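/- Write $\log_1 x=\log x$ and $\log_{k} x=\log_{k-1}(\log x)$ for $k>1$. For $r\ge 1$ and a Dirichlet polynomial $D(s)=\sum_{n\le x}a_n n^{-s}$ with complex coefficients, let $$\|D\|_{\mathcal H_r}=\lim_{T\to\infty}\Big(\frac1{2T}\int_{-T}^{T}|D(it)|^r\,dt\Big)^{1/r};$$ this limit exists, and it is positive when $D\neq0$. Let $1\le p<q<\infty$, and let $\mho(q,p,x)$ be the supremum of $\|D\|_{\mathcal H_q}/\|D\|_{\mathcal H_p}$ over all nonzero Dirichlet polynomials $D(s)=\sum_{n\le x}a_nn^{-s}$. Then, as $x\to\infty$, this supremum is finite and $$\mho(q,p,x)=\exp\left(\frac{\log x}{\log_2 x}\left(\log\sqrt{\frac qp}+O\left(\frac{\log_3x}{\log_2x}\right)\right)\right).$$ Moreover, put $k(x)=\left\lfloor\frac{\log x}{\log_2x+\log_3x}\right\rfloor$ and $n(x)=\pi(x^{1/k(x)})$, where $\pi$ is the prime-counting function, let $\mathfrak p_1<\mathfrak p_2<\cdots$ be the primes, and let $$D_x(s)=\Big(\frac1{\sqrt{n(x)}}\sum_{i=1}^{n(x)}\mathfrak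 p_i^{-s}\Big)^{k(x)},$$ the Dirichlet polynomial obtained from $Q_{n}^{k}$, where $Q_n(z)=n^{-1/2}\sum_{i=1}^n z_i$, $n=n(x)$, $k=k(x)$, by substituting $\mathfrak p_i^{-s}$ for $z_i$. Then, for all sufficiently large $x$, $D_x$ is a nonzero Dirichlet polynomial of the form $\sum_{m\le x}a_mm^{-s}$, and $$\frac{\|D_x\|_{\mathcal H_q}}{\|D_x\|_{\mathcal H_p}}\ \ge\ \exp\left(\frac{\log x}{\log_2 x}\left(\log\sqrt{\frac qp}+O\left(\frac{\log_3x}{\log_2x}\right)\right)\right).$$ The implied constants depend only on $p$ and $q$. -/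

import Mathlib

open Filter Topology Asymptotics

/-- The iterated logarithm: `logIter 1 x = log x` and `logIter (k + 1) x = logIter k (log x)`. -/
noncomputable def logIter (k : ℕ) (x : ℝ) : ℝ := Real.log^[k] x

/-- The Dirichlet polynomials `s ↦ ∑_{1 ≤ n ≤ x} a_n n^{-s}` with complex coefficients. -/
def dirichletPolynomials (x : ℝ) : Set (ℂ → ℂ) :=
  {D | ∃ a : ℕ → ℂ, D = fun s => ∑ n ∈ Finset.Icc 1 ⌊x⌋₊, a n * (n : ℂ) ^ (-s)}

/-- The `p`-mean of `D` over the segment from `-iT` to `iT` of the imaginary axis. -/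
noncomputable def pMean (p : ℝ) (D : ℂ → ℂ) (T : ℝ) : ℝ :=
  (1 / (2 * T) * ∫ t in (-T)..T, ‖D (t * Complex.I)‖ ^ p) ^ (1 / p)

/-- The Hardy norm `‖D‖_{𝓗_p}`: the limit of the `p`-means as `T → ∞`. -/
noncomputable def hardyNorm (p : ℝ) (D : ℂ → ℂ) : ℝ :=
  limUnder atTop (pMean p D)

/-- The quotients `‖D‖_{𝓗_q} / ‖D‖_{𝓗_p}` over the nonzero Dirichlet polynomials of length `x`. -/
def normRatios (q p x : ℝ) : Set ℝ :=
  {r | ∃ D ∈ dirichletPolynomials x, D ≠ 0 ∧ r = hardyNorm q D / hardyNorm p D}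

/-- `℧(q, p, x)`. -/
noncomputable def mho (q p x : ℝ) : ℝ := sSup (normRatios q p x)

/-- The (inverse) Bohr transform of a polynomial in `z_0, z_1, …`: the monomial `z ^ α` becomes
`(∏ p_i ^ α_i) ^ (-s)`, where `p_0 < p_1 < …` are the primes, that is, `p_i ^ (-s)` is
substituted for `z_i`. -/
noncomputable def bohrTransform (P : MvPolynomial ℕ ℂ) : ℂ → ℂ :=
  fun s => MvPolynomial.eval (fun i => (Nat.nth Nat.Prime i : ℂ) ^ (-s)) P

/-- `Q_n = n^{-1/2} (z_0 + ⋯ + z_{n-1})`. -/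
noncomputable def steinhausPoly (n : ℕ) : MvPolynomial ℕ ℂ :=
  MvPolynomial.C ((1 / √(n : ℝ) : ℝ) : ℂ) * ∑ i ∈ Finset.range n, MvPolynomial.X i

/-- `k(x) = ⌊log x / (log₂ x + log₃ x)⌋`. -/
noncomputable def extremalDegree (x : ℝ) : ℕ :=
  ⌊logIter 1 x / (logIter 2 x + logIter 3 x)⌋₊

/-- `n(x) = π(x^{1/k(x)})`. -/
noncomputable def extremalVars (x : ℝ) : ℕ :=
  Nat.primeCounting ⌊x ^ (1 / (extremalDegree x : ℝ))⌋₊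

/-- `D_x`, the Bohr transform of `Q_{n(x)} ^ k(x)`. -/
noncomputable def extremalPoly (x : ℝ) : ℂ → ℂ :=
  bohrTransform (steinhausPoly (extremalVars x) ^ extremalDegree x)

/-! The logarithms of the primes are linearly independent over the integers, so `t ↦ (p_i ^ (-i t))`
equidistributes on the polytorus and the means of a Dirichlet polynomial converge to integrals of
its Bohr lift, an ordinary polynomial in several variables (`tendsto_average_primeFlow`,
`hardyNorm_eq_torusNorm`). On the polytorus, passing from `L^p` to `L^q` costs a factor `√(q/p)` per
degree, and this is sharp to the required order.

Upper bound. Weissler's inequality says that `f ↦ f(√(p/q) z)` is a contraction from `L^p` to `L^q`;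
hence `‖P‖_q ≤ √(q/p)^m ‖P‖_p` for `m`-homogeneous `P`. An integer up to `x` may have about `log x /
log 2` prime factors, which is too many, but apart from the first `s ≈ log x / (log₂ x)^3` primes it
has at most `M ≈ log x / log₂ x` of them. The lift is therefore split into pieces in which the
exponents of the first `s` primes and the degree in the other primes are fixed. In each piece the
small primes contribute a monomial of modulus one; each piece is an average of rotates, so its `L^p`
norm is at most that of the whole; and there are only `exp(O(log x / (log₂ x)^2))` pieces
(`torusNorm_le_of_degrees_le`, `hardyNorm_div_hardyNorm_le`).

Weissler's inequality is proved through entropy. The Poisson operator with parameter `ρ` contracts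
the entropy of a positive density by `ρ^2` (`entropy_re_eval_le`), because the circle averages of
`|Q'|^2 / Re Q` increase with the radius. It is also self-adjoint, so the Gibbs variational
inequality, with `ρ^2 = p/q` and the density `|f(ρz)|^q`, yields the inequality for zero-free `f`.
Zeros are removed by reflection in the circle, and Minkowski's integral inequality gives the step to
several variables.

Lower bound. The `L^r` norm of the `k`-th power of a Steinhaus sum is the `k`-th power of its
`L^{kr}` norm. The `2m`-th moment counts coincidences and lies between `m! n(n-1)⋯(n-m+1)` and `m!
n^m`, so the `L^{kr}` norm is about `√(krn/(2e))`. The quotient is `√(q/p)^k` up to `exp(O(log k +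
k^2/n))` (`exp_le_torusNorm_div_torusNorm`). The chosen `k(x)` is close to `log x / log₂ x` and
still leaves `n(x) ≥ log x / 4` variables, which makes `k^2/n` negligible. -/

/-! ### The Poisson kernel on the unit circle -/

open Real in
-- For unimodular `ζ` and `ξ` the distances `|ξ - ρζ|` and `|ζ - ρξ|` agree. This symmetry makes
-- Poisson averaging self-adjoint.
theorem poissonKernel_mul_comm {ρ : ℝ} {ζ ξ : ℂ} (hζ : ‖ζ‖ = 1) (hξ : ‖ξ‖ = 1) :
    poissonKernel 0 (ρ * ζ) ξ = poissonKernel 0 (ρ * ξ) ζ := by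
  have key : ∀ a b : ℂ, ‖a‖ = 1 → ‖b‖ = 1 →
      ‖a - ρ * b‖ ^ 2 = 1 + ρ ^ 2 - 2 * ρ * (a.re * b.re + a.im * b.im) := by
    intro a b ha hb
    have ha' : a.re * a.re + a.im * a.im = 1 := by
      rw [← Complex.normSq_apply, Complex.normSq_eq_norm_sq, ha]; norm_num
    have hb' : b.re * b.re + b.im * b.im = 1 := by
      rw [← Complex.normSq_apply, Complex.normSq_eq_norm_sq, hb]; norm_num
    rw [← Complex.normSq_eq_norm_sq, Complex.normSq_apply]
    simp only [Complex.sub_re, Complex.mul_re, Complex.ofReal_re, Complex.ofReal_im, Complex.sub_im,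
      Complex.mul_im]
    linear_combination ha' + ρ ^ 2 * hb'
  simp only [poissonKernel_def, sub_zero, norm_mul, hζ, hξ, key ξ ζ hξ hζ, key ζ ξ hζ hξ]
  ring

theorem continuous_poissonKernel_circleMap {ρ : ℝ} (h0 : 0 ≤ ρ) (h1 : ρ < 1) :
    Continuous fun x : ℝ × ℝ =>
      poissonKernel 0 (ρ * circleMap 0 1 x.1) (circleMap 0 1 x.2) := by
  unfold poissonKernel
  refine Continuous.div (by fun_prop) (by fun_prop) fun x => ?_
  simp only [sub_zero]
  have : ‖circleMap 0 1 x.2‖ - ‖ρ * circleMap 0 1 x.1‖ ≤ ‖circleMap 0 1 x.2 - ρ * circleMap 0 1 x.1‖ :=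
    norm_sub_norm_le _ _
  simp only [norm_circleMap_zero, norm_mul, Complex.norm_real, Real.norm_eq_abs, abs_one,
    abs_of_nonneg h0, mul_one] at this
  have h2 : 0 < ‖circleMap 0 1 x.2 - ρ * circleMap 0 1 x.1‖ := by linarith
  positivity

theorem ContinuousOn.continuous_comp_circleMap {E : Type*} [TopologicalSpace E] {G : ℂ → E} {r : ℝ}
    (hG : ContinuousOn G (Metric.sphere 0 |r|)) : Continuous fun θ : ℝ => G (circleMap 0 r θ) :=
  hG.comp_continuous (by fun_prop) fun θ => circleMap_mem_sphere' 0 r θ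

open Real in
-- Fubini and the symmetry of the kernel: Poisson averaging is self-adjoint for the pairing of
-- functions on the circle.
theorem circleAverage_poissonKernel_swap {G₁ G₂ : ℂ → ℝ}
    (h₁ : ContinuousOn G₁ (Metric.sphere 0 1)) (h₂ : ContinuousOn G₂ (Metric.sphere 0 1))
    {ρ : ℝ} (h0 : 0 ≤ ρ) (h1 : ρ < 1) :
    circleAverage (fun ζ => G₁ ζ * circleAverage (poissonKernel 0 (ρ * ζ) • G₂) 0 1) 0 1 =
      circleAverage (fun ξ => G₂ ξ * circleAverage (poissonKernel 0 (ρ * ξ) • G₁) 0 1) 0 1 := by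
  have c₁ : Continuous fun θ : ℝ => G₁ (circleMap 0 1 θ) :=
    ContinuousOn.continuous_comp_circleMap (by simpa using h₁)
  have c₂ : Continuous fun θ : ℝ => G₂ (circleMap 0 1 θ) :=
    ContinuousOn.continuous_comp_circleMap (by simpa using h₂)
  have cK := continuous_poissonKernel_circleMap h0 h1
  simp only [circleAverage_def, smul_eq_mul, Pi.mul_apply, ← intervalIntegral.integral_const_mul]
  rw [MeasureTheory.intervalIntegral_intervalIntegral_swap]
  · refine intervalIntegral.integral_congr fun ξ _ => intervalIntegral.integral_congr fun ζ _ => ?_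
    rw [poissonKernel_mul_comm (ρ := ρ) (by simp) (by simp)]
    ring
  · have : Continuous (fun x : ℝ × ℝ => (2 * π)⁻¹ * (G₁ (circleMap 0 1 x.1) * ((2 * π)⁻¹ *
      (poissonKernel 0 (ρ * circleMap 0 1 x.1) (circleMap 0 1 x.2) * G₂ (circleMap 0 1 x.2))))) :=
      continuous_const.mul ((c₁.comp continuous_fst).mul
        (continuous_const.mul (cK.mul (c₂.comp continuous_snd))))
    exact (this.continuousOn.integrableOn_compact (isCompact_uIcc.prod isCompact_uIcc)).mono_set
      (Set.prod_mono Set.uIoc_subset_uIcc Set.uIoc_subset_uIcc)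

/-! ### Contraction of entropy under the Poisson semigroup -/

/-- Differentiation under the integral sign for a continuous partial derivative. -/
theorem hasDerivAt_intervalIntegral_of_continuousOn {F F' : ℝ → ℝ → ℝ} {U : Set ℝ} (hU : IsOpen U)
    {a b : ℝ} (hF : ∀ r ∈ U, Continuous (F r))
    (hF' : ContinuousOn (Function.uncurry F') (U ×ˢ Set.univ))
    (hd : ∀ r ∈ U, ∀ θ, HasDerivAt (fun r => F r θ) (F' r θ) r) {r₀ : ℝ} (hr₀ : r₀ ∈ U) :
    HasDerivAt (fun r => ∫ θ in a..b, F r θ) (∫ θ in a..b, F' r₀ θ) r₀ := by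
  obtain ⟨ε, hε, hεU⟩ := Metric.isOpen_iff.1 hU r₀ hr₀
  have hsub : Metric.closedBall r₀ (ε / 2) ⊆ U :=
    (Metric.closedBall_subset_ball (by linarith)).trans hεU
  have hK : IsCompact (Metric.closedBall r₀ (ε / 2) ×ˢ Set.uIcc a b) :=
    (isCompact_closedBall _ _).prod isCompact_uIcc
  obtain ⟨C, hC⟩ := hK.exists_bound_of_continuousOn (f := Function.uncurry F')
    (hF'.mono (Set.prod_mono hsub (Set.subset_univ _)))
  have hc : Continuous (F' r₀) := by
    refine continuous_iff_continuousAt.2 fun θ => ?_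
    have h1 : ContinuousAt (Function.uncurry F') (r₀, θ) :=
      hF'.continuousAt ((hU.prod isOpen_univ).mem_nhds ⟨hr₀, Set.mem_univ _⟩)
    exact ContinuousAt.comp (f := fun t => (r₀, t)) h1 (by fun_prop)
  refine (intervalIntegral.hasDerivAt_integral_of_dominated_loc_of_deriv_le
    (bound := fun _ => C) (Metric.closedBall_mem_nhds r₀ (half_pos hε)) ?_ ?_ ?_ ?_ ?_ ?_).2
  · filter_upwards [hU.mem_nhds hr₀] with r hr
    exact (hF r hr).aestronglyMeasurable
  · exact (hF r₀ hr₀).intervalIntegrable _ _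
  · exact hc.aestronglyMeasurable
  · exact Filter.Eventually.of_forall fun t ht x hx => hC (x, t) ⟨hx, Set.uIoc_subset_uIcc ht⟩
  · exact intervalIntegrable_const
  · exact Filter.Eventually.of_forall fun t _ x hx => hd x (hsub hx) t

/-- If `A` satisfies `r A' = B` and `B' = r m` with `m` increasing, then `(A r - A 0) / r ^ 2` is
increasing. -/
theorem sub_le_sq_mul_sub_of_monotoneOn {A B m : ℝ → ℝ}
    (hA : ∀ r ∈ Set.Ioo (0 : ℝ) 1, HasDerivAt A (B r / r) r)
    (hB : ∀ r ∈ Set.Ioo (0 : ℝ) 1, HasDerivAt B (r * m r) r)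
    (hAc : ContinuousOn A (Set.Icc 0 1)) (hBc : ContinuousOn B (Set.Ico 0 1)) (hB0 : B 0 = 0)
    (hm : MonotoneOn m (Set.Ico 0 1)) {r : ℝ} (hr : r ∈ Set.Ioc (0 : ℝ) 1) :
    A r - A 0 ≤ r ^ 2 * (A 1 - A 0) := by
  -- `B R` is the integral of `s * m s` over `[0, R]`; bound `m s` by its largest value `m R`.
  have h1 : ∀ R ∈ Set.Ioo (0 : ℝ) 1, 2 * B R ≤ R * (R * m R) := by
    intro R hR
    have hanti : AntitoneOn (fun s => B s - s ^ 2 / 2 * m R) (Set.Icc 0 R) := by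
      refine antitoneOn_of_hasDerivWithinAt_nonpos (convex_Icc 0 R) (f' := fun s => s * m s - s * m R) ?_ ?_ ?_
      · refine (hBc.mono fun s hs => ⟨hs.1, hs.2.trans_lt hR.2⟩).sub (by fun_prop)
      · intro s hs
        rw [interior_Icc] at hs
        have := (hB s ⟨hs.1, hs.2.trans hR.2⟩).sub
          ((((hasDerivAt_id s).pow 2).div_const 2).mul_const (m R))
        refine (this.congr_deriv ?_).hasDerivWithinAt
        simp
      · intro s hs
        rw [interior_Icc] at hs
        have := hm ⟨hs.1.le, hs.2.trans hR.2⟩ ⟨hR.1.le, hR.2⟩ hs.2.le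
        nlinarith [hs.1]
    have := hanti ⟨le_rfl, hR.1.le⟩ ⟨hR.1.le, le_rfl⟩ hR.1.le
    simp only [hB0] at this
    nlinarith
  -- The derivative of `B - 2 * A` is `s * m s - 2 * B s / s`, which is nonnegative by `h1`. In turn
  -- `h2` is the sign of the derivative of `(A s - A 0) / s ^ 2`.
  have h2 : ∀ R ∈ Set.Ioo (0 : ℝ) 1, 2 * (A R - A 0) ≤ B R := by
    intro R hR
    have hmono : MonotoneOn (fun s => B s - 2 * A s) (Set.Ico 0 1) := by
      refine monotoneOn_of_hasDerivWithinAt_nonneg (convex_Ico 0 1) (f' := fun s => s * m s - 2 * (B s / s)) ?_ ?_ ?_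
      · exact hBc.sub (continuousOn_const.mul (hAc.mono Set.Ico_subset_Icc_self))
      · intro s hs
        rw [interior_Ico] at hs
        exact ((hB s hs).sub ((hA s hs).const_mul 2)).hasDerivWithinAt
      · intro s hs
        rw [interior_Ico] at hs
        have := h1 s hs
        have hs0 := hs.1
        rw [sub_nonneg, mul_div_assoc', div_le_iff₀ hs0]
        linarith
    have := hmono ⟨le_rfl, zero_lt_one⟩ ⟨hR.1.le, hR.2⟩ hR.1.le
    simp only [hB0] at this
    linarith
  have hmono : MonotoneOn (fun s => (A s - A 0) / s ^ 2) (Set.Ioc 0 1) := by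
    refine monotoneOn_of_hasDerivWithinAt_nonneg (convex_Ioc 0 1)
      (f' := fun s => (B s / s * s ^ 2 - (A s - A 0) * (2 * s)) / (s ^ 2) ^ 2) ?_ ?_ ?_
    · refine ((hAc.mono Set.Ioc_subset_Icc_self).sub continuousOn_const).div (by fun_prop) ?_
      intro s hs
      have := hs.1
      positivity
    · intro s hs
      rw [interior_Ioc] at hs
      have hs0 := hs.1
      have := ((hA s hs).sub_const (A 0)).div ((hasDerivAt_id s).pow 2) (by simp; positivity)
      refine (this.congr_deriv ?_).hasDerivWithinAt
      simp
    · intro s hs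
      rw [interior_Ioc] at hs
      have hs0 := hs.1
      have := h2 s hs
      apply div_nonneg _ (by positivity)
      have : B s / s * s ^ 2 = B s * s := by field_simp
      rw [this]
      nlinarith
  have := hmono hr ⟨zero_lt_one, le_rfl⟩ hr.2
  simp only [one_pow, div_one] at this
  have hr0 := hr.1
  rwa [div_le_iff₀ (by positivity), mul_comm] at this

open Polynomial in
/-- The radial integral `∫ h log h` of `h = Re Q`, its logarithmic derivative in the radius, and the
derivative of the latter. -/
theorem hasDerivAt_integral_re_mul_log (Q : ℂ[X])
    (hQ : ∀ z ∈ Metric.ball (0 : ℂ) 1, 0 < (Q.eval z).re) {r : ℝ} (hr : r ∈ Set.Ioo (0 : ℝ) 1) :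
    HasDerivAt (fun r => ∫ θ in (0 : ℝ)..2 * Real.pi,
        (Q.eval (circleMap 0 r θ)).re * Real.log (Q.eval (circleMap 0 r θ)).re)
      ((∫ θ in (0 : ℝ)..2 * Real.pi, (circleMap 0 r θ * Q.derivative.eval (circleMap 0 r θ)).re *
        (Real.log (Q.eval (circleMap 0 r θ)).re + 1)) / r) r ∧
    HasDerivAt (fun r => ∫ θ in (0 : ℝ)..2 * Real.pi,
        (circleMap 0 r θ * Q.derivative.eval (circleMap 0 r θ)).re *
        (Real.log (Q.eval (circleMap 0 r θ)).re + 1))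
      (r * ∫ θ in (0 : ℝ)..2 * Real.pi, ‖Q.derivative.eval (circleMap 0 r θ)‖ ^ 2 /
        (Q.eval (circleMap 0 r θ)).re) r := by
  have hpos : ∀ r ∈ Set.Ioo (-1 : ℝ) 1, ∀ θ, 0 < (Q.eval (circleMap 0 r θ)).re := fun r hr θ =>
    hQ _ (by simpa [abs_lt] using hr)
  have hcm : Continuous fun x : ℝ × ℝ => circleMap 0 x.1 x.2 := by fun_prop
  have hQc : Continuous fun x : ℝ × ℝ => (Q.eval (circleMap 0 x.1 x.2)).re := by fun_prop
  have hQ' : Continuous fun x : ℝ × ℝ => Q.derivative.eval (circleMap 0 x.1 x.2) := by fun_prop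
  have hQ'' : Continuous fun x : ℝ × ℝ => Q.derivative.derivative.eval (circleMap 0 x.1 x.2) := by
    fun_prop
  have hlog : ContinuousOn (fun x : ℝ × ℝ => Real.log (Q.eval (circleMap 0 x.1 x.2)).re)
      (Set.Ioo (-1 : ℝ) 1 ×ˢ Set.univ) :=
    hQc.continuousOn.log fun x hx => (hpos x.1 hx.1 x.2).ne'
  have hlogθ : ∀ r ∈ Set.Ioo (-1 : ℝ) 1,
      Continuous fun θ : ℝ => Real.log (Q.eval (circleMap 0 r θ)).re := fun r hr =>
    Continuous.log (by fun_prop) fun θ => (hpos r hr θ).ne'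
  have hcr : ∀ r θ : ℝ, HasDerivAt (fun r : ℝ => circleMap 0 r θ) (circleMap 0 1 θ) r := by
    intro r θ
    simp only [circleMap, zero_add, Complex.ofReal_one]
    exact (Complex.ofRealCLM.hasDerivAt (x := r)).mul_const _
  have hdr : ∀ (P : ℂ[X]) (r θ : ℝ), HasDerivAt (fun r : ℝ => P.eval (circleMap 0 r θ))
      (P.derivative.eval (circleMap 0 r θ) * circleMap 0 1 θ) r := fun P r θ =>
    (P.hasDerivAt _).comp r (hcr r θ)
  have hdθ : ∀ (P : ℂ[X]) (r θ : ℝ), HasDerivAt (fun θ : ℝ => P.eval (circleMap 0 r θ))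
      (P.derivative.eval (circleMap 0 r θ) * (circleMap 0 r θ * Complex.I)) θ := fun P r θ =>
    (P.hasDerivAt _).comp θ (hasDerivAt_circleMap 0 r θ)
  have hre : ∀ {f : ℝ → ℂ} {f' : ℂ} {x : ℝ}, HasDerivAt f f' x →
      HasDerivAt (fun x => (f x).re) f'.re x := fun h => Complex.reCLM.hasFDerivAt.comp_hasDerivAt _ h
  have him : ∀ {f : ℝ → ℂ} {f' : ℂ} {x : ℝ}, HasDerivAt f f' x →
      HasDerivAt (fun x => (f x).im) f'.im x := fun h => Complex.imCLM.hasFDerivAt.comp_hasDerivAt _ h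
  have hrr : r ∈ Set.Ioo (-1 : ℝ) 1 := ⟨by linarith [hr.1], hr.2⟩
  have hr0 : r ≠ 0 := hr.1.ne'
  have hcm1 : ∀ θ, circleMap 0 r θ = r * circleMap 0 1 θ := fun θ => by simp [circleMap]
  constructor
  · have := hasDerivAt_intervalIntegral_of_continuousOn (isOpen_Ioo (a := (-1 : ℝ)) (b := 1))
      (F := fun r θ => (Q.eval (circleMap 0 r θ)).re * Real.log (Q.eval (circleMap 0 r θ)).re)
      (F' := fun r θ => (Q.derivative.eval (circleMap 0 r θ) * circleMap 0 1 θ).re *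
        (Real.log (Q.eval (circleMap 0 r θ)).re + 1)) (a := 0) (b := 2 * Real.pi) ?_ ?_ ?_ hrr
    · refine this.congr_deriv ?_
      rw [eq_div_iff hr0, ← intervalIntegral.integral_mul_const]
      refine intervalIntegral.integral_congr fun θ _ => ?_
      simp only [hcm1 θ]
      simp
      ring
    · intro r hr
      exact (hQc.comp (continuous_const.prodMk continuous_id)).mul (hlogθ r hr)
    · exact ContinuousOn.mul (by fun_prop) (hlog.add continuousOn_const)
    · intro r hr θ
      have h1 := hre (hdr Q r θ)
      refine (h1.mul (h1.log (hpos r hr θ).ne')).congr_deriv ?_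
      have := (hpos r hr θ).ne'
      field_simp
  · have := hasDerivAt_intervalIntegral_of_continuousOn (isOpen_Ioo (a := (-1 : ℝ)) (b := 1))
      (F := fun r θ => (circleMap 0 r θ * Q.derivative.eval (circleMap 0 r θ)).re *
        (Real.log (Q.eval (circleMap 0 r θ)).re + 1))
      (F' := fun r θ => (circleMap 0 1 θ * Q.derivative.eval (circleMap 0 r θ) +
          circleMap 0 r θ * (Q.derivative.derivative.eval (circleMap 0 r θ) * circleMap 0 1 θ)).re *
        (Real.log (Q.eval (circleMap 0 r θ)).re + 1) +
        (circleMap 0 r θ * Q.derivative.eval (circleMap 0 r θ)).re *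
        ((Q.derivative.eval (circleMap 0 r θ) * circleMap 0 1 θ).re / (Q.eval (circleMap 0 r θ)).re))
      (a := 0) (b := 2 * Real.pi) ?_ ?_ ?_ hrr
    · refine this.congr_deriv ?_
      -- Up to sign this is the angular derivative of `h log h`, where `h = Re Q`. In polar form, `Δ
      -- (h log h) = |∇h|^2 / h` for harmonic `h`; that is the identity `hEq`. The angular second
      -- derivative integrates to zero over a period, so only the radial part and `r^2 |Q'|^2 / h`
      -- remain.
      have hd : ∀ θ : ℝ, HasDerivAt (fun θ => (circleMap 0 r θ * Q.derivative.eval (circleMap 0 r θ)).im *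
          (Real.log (Q.eval (circleMap 0 r θ)).re + 1)) _ θ := fun θ =>
        (him ((hasDerivAt_circleMap 0 r θ).mul (hdθ Q.derivative r θ))).mul
          (((hre (hdθ Q r θ)).log (hpos r hrr θ).ne').add_const 1)
      have hF : Continuous fun θ => (circleMap 0 1 θ * Q.derivative.eval (circleMap 0 r θ) +
          circleMap 0 r θ * (Q.derivative.derivative.eval (circleMap 0 r θ) * circleMap 0 1 θ)).re *
          (Real.log (Q.eval (circleMap 0 r θ)).re + 1) +
          (circleMap 0 r θ * Q.derivative.eval (circleMap 0 r θ)).re *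
          ((Q.derivative.eval (circleMap 0 r θ) * circleMap 0 1 θ).re /
            (Q.eval (circleMap 0 r θ)).re) := by
        refine (Continuous.mul (by fun_prop) ((hlogθ r hrr).add continuous_const)).add
          (Continuous.mul (by fun_prop) (Continuous.div (by fun_prop) (by fun_prop)
            fun θ => (hpos r hrr θ).ne'))
      have hM : Continuous fun θ => ‖Q.derivative.eval (circleMap 0 r θ)‖ ^ 2 /
          (Q.eval (circleMap 0 r θ)).re :=
        Continuous.div (by fun_prop) (by fun_prop) fun θ => (hpos r hrr θ).ne'
      have hEq : ∀ θ, r * ((circleMap 0 1 θ * Q.derivative.eval (circleMap 0 r θ) +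
          circleMap 0 r θ * (Q.derivative.derivative.eval (circleMap 0 r θ) * circleMap 0 1 θ)).re *
          (Real.log (Q.eval (circleMap 0 r θ)).re + 1) +
          (circleMap 0 r θ * Q.derivative.eval (circleMap 0 r θ)).re *
          ((Q.derivative.eval (circleMap 0 r θ) * circleMap 0 1 θ).re /
            (Q.eval (circleMap 0 r θ)).re)) - r * (r * (‖Q.derivative.eval (circleMap 0 r θ)‖ ^ 2 /
          (Q.eval (circleMap 0 r θ)).re)) =
          (circleMap 0 r θ * Complex.I * Q.derivative.eval (circleMap 0 r θ) + circleMap 0 r θ *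
            (Q.derivative.derivative.eval (circleMap 0 r θ) * (circleMap 0 r θ * Complex.I))).im *
            (Real.log (Q.eval (circleMap 0 r θ)).re + 1) +
          (circleMap 0 r θ * Q.derivative.eval (circleMap 0 r θ)).im *
            ((Q.derivative.eval (circleMap 0 r θ) * (circleMap 0 r θ * Complex.I)).re /
              (Q.eval (circleMap 0 r θ)).re) := by
        intro θ
        have hn : (circleMap 0 1 θ).re ^ 2 + (circleMap 0 1 θ).im ^ 2 = 1 := by
          rw [sq, sq, ← Complex.normSq_apply, Complex.normSq_eq_norm_sq]
          simp
        rw [← Complex.normSq_eq_norm_sq, Complex.normSq_apply, hcm1 θ]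
        have h0 := (hpos r hrr θ).ne'
        rw [hcm1 θ] at h0
        generalize circleMap 0 1 θ = w at *
        generalize Real.log _ = l
        generalize eval _ Q.derivative = a
        generalize eval _ Q.derivative.derivative = b
        generalize (eval _ Q).re = c at *
        simp only [Complex.add_re, Complex.mul_re, Complex.mul_im, Complex.add_im, Complex.I_re,
          Complex.I_im, Complex.ofReal_re, Complex.ofReal_im]
        field_simp
        linear_combination (r ^ 2 * (a.re ^ 2 + a.im ^ 2)) * hn
      have hper := intervalIntegral.integral_eq_sub_of_hasDerivAt (a := 0) (b := 2 * Real.pi)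
        (fun θ _ => hd θ) ?_
      · simp only [(periodic_circleMap 0 r).eq, sub_self] at hper
        rw [← sub_eq_zero, ← mul_right_inj' hr0, mul_zero]
        refine Eq.trans ?_ hper
        rw [mul_sub, ← intervalIntegral.integral_const_mul, ← intervalIntegral.integral_const_mul,
          ← intervalIntegral.integral_const_mul, ← intervalIntegral.integral_sub]
        · exact intervalIntegral.integral_congr fun θ _ => hEq θ
        · exact (hF.const_mul r).intervalIntegrable _ _
        · exact ((hM.const_mul r).const_mul r).intervalIntegrable _ _
      · refine Continuous.intervalIntegrable ?_ _ _
        convert (hF.const_mul r).sub ((hM.const_mul r).const_mul r) using 2 with θ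
        exact (hEq θ).symm
    · intro r hr
      exact Continuous.mul (by fun_prop) ((hlogθ r hr).add continuous_const)
    · refine (ContinuousOn.mul (by fun_prop) (hlog.add continuousOn_const)).add
        (ContinuousOn.mul (by fun_prop) (ContinuousOn.div (by fun_prop) (by fun_prop)
          fun x hx => (hpos x.1 hx.1 x.2).ne'))
    · intro r hr θ
      exact (hre ((hcr r θ).mul (hdr Q.derivative r θ))).mul
        (((hre (hdr Q r θ)).log (hpos r hr θ).ne').add_const 1)

theorem poissonKernel_nonneg_of_norm_eq_one {ρ : ℝ} (h0 : 0 ≤ ρ) (h1 : ρ < 1) {ζ ξ : ℂ} (hζ : ‖ζ‖ = 1)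
    (hξ : ‖ξ‖ = 1) : 0 ≤ poissonKernel 0 (ρ * ζ) ξ := by
  rw [poissonKernel_def]
  simp only [sub_zero, norm_mul, hζ, hξ, Complex.norm_real, Real.norm_eq_abs, abs_of_nonneg h0]
  exact div_nonneg (by nlinarith) (by positivity)

theorem continuous_poissonKernel_circleMap_right {ρ : ℝ} (h0 : 0 ≤ ρ) (h1 : ρ < 1) {ζ : ℂ}
    (hζ : ‖ζ‖ = 1) : Continuous fun θ : ℝ => poissonKernel 0 (ρ * ζ) (circleMap 0 1 θ) := by
  obtain ⟨t, rfl⟩ : ∃ t : ℝ, circleMap 0 1 t = ζ := by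
    refine ⟨Complex.arg ζ, ?_⟩
    have := Complex.norm_mul_exp_arg_mul_I ζ
    simpa [circleMap, hζ] using this
  exact (continuous_poissonKernel_circleMap h0 h1).comp (f := fun θ : ℝ => (t, θ)) (by fun_prop)

theorem mul_mem_unitBall {ρ : ℝ} (h0 : 0 ≤ ρ) (h1 : ρ < 1) {ζ : ℂ} (hζ : ‖ζ‖ = 1) :
    (ρ * ζ : ℂ) ∈ Metric.ball (0 : ℂ) 1 := by
  simpa [hζ, abs_of_nonneg h0] using h1

open Real in
theorem circleAverage_poissonKernel_eq_one {ρ : ℝ} (h0 : 0 ≤ ρ) (h1 : ρ < 1) {ζ : ℂ} (hζ : ‖ζ‖ = 1) :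
    circleAverage (poissonKernel 0 (ρ * ζ) • fun _ => (1 : ℝ)) 0 1 = 1 :=
  InnerProductSpace.HarmonicOnNhd.circleAverage_poissonKernel_smul (f := fun _ => (1 : ℝ))
    (fun _ _ => InnerProductSpace.harmonicAt_const 1) (mul_mem_unitBall h0 h1 hζ)

open Real in
/-- Averages over circles are not changed by Poisson averaging. -/
theorem circleAverage_circleAverage_poissonKernel {G : ℂ → ℝ} (hG : ContinuousOn G (Metric.sphere 0 1))
    {ρ : ℝ} (h0 : 0 ≤ ρ) (h1 : ρ < 1) :
    circleAverage (fun ζ => circleAverage (poissonKernel 0 (ρ * ζ) • G) 0 1) 0 1 =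
      circleAverage G 0 1 := by
  have := circleAverage_poissonKernel_swap (continuousOn_const (c := (1 : ℝ))) hG h0 h1
  simp only [one_mul] at this
  rw [this]
  refine circleAverage_congr_sphere fun ζ hζ => ?_
  have hζ : ‖ζ‖ = 1 := by simpa using hζ
  simp only [circleAverage_poissonKernel_eq_one h0 h1 hζ, mul_one]

open Polynomial in
theorem harmonicOnNhd_re_eval (Q : ℂ[X]) (s : Set ℂ) :
    InnerProductSpace.HarmonicOnNhd (fun z => (Q.eval z).re) s := fun z _ => by
  have h : AnalyticAt ℂ (fun z => Q.eval z) z := by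
    simpa [aeval_def, eval₂_eq_eval_map] using AnalyticAt.aeval_polynomial (analyticAt_id (𝕜 := ℂ) (z := z)) Q
  exact h.harmonicAt_re

open Real in
/-- Jensen's inequality for the convex function `(a, h) ↦ |a| ^ 2 / h` and the Poisson kernel. -/
theorem norm_sq_div_re_le_circleAverage (a Q : Polynomial ℂ)
    (hQ : ∀ z ∈ Metric.closedBall (0 : ℂ) 1, 0 < (Q.eval z).re) {ρ : ℝ} (h0 : 0 ≤ ρ) (h1 : ρ < 1)
    {ζ : ℂ} (hζ : ‖ζ‖ = 1) :
    ‖a.eval (ρ * ζ)‖ ^ 2 / (Q.eval (ρ * ζ)).re ≤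
      circleAverage (poissonKernel 0 (ρ * ζ) • fun ξ => ‖a.eval ξ‖ ^ 2 / (Q.eval ξ).re) 0 1 := by
  have hw := mul_mem_unitBall h0 h1 hζ
  set w : ℂ := ρ * ζ
  have hK := continuous_poissonKernel_circleMap_right h0 h1 hζ
  have hK0 : ∀ θ : ℝ, 0 ≤ poissonKernel 0 w (circleMap 0 1 θ) := fun θ =>
    poissonKernel_nonneg_of_norm_eq_one h0 h1 hζ (by simp)
  have hH : 0 < (Q.eval w).re := hQ _ (Metric.ball_subset_closedBall hw)
  have hQ1 : ∀ θ : ℝ, 0 < (Q.eval (circleMap 0 1 θ)).re := fun θ => hQ _ (by simp)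
  have hQw : circleAverage (poissonKernel 0 w • fun z => (Q.eval z).re) 0 1 = (Q.eval w).re :=
    (harmonicOnNhd_re_eval Q _).circleAverage_poissonKernel_smul hw
  have haw : circleAverage (poissonKernel 0 w • fun z => a.eval z) 0 1 = a.eval w :=
    DiffContOnCl.circleAverage_poissonKernel_smul a.differentiable.diffContOnCl hw
  -- The convex function `|a|^2 / h` lies above `2 t |a| - t^2 h` for every `t`, and this `t` gives
  -- equality at the point `w`. Averaging the linear minorant against the kernel gives Jensen's
  -- inequality directly.
  set t := ‖a.eval w‖ / (Q.eval w).re with ht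
  have cS : Continuous fun θ : ℝ => poissonKernel 0 w (circleMap 0 1 θ) *
      (‖a.eval (circleMap 0 1 θ)‖ ^ 2 / (Q.eval (circleMap 0 1 θ)).re) :=
    hK.mul (Continuous.div (by fun_prop) (by fun_prop) fun θ => (hQ1 θ).ne')
  have cH : Continuous fun θ : ℝ => poissonKernel 0 w (circleMap 0 1 θ) *
      (Q.eval (circleMap 0 1 θ)).re := hK.mul (by fun_prop)
  have cN : Continuous fun θ : ℝ => poissonKernel 0 w (circleMap 0 1 θ) *
      ‖a.eval (circleMap 0 1 θ)‖ := hK.mul (by fun_prop)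
  have e1 : ‖a.eval w‖ ≤ (2 * π)⁻¹ * ∫ θ in 0..2 * π, poissonKernel 0 w (circleMap 0 1 θ) *
      ‖a.eval (circleMap 0 1 θ)‖ := by
    rw [← haw, circleAverage_def, norm_smul, norm_of_nonneg (by positivity)]
    gcongr
    refine (intervalIntegral.norm_integral_le_integral_norm (by positivity)).trans_eq ?_
    refine intervalIntegral.integral_congr fun θ _ => ?_
    simp [abs_of_nonneg (hK0 θ)]
  have e2 : 2 * t * ((2 * π)⁻¹ * ∫ θ in 0..2 * π, poissonKernel 0 w (circleMap 0 1 θ) *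
      ‖a.eval (circleMap 0 1 θ)‖) ≤
      circleAverage (poissonKernel 0 w • fun ξ => ‖a.eval ξ‖ ^ 2 / (Q.eval ξ).re) 0 1 +
        t ^ 2 * (Q.eval w).re := by
    rw [← hQw]
    simp only [circleAverage_def, smul_eq_mul, Pi.mul_apply]
    have e : ∀ A B C : ℝ, 2 * t * B ≤ A + t ^ 2 * C →
        2 * t * ((2 * π)⁻¹ * B) ≤ (2 * π)⁻¹ * A + t ^ 2 * ((2 * π)⁻¹ * C) := by
      intro A B C h
      have := mul_le_mul_of_nonneg_left h (by positivity : 0 ≤ (2 * π)⁻¹)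
      linarith
    refine e _ _ _ ?_
    rw [← intervalIntegral.integral_const_mul, ← intervalIntegral.integral_const_mul,
      ← intervalIntegral.integral_add (cS.intervalIntegrable _ _)
      ((cH.const_mul _).intervalIntegrable _ _)]
    refine intervalIntegral.integral_mono (by positivity) ((cN.const_mul _).intervalIntegrable _ _)
      ((cS.add (cH.const_mul _)).intervalIntegrable _ _) fun θ => ?_
    have h := hQ1 θ
    have hk := hK0 θ
    have : 2 * t * ‖a.eval (circleMap 0 1 θ)‖ ≤
        ‖a.eval (circleMap 0 1 θ)‖ ^ 2 / (Q.eval (circleMap 0 1 θ)).re +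
          t ^ 2 * (Q.eval (circleMap 0 1 θ)).re := by
      rw [div_add' _ _ _ h.ne', le_div_iff₀ h]
      nlinarith [sq_nonneg (‖a.eval (circleMap 0 1 θ)‖ - t * (Q.eval (circleMap 0 1 θ)).re)]
    simp only
    nlinarith
  have ht0 : 0 ≤ t := by positivity
  have e3 := mul_le_mul_of_nonneg_left e1 (by positivity : 0 ≤ 2 * t)
  have e4 : t * ‖a.eval w‖ = ‖a.eval w‖ ^ 2 / (Q.eval w).re := by rw [ht]; ring
  have e5 : t ^ 2 * (Q.eval w).re = ‖a.eval w‖ ^ 2 / (Q.eval w).re := by rw [ht]; field_simp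
  linarith

open Real in
-- `|a|^2 / Re Q` lies below its Poisson averages, and Poisson averaging preserves the mean over the
-- circle. Rescaling the larger circle to the unit circle turns this into a comparison of two radii.
-- It is needed for `a = Q'`.
theorem monotoneOn_circleAverage_norm_sq_div_re (a Q : Polynomial ℂ)
    (hQ : ∀ z ∈ Metric.ball (0 : ℂ) 1, 0 < (Q.eval z).re) :
    MonotoneOn (fun r => circleAverage (fun ξ => ‖a.eval ξ‖ ^ 2 / (Q.eval ξ).re) 0 r)
      (Set.Ico 0 1) := by
  intro r hr R hR hrR
  rcases hrR.eq_or_lt with rfl | hlt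
  · exact le_rfl
  have hR0 : 0 < R := hr.1.trans_lt hlt
  set ρ := r / R with hρ
  have h0 : 0 ≤ ρ := div_nonneg hr.1 hR0.le
  have h1 : ρ < 1 := (div_lt_one hR0).2 hlt
  set P : Polynomial ℂ := Q.comp (Polynomial.C (R : ℂ) * Polynomial.X)
  set b : Polynomial ℂ := a.comp (Polynomial.C (R : ℂ) * Polynomial.X)
  have hP : ∀ z ∈ Metric.closedBall (0 : ℂ) 1, 0 < (P.eval z).re := by
    intro z hz
    simp only [P, Polynomial.eval_comp, Polynomial.eval_mul, Polynomial.eval_C, Polynomial.eval_X]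
    refine hQ _ ?_
    simp only [mem_closedBall_zero_iff] at hz
    simp only [mem_ball_zero_iff, norm_mul, Complex.norm_real, norm_of_nonneg hR.1]
    nlinarith [hR.2]
  have hPc : ContinuousOn (fun ξ => ‖b.eval ξ‖ ^ 2 / (P.eval ξ).re) (Metric.closedBall 0 1) :=
    ContinuousOn.div (by fun_prop) (by fun_prop) fun z hz => (hP z hz).ne'
  have key := circleAverage_circleAverage_poissonKernel (hPc.mono Metric.sphere_subset_closedBall) h0 h1
  have hRr : ((R : ℂ) * ρ) = r := by
    rw [hρ, Complex.ofReal_div]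
    exact mul_div_cancel₀ _ (by exact_mod_cast hR0.ne')
  have e1 : circleAverage (fun ξ => ‖a.eval ξ‖ ^ 2 / (Q.eval ξ).re) 0 R =
      circleAverage (fun ξ => ‖b.eval ξ‖ ^ 2 / (P.eval ξ).re) 0 1 := by
    rw [circleAverage_eq_circleAverage_zero_one]
    simp [P, b]
  have e2 : circleAverage (fun ξ => ‖a.eval ξ‖ ^ 2 / (Q.eval ξ).re) 0 r =
      circleAverage (fun ξ => ‖b.eval (ρ * ξ)‖ ^ 2 / (P.eval (ρ * ξ)).re) 0 1 := by
    rw [circleAverage_eq_circleAverage_zero_one]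
    simp [P, b, ← mul_assoc, hRr]
  simp only
  rw [e1, e2, ← key]
  have hmem : ∀ ξ ∈ Metric.sphere (0 : ℂ) |1|, ‖ξ‖ = 1 := fun ξ hξ => by simpa using hξ
  have hmap : Set.MapsTo (fun ξ : ℂ => (ρ : ℂ) * ξ) (Metric.sphere 0 |1|) (Metric.closedBall 0 1) :=
    fun ξ hξ => Metric.ball_subset_closedBall (mul_mem_unitBall h0 h1 (hmem ξ hξ))
  refine circleAverage_mono ?_ ?_ fun ζ hζ =>
    norm_sq_div_re_le_circleAverage b P hP h0 h1 (hmem ζ hζ)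
  · exact (hPc.comp (by fun_prop) hmap).circleIntegrable'
  · have hs : ContinuousOn (fun ξ => ‖b.eval ξ‖ ^ 2 / (P.eval ξ).re) (Metric.sphere 0 |1|) :=
      hPc.mono (by rw [abs_one]; exact Metric.sphere_subset_closedBall)
    have c := hs.continuous_comp_circleMap
    have hK : Continuous fun x : ℝ × ℝ => poissonKernel 0 (ρ * circleMap 0 1 x.1) (circleMap 0 1 x.2) *
        (‖b.eval (circleMap 0 1 x.2)‖ ^ 2 / (P.eval (circleMap 0 1 x.2)).re) :=
      (continuous_poissonKernel_circleMap h0 h1).mul (c.comp continuous_snd)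
    have h := intervalIntegral.continuous_parametric_intervalIntegral_of_continuous' (μ := MeasureTheory.volume)
      (f := fun θ ψ : ℝ => poissonKernel 0 (ρ * circleMap 0 1 θ) (circleMap 0 1 ψ) *
        (‖b.eval (circleMap 0 1 ψ)‖ ^ 2 / (P.eval (circleMap 0 1 ψ)).re)) hK 0 (2 * π)
    exact (h.const_smul (2 * π)⁻¹).intervalIntegrable (μ := MeasureTheory.volume) 0 (2 * π)

open Real in
/-- The entropy of a positive function on the circle contracts by `ρ ^ 2` under the Poisson
semigroup. -/
theorem entropy_re_eval_le (Q : Polynomial ℂ)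
    (hQ : ∀ z ∈ Metric.closedBall (0 : ℂ) 1, 0 < (Q.eval z).re) {ρ : ℝ} (hρ : ρ ∈ Set.Ioc (0 : ℝ) 1) :
    circleAverage (fun z => (Q.eval (ρ * z)).re * log (Q.eval (ρ * z)).re) 0 1 -
        (Q.eval 0).re * log (Q.eval 0).re ≤
      ρ ^ 2 * (circleAverage (fun z => (Q.eval z).re * log (Q.eval z).re) 0 1 -
        (Q.eval 0).re * log (Q.eval 0).re) := by
  have hQ' : ∀ z ∈ Metric.ball (0 : ℂ) 1, 0 < (Q.eval z).re := fun z hz =>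
    hQ z (Metric.ball_subset_closedBall hz)
  have hpos : ∀ r ∈ Set.Icc (0 : ℝ) 1, ∀ θ, 0 < (Q.eval (circleMap 0 r θ)).re := fun r hr θ =>
    hQ _ (by simpa [abs_of_nonneg hr.1] using hr.2)
  have hlog : ContinuousOn (fun x : ℝ × ℝ => log (Q.eval (circleMap 0 x.1 x.2)).re)
      (Set.Icc 0 1 ×ˢ Set.univ) :=
    ContinuousOn.log (by fun_prop) fun x hx => (hpos x.1 hx.1 x.2).ne'
  have hcont : ∀ a : ℂ → ℝ, Continuous a → ∀ b : ℝ → ℝ, Continuous b →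
      ContinuousOn (fun r => ∫ θ in (0 : ℝ)..2 * π, a (circleMap 0 r θ) *
        b (log (Q.eval (circleMap 0 r θ)).re)) (Set.Icc 0 1) := by
    intro a ha b hb
    rw [continuousOn_iff_continuous_domRestrict]
    refine intervalIntegral.continuous_parametric_intervalIntegral_of_continuous'
      (f := fun (r : Set.Icc (0 : ℝ) 1) θ => a (circleMap 0 r θ) *
        b (log (Q.eval (circleMap 0 r θ)).re)) ?_ 0 (2 * π)
    refine Continuous.mul (ha.comp (by fun_prop)) (hb.comp ?_)
    exact hlog.comp_continuous (f := fun x : Set.Icc (0 : ℝ) 1 × ℝ => ((x.1 : ℝ), x.2)) (by fun_prop)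
      fun x => ⟨x.1.2, Set.mem_univ _⟩
  have key := sub_le_sq_mul_sub_of_monotoneOn (fun r hr => (hasDerivAt_integral_re_mul_log Q hQ' hr).1)
    (fun r hr => (hasDerivAt_integral_re_mul_log Q hQ' hr).2)
    (hcont (fun z => (Q.eval z).re) (by fun_prop) id continuous_id)
    ((hcont (fun z => (z * Q.derivative.eval z).re) (by fun_prop) (· + 1) (by fun_prop)).mono
      Set.Ico_subset_Icc_self) (by simp) ?_ hρ
  · have hav : ∀ r : ℝ, ∫ θ in (0 : ℝ)..2 * π, (Q.eval (circleMap 0 r θ)).re *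
        log (Q.eval (circleMap 0 r θ)).re =
        2 * π * circleAverage (fun z => (Q.eval z).re * log (Q.eval z).re) 0 r := fun r => by
      rw [circleAverage_def, smul_eq_mul, mul_inv_cancel_left₀ (by positivity)]
    rw [hav, hav, hav, circleAverage_zero, circleAverage_eq_circleAverage_zero_one (R := ρ),
      ← mul_sub, ← mul_sub, mul_left_comm] at key
    simpa using le_of_mul_le_mul_left key (by positivity)
  · have := monotoneOn_circleAverage_norm_sq_div_re Q.derivative Q hQ'
    intro r hr R hR hrR
    exact le_of_mul_le_mul_left (this hr hR hrR) (by positivity)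

/-! ### Duality and the Gibbs inequality -/

open Real in
-- The values at `ρ * z` of a harmonic function are its Poisson averages, so this is the
-- self-adjointness of Poisson averaging.
theorem circleAverage_mul_comp_mul_comm {u v : ℂ → ℝ}
    (hu : InnerProductSpace.HarmonicOnNhd u (Metric.closedBall 0 1))
    (hv : InnerProductSpace.HarmonicOnNhd v (Metric.closedBall 0 1))
    {ρ : ℝ} (h0 : 0 ≤ ρ) (h1 : ρ < 1) :
    circleAverage (fun z => u z * v (ρ * z)) 0 1 = circleAverage (fun z => u (ρ * z) * v z) 0 1 := by
  have hc : ∀ {w : ℂ → ℝ}, InnerProductSpace.HarmonicOnNhd w (Metric.closedBall 0 1) →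
      ContinuousOn w (Metric.sphere 0 1) := fun hw z hz =>
    (hw z (Metric.sphere_subset_closedBall hz)).1.continuousAt.continuousWithinAt
  have hs : ∀ {w : ℂ → ℝ}, InnerProductSpace.HarmonicOnNhd w (Metric.closedBall 0 1) →
      ∀ z ∈ Metric.sphere (0 : ℂ) |1|, circleAverage (poissonKernel 0 (ρ * z) • w) 0 1 = w (ρ * z) :=
    fun hw z hz => hw.circleAverage_poissonKernel_smul
      (mul_mem_unitBall h0 h1 (by simpa using hz))
  have := circleAverage_poissonKernel_swap (hc hu) (hc hv) h0 h1
  rw [circleAverage_congr_sphere (f₂ := fun z => u z * v (ρ * z)) fun z hz => by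
      simp only [hs hv z hz],
    circleAverage_congr_sphere (f₁ := fun z => v z * _) (f₂ := fun z => u (ρ * z) * v z) fun z hz => by
      simp only [hs hu z hz]; ring] at this
  exact this

open Real in
/-- The Gibbs variational inequality. -/
theorem circleAverage_mul_le_entropy {g v : ℂ → ℝ} (hg : ContinuousOn g (Metric.sphere 0 1))
    (hv : ContinuousOn v (Metric.sphere 0 1)) (hpos : ∀ z ∈ Metric.sphere (0 : ℂ) 1, 0 < g z) :
    circleAverage (fun z => g z * v z) 0 1 ≤
      circleAverage g 0 1 * log (circleAverage (fun z => exp (v z)) 0 1) +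
        (circleAverage (fun z => g z * log (g z)) 0 1 -
          circleAverage g 0 1 * log (circleAverage g 0 1)) := by
  have cg : Continuous fun θ : ℝ => g (circleMap 0 1 θ) :=
    ContinuousOn.continuous_comp_circleMap (by simpa using hg)
  have cv : Continuous fun θ : ℝ => v (circleMap 0 1 θ) :=
    ContinuousOn.continuous_comp_circleMap (by simpa using hv)
  have hp : ∀ θ : ℝ, 0 < g (circleMap 0 1 θ) := fun θ => hpos _ (by simp)
  have cl : Continuous fun θ : ℝ => log (g (circleMap 0 1 θ)) := cg.log fun θ => (hp θ).ne'
  have hI : ∀ f : ℝ → ℝ, Continuous f → (∀ θ, 0 < f θ) → 0 < (2 * π)⁻¹ * ∫ θ in 0..2 * π, f θ := by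
    intro f hf hf0
    have := intervalIntegral.intervalIntegral_pos_of_pos (hf.intervalIntegrable 0 (2 * π)) hf0
      (by positivity)
    positivity
  have hG := hI _ cg hp
  have hE := hI _ (cv.rexp) fun θ => exp_pos _
  simp only [circleAverage_def, smul_eq_mul]
  set G := (2 * π)⁻¹ * ∫ θ in 0..2 * π, g (circleMap 0 1 θ) with hGdef
  set E := (2 * π)⁻¹ * ∫ θ in 0..2 * π, exp (v (circleMap 0 1 θ)) with hEdef
  -- Pointwise Young inequality, from `log y ≤ y - 1` at `y = (G / E) e^v / g`. The constant `G / E`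
  -- gives `e^v` the same mean as `g`, so the terms that are not logarithmic cancel after
  -- integration.
  have hpt : ∀ θ : ℝ, g (circleMap 0 1 θ) * v (circleMap 0 1 θ) ≤
      g (circleMap 0 1 θ) * log (g (circleMap 0 1 θ)) + (log (E / G) - 1) * g (circleMap 0 1 θ) +
        (G / E) * exp (v (circleMap 0 1 θ)) := by
    intro θ
    have h := hp θ
    set x := g (circleMap 0 1 θ)
    set y := v (circleMap 0 1 θ)
    have h1 := log_le_sub_one_of_pos (show 0 < G / E * exp y / x by positivity)
    rw [log_div (by positivity) h.ne', log_mul (by positivity) (exp_pos _).ne', log_exp,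
      log_div hG.ne' hE.ne'] at h1
    have h2 := mul_le_mul_of_nonneg_left h1 h.le
    rw [log_div hE.ne' hG.ne']
    have h3 : x * (G / E * exp y / x - 1) = G / E * exp y - x := by field_simp
    linarith
  have c₁ : Continuous fun θ : ℝ => g (circleMap 0 1 θ) * log (g (circleMap 0 1 θ)) := cg.mul cl
  have c₂ : Continuous fun θ : ℝ => (log (E / G) - 1) * g (circleMap 0 1 θ) := cg.const_mul _
  have c₃ : Continuous fun θ : ℝ => G / E * exp (v (circleMap 0 1 θ)) := cv.rexp.const_mul _
  have c₁₂ : Continuous fun θ : ℝ => g (circleMap 0 1 θ) * log (g (circleMap 0 1 θ)) +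
    (log (E / G) - 1) * g (circleMap 0 1 θ) := c₁.add c₂
  have hint := intervalIntegral.integral_mono (μ := MeasureTheory.volume) (by positivity : 0 ≤ 2 * π)
    ((cg.mul cv).intervalIntegrable _ _) ((c₁₂.add c₃).intervalIntegrable _ _) hpt
  simp only [Pi.add_apply, Pi.mul_apply] at hint
  rw [intervalIntegral.integral_add (c₁₂.intervalIntegrable _ _) (c₃.intervalIntegrable _ _),
    intervalIntegral.integral_add (c₁.intervalIntegrable _ _) (c₂.intervalIntegrable _ _),
    intervalIntegral.integral_const_mul, intervalIntegral.integral_const_mul] at hint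
  have h4 := mul_le_mul_of_nonneg_left hint (by positivity : 0 ≤ (2 * π)⁻¹)
  refine h4.trans_eq ?_
  rw [mul_add, mul_add, mul_left_comm, ← hGdef, mul_left_comm _ (G / E), ← hEdef,
    log_div hE.ne' hG.ne', div_mul_cancel₀ _ hE.ne']
  ring

/-! ### Approximation of densities by real parts of polynomials -/

/-- Real trigonometric polynomials are real parts of polynomials on the unit circle. -/
theorem exists_polynomial_re_eval_toCircle_near (f : C(UnitAddCircle, ℝ)) {ε : ℝ} (hε : 0 < ε) :
    ∃ Q : Polynomial ℂ, ∀ x : UnitAddCircle, |(Q.eval (AddCircle.toCircle x : ℂ)).re - f x| < ε := by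
  have hspan : ∀ t ∈ Submodule.span ℂ (Set.range (@fourier 1)), ∃ Q₁ Q₂ : Polynomial ℂ,
      ∀ x : UnitAddCircle, t x = Q₁.eval (AddCircle.toCircle x : ℂ) +
        starRingEnd ℂ (Q₂.eval (AddCircle.toCircle x : ℂ)) := by
    intro t ht
    induction ht using Submodule.span_induction with
    | mem t ht =>
      obtain ⟨n, rfl⟩ := ht
      obtain ⟨n, rfl | rfl⟩ := n.eq_nat_or_neg
      · exact ⟨Polynomial.X ^ n, 0, fun x => by simp [fourier_apply, AddCircle.toCircle_nsmul]⟩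
      · refine ⟨0, Polynomial.X ^ n, fun x => ?_⟩
        simp [fourier_apply, AddCircle.toCircle_nsmul, AddCircle.toCircle_neg, ← Circle.coe_inv_eq_conj]
    | zero => exact ⟨0, 0, by simp⟩
    | add s t _ _ hs ht =>
      obtain ⟨Q₁, Q₂, hQ⟩ := hs
      obtain ⟨R₁, R₂, hR⟩ := ht
      exact ⟨Q₁ + R₁, Q₂ + R₂, fun x => by simp [hQ, hR]; ring⟩
    | smul c t _ ht =>
      obtain ⟨R₁, R₂, hR⟩ := ht
      exact ⟨Polynomial.C c * R₁, Polynomial.C (starRingEnd ℂ c) * R₂, fun x => by simp [hR]; ring⟩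
  set F : C(UnitAddCircle, ℂ) := ⟨fun x => (f x : ℂ), by fun_prop⟩
  have hF : F ∈ closure (Submodule.span ℂ (Set.range (@fourier 1)) : Set C(UnitAddCircle, ℂ)) := by
    rw [← Submodule.topologicalClosure_coe, span_fourier_closure_eq_top]
    trivial
  obtain ⟨t, ht, htF⟩ := Metric.mem_closure_iff.1 hF ε hε
  obtain ⟨Q₁, Q₂, hQ⟩ := hspan t ht
  refine ⟨Q₁ + Q₂, fun x => ?_⟩
  have h1 : (((Q₁ + Q₂).eval (AddCircle.toCircle x : ℂ)).re - f x) = (t x - F x).re := by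
    simp [hQ, F]
  rw [h1]
  refine (Complex.abs_re_le_norm _).trans_lt ?_
  rw [dist_comm, dist_eq_norm] at htF
  exact ((t - F).norm_coe_le_norm x).trans_lt htF

/-- A positive continuous function on the unit circle is a uniform limit of real parts of polynomials
which are positive on the closed disc. -/
theorem exists_polynomial_re_pos_near {g : ℂ → ℝ} (hg : ContinuousOn g (Metric.sphere 0 1))
    (hpos : ∀ z ∈ Metric.sphere (0 : ℂ) 1, 0 < g z) {ε : ℝ} (hε : 0 < ε) :
    ∃ Q : Polynomial ℂ, (∀ z ∈ Metric.closedBall (0 : ℂ) 1, 0 < (Q.eval z).re) ∧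
      ∀ z ∈ Metric.sphere (0 : ℂ) 1, |(Q.eval z).re - g z| < ε := by
  obtain ⟨z₀, hz₀, hmin⟩ := (isCompact_sphere (0 : ℂ) 1).exists_isMinOn
    (NormedSpace.sphere_nonempty.2 zero_le_one) hg
  set f : C(UnitAddCircle, ℝ) := ⟨fun x => g (AddCircle.toCircle x), hg.comp_continuous
    (continuous_subtype_val.comp AddCircle.continuous_toCircle) fun x =>
      mem_sphere_zero_iff_norm.2 (Circle.norm_coe _)⟩
  obtain ⟨Q, hQ⟩ := exists_polynomial_re_eval_toCircle_near f (lt_min hε (hpos z₀ hz₀))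
  have hsph : ∀ z ∈ Metric.sphere (0 : ℂ) 1, |(Q.eval z).re - g z| < min ε (g z₀) := by
    intro z hz
    obtain ⟨x, hx⟩ := (AddCircle.homeomorphCircle (T := 1) one_ne_zero).surjective
      (⟨z, by simpa [Submonoid.unitSphere] using hz⟩ : Circle)
    have := hQ x
    rw [← AddCircle.homeomorphCircle_apply one_ne_zero, hx] at this
    simpa [f, ← AddCircle.homeomorphCircle_apply one_ne_zero, hx] using this
  have hsph0 : ∀ z ∈ Metric.sphere (0 : ℂ) 1, 0 < (Q.eval z).re := fun z hz => by
    have h1 := hsph z hz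
    have h2 : g z₀ ≤ g z := hmin hz
    have := (abs_lt.1 (h1.trans_le (min_le_right _ _))).1
    linarith
  refine ⟨Q, ?_, fun z hz => (hsph z hz).trans_le (min_le_left _ _)⟩
  -- Minimum principle: `Re Q` minus its minimum on the circle is nonnegative there, hence so are
  -- its Poisson averages, which are its values inside the disc.
  obtain ⟨z₁, hz₁, hmin₁⟩ := (isCompact_sphere (0 : ℂ) 1).exists_isMinOn
    (f := fun z => (Q.eval z).re) (NormedSpace.sphere_nonempty.2 zero_le_one) (by fun_prop)
  have hc := hsph0 z₁ hz₁
  intro w hw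
  rcases (mem_closedBall_zero_iff.1 hw).eq_or_lt with h | h
  · exact hsph0 w (by simpa using h)
  · have hwb : w ∈ Metric.ball (0 : ℂ) 1 := by simpa using h
    have := (harmonicOnNhd_re_eval (Q - Polynomial.C ((Q.eval z₁).re : ℂ)) _).circleAverage_poissonKernel_smul hwb
    have h2 : 0 ≤ Real.circleAverage (poissonKernel 0 w •
        fun z => ((Q - Polynomial.C ((Q.eval z₁).re : ℂ)).eval z).re) 0 1 := by
      refine Real.circleAverage_nonneg_of_nonneg fun z hz => ?_
      rw [abs_one] at hz
      have h3 : (Q.eval z₁).re ≤ (Q.eval z).re := hmin₁ hz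
      have h4 : ‖z‖ = 1 := by simpa using hz
      simp only [Pi.smul_apply', smul_eq_mul, poissonKernel_def, sub_zero, h4]
      refine mul_nonneg (div_nonneg ?_ (by positivity)) ?_
      · nlinarith [norm_nonneg w]
      · simpa using h3
    rw [this] at h2
    simp at h2
    linarith

/-- The uniform closeness keeps all `F n` in one compact interval, where `φ` is bounded, and
dominated convergence applies. It serves for `φ = id` and for `φ t = t log t`. -/
theorem tendsto_intervalIntegral_comp_mul {f : ℝ → ℝ} {F : ℕ → ℝ → ℝ} {w φ : ℝ → ℝ} {a b : ℝ}
    (hf : Continuous f) (hF : ∀ n, Continuous (F n)) (hw : Continuous w) (hφ : Continuous φ)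
    (h : ∀ n θ, |F n θ - f θ| < 1 / ((n : ℝ) + 1)) :
    Tendsto (fun n => ∫ θ in a..b, φ (F n θ) * w θ) atTop (𝓝 (∫ θ in a..b, φ (f θ) * w θ)) := by
  obtain ⟨M, hM⟩ := (isCompact_uIcc (a := a) (b := b)).exists_bound_of_continuousOn hf.continuousOn
  obtain ⟨W, hW⟩ := (isCompact_uIcc (a := a) (b := b)).exists_bound_of_continuousOn hw.continuousOn
  obtain ⟨C, hC⟩ := (isCompact_Icc (a := -(M + 1)) (b := M + 1)).exists_bound_of_continuousOn
    hφ.continuousOn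
  refine intervalIntegral.tendsto_integral_filter_of_dominated_convergence (fun _ => C * W)
    (Eventually.of_forall fun n => ((hφ.comp (hF n)).mul hw).aestronglyMeasurable)
    (Eventually.of_forall fun n => Eventually.of_forall fun θ hθ => ?_) intervalIntegrable_const
    (Eventually.of_forall fun θ _ => ?_)
  · have h1 := hM θ (Set.uIoc_subset_uIcc hθ)
    have h2 := (h n θ).trans_le (div_le_one_of_le₀ (by linarith [n.cast_nonneg (α := ℝ)])
      (by positivity))
    rw [Real.norm_eq_abs, abs_le] at h1
    rw [abs_lt] at h2
    have h3 := hC (F n θ) ⟨by linarith, by linarith⟩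
    rw [norm_mul]
    exact mul_le_mul h3 (hW θ (Set.uIoc_subset_uIcc hθ)) (norm_nonneg _) ((norm_nonneg _).trans h3)
  · refine Tendsto.mul_const _ ((hφ.tendsto _).comp ?_)
    rw [tendsto_iff_dist_tendsto_zero]
    exact squeeze_zero (fun _ => dist_nonneg) (fun n => (h n θ).le) tendsto_one_div_add_atTop_nhds_zero_nat

/-! ### Weissler's inequality in one variable -/

open Real in
-- Without zeros, `log |F|` is harmonic. For a density `g` with mean `Z`, and `E` the mean of
-- `|F|^p`, self-adjointness, the Gibbs inequality and entropy contraction give `p ∫ g log |F(ρz)| ≤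
-- Z log E + ρ^2 Ent(g)`. For `g = |F(ρz)|^q` the left side is `(p/q) ∫ g log g`; as `ρ^2 = p/q`, it
-- cancels against the same term in the entropy and leaves `(p/q) log Z ≤ log E`.
theorem circleAverage_norm_rpow_le_of_ne_zero (F : Polynomial ℂ)
    (hF : ∀ z ∈ Metric.closedBall (0 : ℂ) 1, F.eval z ≠ 0) {p q : ℝ} (hp : 0 < p) (hpq : p < q) :
    circleAverage (fun z => ‖F.eval (√(p / q) * z)‖ ^ q) 0 1 ≤
      circleAverage (fun z => ‖F.eval z‖ ^ p) 0 1 ^ (q / p) := by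
  have hq : 0 < q := hp.trans hpq
  set ρ := √(p / q) with hρdef
  have hρ0 : 0 < ρ := by positivity
  have hρsq : ρ ^ 2 = p / q := sq_sqrt (by positivity)
  have hρ1 : ρ < 1 := by
    rw [hρdef, sqrt_lt' one_pos, one_pow, div_lt_one hq]
    exact hpq
  have hball : ∀ z ∈ Metric.closedBall (0 : ℂ) 1, (ρ * z : ℂ) ∈ Metric.closedBall (0 : ℂ) 1 := by
    intro z hz
    simp only [mem_closedBall_zero_iff] at hz ⊢
    rw [norm_mul, Complex.norm_real, norm_of_nonneg hρ0.le]
    nlinarith [norm_nonneg z]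
  have hFn : ∀ z ∈ Metric.closedBall (0 : ℂ) 1, 0 < ‖F.eval z‖ := fun z hz => norm_pos_iff.2 (hF z hz)
  have hu : InnerProductSpace.HarmonicOnNhd (fun z => log ‖F.eval z‖) (Metric.closedBall 0 1) := by
    intro z hz
    refine AnalyticAt.harmonicAt_log_norm (f := fun z => F.eval z) ?_ (hF z hz)
    simpa [Polynomial.aeval_def, Polynomial.eval₂_eq_eval_map] using
      AnalyticAt.aeval_polynomial (analyticAt_id (𝕜 := ℂ) (z := z)) F
  have huc : ContinuousOn (fun z => log ‖F.eval z‖) (Metric.closedBall 0 1) :=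
    ContinuousOn.log (by fun_prop) fun z hz => (hFn z hz).ne'
  set E := circleAverage (fun z => ‖F.eval z‖ ^ p) 0 1 with hE
  -- the inequality for densities that are real parts of polynomials
  have step : ∀ Q : Polynomial ℂ, (∀ z ∈ Metric.closedBall (0 : ℂ) 1, 0 < (Q.eval z).re) →
      p * circleAverage (fun z => (Q.eval z).re * log ‖F.eval (ρ * z)‖) 0 1 ≤
        circleAverage (fun z => (Q.eval z).re) 0 1 * log E +
          ρ ^ 2 * (circleAverage (fun z => (Q.eval z).re * log (Q.eval z).re) 0 1 -
            circleAverage (fun z => (Q.eval z).re) 0 1 *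
              log (circleAverage (fun z => (Q.eval z).re) 0 1)) := by
    intro Q hQ
    have hmean : circleAverage (fun z => (Q.eval z).re) 0 1 = (Q.eval 0).re := by
      have := (harmonicOnNhd_re_eval Q (Metric.closedBall 0 |1|)).circleAverage_eq
      simpa using this
    have hmean' : circleAverage (fun z => (Q.eval (ρ * z)).re) 0 1 = (Q.eval 0).re := by
      have := (harmonicOnNhd_re_eval Q (Metric.closedBall 0 |ρ|)).circleAverage_eq
      rw [circleAverage_eq_circleAverage_zero_one] at this
      simpa using this
    rw [circleAverage_mul_comp_mul_comm (u := fun z => (Q.eval z).re) (harmonicOnNhd_re_eval Q _) hu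
      hρ0.le hρ1, hmean]
    have h1 := entropy_re_eval_le Q hQ ⟨hρ0, hρ1.le⟩
    have h2 := circleAverage_mul_le_entropy (g := fun z => (Q.eval (ρ * z)).re)
      (v := fun z => p * log ‖F.eval z‖) (by fun_prop)
      (continuousOn_const.mul (huc.mono Metric.sphere_subset_closedBall))
      fun z hz => hQ _ (hball z (Metric.sphere_subset_closedBall hz))
    have h3 : circleAverage (fun z => exp (p * log ‖F.eval z‖)) 0 1 = E := by
      refine circleAverage_congr_sphere fun z hz => ?_
      rw [abs_one] at hz
      rw [rpow_def_of_pos (hFn z (Metric.sphere_subset_closedBall hz)), mul_comm]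
    have h4 : p * circleAverage (fun z => (Q.eval (ρ * z)).re * log ‖F.eval z‖) 0 1 =
        circleAverage (fun z => (Q.eval (ρ * z)).re * (p * log ‖F.eval z‖)) 0 1 := by
      rw [← smul_eq_mul, ← circleAverage_fun_smul]
      simp only [smul_eq_mul, mul_left_comm]
    rw [h3, hmean'] at h2
    rw [h4]
    linarith
  -- passage to the density `‖F (ρ z)‖ ^ q`
  set g : ℂ → ℝ := fun z => ‖F.eval (ρ * z)‖ ^ q with hg
  have hgc : ContinuousOn g (Metric.sphere 0 1) :=
    ContinuousOn.rpow_const (by fun_prop) fun z hz => Or.inr hq.le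
  have hgpos : ∀ z ∈ Metric.sphere (0 : ℂ) 1, 0 < g z := fun z hz =>
    rpow_pos_of_pos (hFn _ (hball z (Metric.sphere_subset_closedBall hz))) _
  choose Q hQ hQg using fun n : ℕ => exists_polynomial_re_pos_near hgc hgpos
    (by positivity : (0 : ℝ) < 1 / ((n : ℝ) + 1))
  have cg : Continuous fun θ : ℝ => g (circleMap 0 1 θ) :=
    ContinuousOn.continuous_comp_circleMap (by simpa using hgc)
  have cu : Continuous fun θ : ℝ => log ‖F.eval (ρ * circleMap 0 1 θ)‖ :=
    huc.comp_continuous (f := fun θ : ℝ => (ρ * circleMap 0 1 θ : ℂ)) (by fun_prop)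
      fun θ => hball _ (by simp)
  have hlim : ∀ w φ : ℝ → ℝ, Continuous w → Continuous φ →
      Tendsto (fun n => (2 * π)⁻¹ * ∫ θ in 0..2 * π, φ ((Q n).eval (circleMap 0 1 θ)).re * w θ) atTop
        (𝓝 ((2 * π)⁻¹ * ∫ θ in 0..2 * π, φ (g (circleMap 0 1 θ)) * w θ)) := fun w φ hw hφ =>
    (tendsto_intervalIntegral_comp_mul cg (fun n => by fun_prop) hw hφ
      fun n θ => hQg n _ (by simp)).const_mul _
  have l1 := hlim _ _ cu continuous_id
  have l2 := hlim (fun _ => 1) _ continuous_const continuous_id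
  have l3 := hlim (fun _ => 1) _ continuous_const Real.continuous_mul_log
  simp only [id, mul_one] at l1 l2 l3
  have hfin := le_of_tendsto_of_tendsto' (l1.const_mul p) ((l2.mul_const (log E)).add
    ((l3.sub (Real.continuous_mul_log.tendsto _ |>.comp l2)).const_mul (ρ ^ 2)))
    fun n => by simpa [circleAverage_def] using step (Q n) (hQ n)
  set Z := (2 * π)⁻¹ * ∫ θ in 0..2 * π, g (circleMap 0 1 θ) with hZ
  have hcA : ∀ f : ℂ → ℝ, ContinuousOn f (Metric.sphere 0 1) → (∀ z ∈ Metric.sphere (0 : ℂ) 1, 0 < f z) →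
      0 < (2 * π)⁻¹ * ∫ θ in 0..2 * π, f (circleMap 0 1 θ) := by
    intro f hf hf0
    have c : Continuous fun θ : ℝ => f (circleMap 0 1 θ) :=
      ContinuousOn.continuous_comp_circleMap (by simpa using hf)
    have := intervalIntegral.intervalIntegral_pos_of_pos (c.intervalIntegrable 0 (2 * π))
      (fun θ => hf0 _ (by simp)) (by positivity)
    positivity
  have hZ0 : 0 < Z := hcA g hgc hgpos
  have hE0 : 0 < E := hcA _ (ContinuousOn.rpow_const (by fun_prop) fun z hz => Or.inr hp.le)
    fun z hz => rpow_pos_of_pos (hFn z (Metric.sphere_subset_closedBall hz)) _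
  have hglog : ∀ θ : ℝ, g (circleMap 0 1 θ) * log (g (circleMap 0 1 θ)) =
      q * (g (circleMap 0 1 θ) * log ‖F.eval (ρ * circleMap 0 1 θ)‖) := by
    intro θ
    rw [show log (g (circleMap 0 1 θ)) = q * log ‖F.eval (ρ * circleMap 0 1 θ)‖ from
      log_rpow (hFn _ (hball _ (by simp))) _]
    ring
  simp only [hglog, intervalIntegral.integral_const_mul, hρsq] at hfin
  have h5 : log Z ≤ q / p * log E := by
    set I := ∫ θ in 0..2 * π, g (circleMap 0 1 θ) * log ‖F.eval (ρ * circleMap 0 1 θ)‖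
    have h6 : p / q * ((2 * π)⁻¹ * (q * I) - Z * log Z) = p * ((2 * π)⁻¹ * I) - p / q * (Z * log Z) := by
      field_simp
    rw [h6] at hfin
    have h7 : Z * (p / q * log Z) ≤ Z * log E := by linarith
    have h8 := le_of_mul_le_mul_left h7 hZ0
    rw [div_mul_eq_mul_div, div_le_iff₀ hq] at h8
    rw [div_mul_eq_mul_div, le_div_iff₀ hp]
    linarith
  have : circleAverage g 0 1 = Z := rfl
  rw [this, ← log_le_log_iff hZ0 (rpow_pos_of_pos hE0 _), log_rpow hE0]
  exact h5

/-- The squares differ by `(1 - |a|^2) (1 - |z|^2)`. Replacing a factor `z - a` by its reflection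
thus keeps the modulus on the circle and does not lower it inside. -/
theorem norm_sub_le_norm_one_sub_conj_mul {a z : ℂ} (ha : ‖a‖ ≤ 1) (hz : ‖z‖ ≤ 1) :
    ‖z - a‖ ≤ ‖1 - starRingEnd ℂ a * z‖ ∧ (‖z‖ = 1 → ‖1 - starRingEnd ℂ a * z‖ = ‖z - a‖) := by
  have key : ‖1 - starRingEnd ℂ a * z‖ ^ 2 - ‖z - a‖ ^ 2 = (1 - ‖a‖ ^ 2) * (1 - ‖z‖ ^ 2) := by
    simp only [← Complex.normSq_eq_norm_sq, Complex.normSq_apply, Complex.sub_re, Complex.sub_im,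
      Complex.mul_re, Complex.mul_im, Complex.conj_re, Complex.conj_im, Complex.one_re, Complex.one_im]
    ring
  refine ⟨?_, fun h => ?_⟩
  · refine le_of_sq_le_sq ?_ (norm_nonneg _)
    have : 0 ≤ (1 - ‖a‖ ^ 2) * (1 - ‖z‖ ^ 2) :=
      mul_nonneg (by nlinarith [norm_nonneg a]) (by nlinarith [norm_nonneg z])
    linarith
  · rw [h] at key
    exact (sq_eq_sq₀ (norm_nonneg _) (norm_nonneg _)).1 (by linarith)

/-- Zeros in the open disc can be reflected in the unit circle. -/
theorem exists_polynomial_ne_zero_on_ball {f : Polynomial ℂ} (hf : f ≠ 0) :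
    ∃ F : Polynomial ℂ, (∀ z ∈ Metric.ball (0 : ℂ) 1, F.eval z ≠ 0) ∧
      ∀ z : ℂ, ‖z‖ ≤ 1 → ‖f.eval z‖ ≤ ‖F.eval z‖ ∧ (‖z‖ = 1 → ‖F.eval z‖ = ‖f.eval z‖) := by
  have key : ∀ s : Multiset ℂ, ∃ F : Polynomial ℂ, (∀ z ∈ Metric.ball (0 : ℂ) 1, F.eval z ≠ 0) ∧
      ∀ z : ℂ, ‖z‖ ≤ 1 → ‖(s.map fun a => Polynomial.X - Polynomial.C a).prod.eval z‖ ≤ ‖F.eval z‖ ∧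
        (‖z‖ = 1 → ‖F.eval z‖ = ‖(s.map fun a => Polynomial.X - Polynomial.C a).prod.eval z‖) := by
    intro s
    induction s using Multiset.induction_on with
    | empty => exact ⟨1, by simp, by simp⟩
    | cons a s ih =>
      obtain ⟨F, hF, hz⟩ := ih
      by_cases ha : ‖a‖ < 1
      · refine ⟨(1 - Polynomial.C (starRingEnd ℂ a) * Polynomial.X) * F, fun z hzb => ?_, fun z h => ?_⟩
        · rw [Polynomial.eval_mul]
          refine mul_ne_zero ?_ (hF z hzb)
          simp only [Polynomial.eval_sub, Polynomial.eval_one, Polynomial.eval_mul, Polynomial.eval_C,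
            Polynomial.eval_X]
          intro h0
          have : ‖starRingEnd ℂ a * z‖ = 1 := by rw [← sub_eq_zero.1 h0, norm_one]
          rw [norm_mul, Complex.norm_conj] at this
          rw [mem_ball_zero_iff] at hzb
          nlinarith [norm_nonneg a, norm_nonneg z]
        · have h1 := norm_sub_le_norm_one_sub_conj_mul ha.le h
          simp only [Multiset.map_cons, Multiset.prod_cons, Polynomial.eval_mul, norm_mul,
            Polynomial.eval_sub, Polynomial.eval_one, Polynomial.eval_X, Polynomial.eval_C] at h1 ⊢
          exact ⟨mul_le_mul h1.1 (hz z h).1 (norm_nonneg _) (by positivity), fun h' => by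
            rw [h1.2 h', (hz z h).2 h']⟩
      · refine ⟨(Polynomial.X - Polynomial.C a) * F, fun z hzb => ?_, fun z h => ?_⟩
        · rw [Polynomial.eval_mul]
          refine mul_ne_zero ?_ (hF z hzb)
          rw [mem_ball_zero_iff] at hzb
          simp only [Polynomial.eval_sub, Polynomial.eval_X, Polynomial.eval_C, ne_eq, sub_eq_zero]
          rintro rfl
          exact ha hzb
        · simp only [Multiset.map_cons, Multiset.prod_cons, Polynomial.eval_mul, norm_mul]
          exact ⟨mul_le_mul_of_nonneg_left (hz z h).1 (norm_nonneg _), fun h' => by rw [(hz z h).2 h']⟩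
  obtain ⟨F, hF, hz⟩ := key f.roots
  have hs := (IsAlgClosed.splits f).eq_prod_roots
  have hev : ∀ z, f.eval z = f.leadingCoeff *
      (f.roots.map fun a => Polynomial.X - Polynomial.C a).prod.eval z := fun z => by
    conv_lhs => rw [hs]
    simp
  refine ⟨Polynomial.C f.leadingCoeff * F, fun z hzb => ?_, fun z h => ?_⟩
  · simpa [hf] using hF z hzb
  · rw [hev, Polynomial.eval_mul, Polynomial.eval_C, norm_mul, norm_mul]
    exact ⟨mul_le_mul_of_nonneg_left (hz z h).1 (norm_nonneg _), fun h' => by rw [(hz z h).2 h']⟩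

open Real in
/-- Weissler's inequality. -/
theorem circleAverage_norm_rpow_le (f : Polynomial ℂ) {p q : ℝ} (hp : 0 < p) (hpq : p < q) :
    circleAverage (fun z => ‖f.eval (√(p / q) * z)‖ ^ q) 0 1 ≤
      circleAverage (fun z => ‖f.eval z‖ ^ p) 0 1 ^ (q / p) := by
  have hq : 0 < q := hp.trans hpq
  by_cases hf : f = 0
  · simp only [hf, Polynomial.eval_zero, norm_zero, zero_rpow hp.ne', zero_rpow hq.ne',
      circleAverage_const]
    positivity
  obtain ⟨F, hF, hz⟩ := exists_polynomial_ne_zero_on_ball hf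
  have hρ1 : √(p / q) ≤ 1 := by
    rw [sqrt_le_one, div_le_one hq]
    exact hpq.le
  have c1 : Continuous fun z : ℂ => ‖F.eval (√(p / q) * z)‖ ^ q :=
    Continuous.rpow_const (by fun_prop) fun _ => Or.inr hq.le
  have c2 : Continuous fun z : ℂ => ‖F.eval z‖ ^ p :=
    Continuous.rpow_const (by fun_prop) fun _ => Or.inr hp.le
  have c3 : Continuous fun z : ℂ => ‖f.eval (√(p / q) * z)‖ ^ q :=
    Continuous.rpow_const (by fun_prop) fun _ => Or.inr hq.le
  -- `F` may still vanish on the unit circle. Its dilates `F(sz)` with `s < 1` do not vanish on the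
  -- closed disc; let `s` tend to one.
  have hlim : circleAverage (fun z => ‖F.eval (√(p / q) * z)‖ ^ q) 0 1 ≤
      circleAverage (fun z => ‖F.eval z‖ ^ p) 0 1 ^ (q / p) := by
    have t1 : Tendsto (fun s : ℝ => circleAverage (fun z => ‖F.eval (√(p / q) * z)‖ ^ q) 0 s) (𝓝[<] 1)
        (𝓝 (circleAverage (fun z => ‖F.eval (√(p / q) * z)‖ ^ q) 0 1)) :=
      (c1.circleAverage.tendsto 1).mono_left nhdsWithin_le_nhds
    have t2 : Tendsto (fun s : ℝ => circleAverage (fun z => ‖F.eval z‖ ^ p) 0 s ^ (q / p)) (𝓝[<] 1)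
        (𝓝 (circleAverage (fun z => ‖F.eval z‖ ^ p) 0 1 ^ (q / p))) :=
      ((c2.circleAverage.rpow_const fun _ => Or.inr (by positivity)).tendsto 1).mono_left
        nhdsWithin_le_nhds
    refine le_of_tendsto_of_tendsto t1 t2 ?_
    filter_upwards [Ioo_mem_nhdsLT (zero_lt_one (α := ℝ))] with s hs
    have := circleAverage_norm_rpow_le_of_ne_zero (F.comp (Polynomial.C (s : ℂ) * Polynomial.X))
      (fun z hz => by
        simp only [Polynomial.eval_comp, Polynomial.eval_mul, Polynomial.eval_C, Polynomial.eval_X]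
        refine hF _ ?_
        rw [mem_closedBall_zero_iff] at hz
        rw [mem_ball_zero_iff, norm_mul, Complex.norm_real, norm_of_nonneg hs.1.le]
        nlinarith [hs.1, hs.2]) hp hpq
    rw [circleAverage_eq_circleAverage_zero_one (R := s), circleAverage_eq_circleAverage_zero_one (R := s)]
    simpa [mul_left_comm] using this
  have hmono : circleAverage (fun z => ‖f.eval (√(p / q) * z)‖ ^ q) 0 1 ≤
      circleAverage (fun z => ‖F.eval (√(p / q) * z)‖ ^ q) 0 1 := by
    refine circleAverage_mono c3.continuousOn.circleIntegrable' c1.continuousOn.circleIntegrable'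
      fun z hz' => ?_
    refine rpow_le_rpow (norm_nonneg _) (hz _ ?_).1 hq.le
    rw [abs_one, mem_sphere_zero_iff_norm] at hz'
    rwa [norm_mul, hz', mul_one, Complex.norm_real, norm_of_nonneg (sqrt_nonneg _)]
  have heq : circleAverage (fun z => ‖F.eval z‖ ^ p) 0 1 = circleAverage (fun z => ‖f.eval z‖ ^ p) 0 1 := by
    refine circleAverage_congr_sphere fun z hz' => ?_
    rw [abs_one, mem_sphere_zero_iff_norm] at hz'
    simp only [(hz z hz'.le).2 hz']
  rw [← heq]
  exact hmono.trans hlim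

open Real in
theorem integral_comp_toCircle (G : ℂ → ℝ) :
    ∫ x : UnitAddCircle, G (AddCircle.toCircle x) = circleAverage G 0 1 := by
  rw [← UnitAddCircle.intervalIntegral_preimage 0, circleAverage_def, zero_add]
  have := intervalIntegral.smul_integral_comp_mul_left (a := 0) (b := 1)
    (fun θ => G (circleMap 0 1 θ)) (2 * π)
  rw [mul_zero, mul_one] at this
  rw [← this, smul_smul, inv_mul_cancel₀ (by positivity), one_smul]
  refine intervalIntegral.integral_congr fun t _ => ?_
  simp [AddCircle.toCircle_apply_mk, circleMap, Circle.coe_exp]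

theorem integral_norm_rpow_toCircle_le (f : Polynomial ℂ) {p q : ℝ} (hp : 0 < p) (hpq : p < q) :
    ∫ x : UnitAddCircle, ‖f.eval ((√(p / q) : ℂ) * AddCircle.toCircle x)‖ ^ q ≤
      (∫ x : UnitAddCircle, ‖f.eval (AddCircle.toCircle x : ℂ)‖ ^ p) ^ (q / p) := by
  rw [integral_comp_toCircle fun z => ‖f.eval ((√(p / q) : ℂ) * z)‖ ^ q,
    integral_comp_toCircle fun z => ‖f.eval z‖ ^ p]
  exact circleAverage_norm_rpow_le f hp hpq

/-! ### Minkowski's inequality and Weissler's inequality on the polytorus -/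

open MeasureTheory

section
variable {X Y : Type*} [TopologicalSpace X] [CompactSpace X] [MeasurableSpace X] [OpensMeasurableSpace X]
  [TopologicalSpace Y]

theorem Continuous.integrable_of_compactSpace {E : Type*} [NormedAddCommGroup E]
    [SecondCountableTopologyEither X E] {μ : Measure X} [IsFiniteMeasure μ]
    {f : X → E} (hf : Continuous f) : Integrable f μ :=
  hf.integrable_of_hasCompactSupport (HasCompactSupport.of_compactSpace f)

theorem Continuous.integral_left_of_compactSpace {E : Type*} [NormedAddCommGroup E] [NormedSpace ℝ E]
    [SecondCountableTopologyEither X E] [FirstCountableTopology Y] [LocallyCompactSpace Y]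
    {μ : Measure X} [IsFiniteMeasure μ]
    {G : X × Y → E} (hG : Continuous G) : Continuous fun y => ∫ x, G (x, y) ∂μ := by
  have := continuous_parametric_integral_of_continuous (μ := μ) (s := Set.univ)
    (f := fun y x => G (x, y)) (by fun_prop) isCompact_univ
  simpa using this
end

section
variable {X Y : Type*} [TopologicalSpace X] [CompactSpace X] [MeasurableSpace X] [BorelSpace X]
  [SecondCountableTopology X] [T2Space X]
  [TopologicalSpace Y] [CompactSpace Y] [MeasurableSpace Y] [BorelSpace Y] [SecondCountableTopology Y]
  [T2Space Y]

/-- **Minkowski's integral inequality** for continuous functions on compact spaces. -/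
theorem integral_integral_rpow_le {μ : Measure X} {ν : Measure Y} [IsFiniteMeasure μ] [IsFiniteMeasure ν]
    {G : X × Y → ℝ} (hG : Continuous G) (hG0 : ∀ z, 0 ≤ G z) {s : ℝ} (hs : 1 < s) :
    ∫ y, (∫ x, G (x, y) ∂μ) ^ s ∂ν ≤ (∫ x, (∫ y, G (x, y) ^ s ∂ν) ^ (1 / s) ∂μ) ^ s := by
  have hs0 : 0 < s := by linarith
  set K : Y → ℝ := fun y => ∫ x, G (x, y) ∂μ with hK
  have hKc : Continuous K := hG.integral_left_of_compactSpace
  have hK0 : ∀ y, 0 ≤ K y := fun y => integral_nonneg fun x => hG0 _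
  set L : X → ℝ := fun x => (∫ y, G (x, y) ^ s ∂ν) ^ (1 / s) with hL
  have hGs : Continuous fun z => G z ^ s := hG.rpow_const fun _ => Or.inr hs0.le
  have hLc : Continuous L := by
    refine Continuous.rpow_const ?_ fun _ => Or.inr (by positivity)
    exact Continuous.integral_left_of_compactSpace (G := fun z : Y × X => G (z.2, z.1) ^ s)
      (hGs.comp continuous_swap)
  have hL0 : ∀ x, 0 ≤ L x := fun x => Real.rpow_nonneg (integral_nonneg fun y => Real.rpow_nonneg (hG0 _) _) _
  set J := ∫ y, K y ^ s ∂ν with hJ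
  have hJ0 : 0 ≤ J := integral_nonneg fun y => Real.rpow_nonneg (hK0 y) _
  have hKs : Continuous fun y => K y ^ (s - 1) := hKc.rpow_const fun _ => Or.inr (by linarith)
  have hconj : s.HolderConjugate (s / (s - 1)) := Real.HolderConjugate.conjExponent hs
  -- Split `K ^ s` as `K * K ^ (s - 1)` and exchange the integrals. Hölder in `y` then produces the
  -- factor `J ^ (1 - 1 / s)`, which is divided out at the end.
  have h1 : J = ∫ x, ∫ y, G (x, y) * K y ^ (s - 1) ∂ν ∂μ := by
    have hc : Continuous fun z : X × Y => G z * K z.2 ^ (s - 1) := hG.mul (hKs.comp continuous_snd)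
    rw [integral_integral_swap (f := fun x y => G (x, y) * K y ^ (s - 1)) hc.integrable_of_compactSpace]
    refine integral_congr_ae (Eventually.of_forall fun y => ?_)
    simp only [integral_mul_const]
    change K y ^ s = K y * K y ^ (s - 1)
    rcases (hK0 y).eq_or_lt with h | h
    · rw [← h, Real.zero_rpow hs0.ne', zero_mul]
    · rw [← Real.rpow_one_add' h.le (by linarith)]
      congr 1
      ring
  have h2 : ∀ x, ∫ y, G (x, y) * K y ^ (s - 1) ∂ν ≤ L x * J ^ (1 - 1 / s) := by
    intro x
    have c1 : Continuous fun y => G (x, y) := by fun_prop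
    have hm : ∀ {f : Y → ℝ} {r : ENNReal}, Continuous f → MemLp f r ν := fun hf => by
      obtain ⟨C, hC⟩ := isCompact_univ.exists_bound_of_continuousOn hf.continuousOn
      exact MemLp.of_bound hf.aestronglyMeasurable C (Eventually.of_forall fun y => hC y (Set.mem_univ _))
    have := integral_mul_le_Lp_mul_Lq_of_nonneg (μ := ν) hconj (f := fun y => G (x, y))
      (g := fun y => K y ^ (s - 1)) (Eventually.of_forall fun y => hG0 _)
      (Eventually.of_forall fun y => Real.rpow_nonneg (hK0 y) _) (hm c1) (hm hKs)
    refine this.trans_eq ?_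
    have e : ∀ y, (K y ^ (s - 1)) ^ (s / (s - 1)) = K y ^ s := fun y => by
      rw [← Real.rpow_mul (hK0 y)]
      congr 1
      field_simp [show s - 1 ≠ 0 by linarith]
    simp only [e]
    congr 2
    field_simp
  have h3 : J ≤ (∫ x, L x ∂μ) * J ^ (1 - 1 / s) := by
    rw [← integral_mul_const]
    conv_lhs => rw [h1]
    refine integral_mono ?_ ?_ h2
    · refine Continuous.integrable_of_compactSpace ?_
      exact Continuous.integral_left_of_compactSpace
        (G := fun z : Y × X => G (z.2, z.1) * K z.1 ^ (s - 1))
        ((hG.comp continuous_swap).mul (hKs.comp continuous_fst))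
    · exact (hLc.mul continuous_const).integrable_of_compactSpace
  rcases hJ0.eq_or_lt with h | h
  · rw [← h]
    exact Real.rpow_nonneg (integral_nonneg hL0) _
  · have h4 : J ^ (1 / s) ≤ ∫ x, L x ∂μ := by
      have h5 : J = J ^ (1 / s) * J ^ (1 - 1 / s) := by
        rw [← Real.rpow_add h]
        simp
      have h6 : 0 < J ^ (1 - 1 / s) := Real.rpow_pos_of_pos h _
      nth_rewrite 1 [h5] at h3
      exact le_of_mul_le_mul_right h3 h6
    calc J = (J ^ (1 / s)) ^ s := by rw [← Real.rpow_mul hJ0, one_div_mul_cancel hs0.ne', Real.rpow_one]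
      _ ≤ _ := Real.rpow_le_rpow (by positivity) h4 hs0.le
end

instance : IsProbabilityMeasure (volume : Measure UnitAddCircle) := ⟨UnitAddCircle.measure_univ⟩

theorem integral_fin_succ {n : ℕ} {E : Type*} [NormedAddCommGroup E] [NormedSpace ℝ E]
    {G : (Fin (n + 1) → UnitAddCircle) → E} :
    ∫ x, G x = ∫ z : UnitAddCircle × (Fin n → UnitAddCircle), G (Fin.cons z.1 z.2) := by
  have := ((volume_preserving_piFinSuccAbove (fun _ : Fin (n + 1) => UnitAddCircle) 0).symm _).integral_comp' G
  rw [← this]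
  simp [MeasurableEquiv.piFinSuccAbove_symm_apply]
  rfl

/-- The point of the polytorus with arguments `x`. -/
noncomputable def torusPoint {n : ℕ} (x : Fin n → UnitAddCircle) : Fin n → ℂ :=
  fun i => (AddCircle.toCircle (x i) : ℂ)

theorem continuous_torusPoint {n : ℕ} : Continuous (torusPoint (n := n)) :=
  continuous_pi fun i => continuous_subtype_val.comp
    (AddCircle.continuous_toCircle.comp (continuous_apply i))

theorem MvPolynomial.continuous_eval_comp {X : Type*} [TopologicalSpace X] {n : ℕ}
    (P : MvPolynomial (Fin n) ℂ) {v : X → Fin n → ℂ} (hv : Continuous v) :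
    Continuous fun x => MvPolynomial.eval (v x) P :=
  (MvPolynomial.continuous_eval P).comp hv

/-- Weissler's inequality on the polytorus. -/
theorem integral_norm_rpow_smul_torusPoint_le {p q : ℝ} (hp : 0 < p) (hpq : p < q) (n : ℕ)
    (P : MvPolynomial (Fin n) ℂ) :
    ∫ x, ‖MvPolynomial.eval ((√(p / q) : ℂ) • torusPoint x) P‖ ^ q ≤
      (∫ x, ‖MvPolynomial.eval (torusPoint x) P‖ ^ p) ^ (q / p) := by
  have hq : 0 < q := hp.trans hpq
  set ρ : ℂ := (√(p / q) : ℂ)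
  induction n with
  | zero =>
    have e2 : ∀ x : Fin 0 → UnitAddCircle, torusPoint x = 0 := fun x => Subsingleton.elim _ _
    simp only [e2, smul_zero, integral_const, probReal_univ, one_smul]
    rw [← Real.rpow_mul (norm_nonneg _), mul_div_cancel₀ _ hp.ne']
  | succ n ih =>
    have hs : 1 < q / p := (one_lt_div hp).2 hpq
    have hcons : ∀ (c : ℂ) (z : UnitAddCircle) (x : Fin n → UnitAddCircle),
        c • torusPoint (Fin.cons z x : Fin (n + 1) → UnitAddCircle) =
          Fin.cons (c * AddCircle.toCircle z) (c • torusPoint x) := by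
      intro c z x
      ext i
      refine Fin.cases ?_ (fun j => ?_) i <;> simp [torusPoint]
    have hcons1 : ∀ (z : UnitAddCircle) (x : Fin n → UnitAddCircle),
        torusPoint (Fin.cons z x : Fin (n + 1) → UnitAddCircle) =
          Fin.cons (AddCircle.toCircle z : ℂ) (torusPoint x) := by
      intro z x
      simpa using hcons 1 z x
    -- slices
    have slice₁ : ∀ (x : Fin n → ℂ), ∃ f : Polynomial ℂ, ∀ z : ℂ,
        MvPolynomial.eval (Fin.cons z x : Fin (n + 1) → ℂ) P = f.eval z := fun x =>
      ⟨_, fun z => MvPolynomial.eval_eq_eval_mv_eval' x z P⟩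
    have slice₂ : ∀ z : ℂ, ∃ R : MvPolynomial (Fin n) ℂ, ∀ x : Fin n → ℂ,
        MvPolynomial.eval (Fin.cons z x : Fin (n + 1) → ℂ) P = MvPolynomial.eval x R := fun z =>
      ⟨(MvPolynomial.finSuccEquiv ℂ n P).eval (MvPolynomial.C z), fun x => by
        rw [MvPolynomial.eval_eq_eval_mv_eval', Polynomial.eval_map, Polynomial.eval,
          Polynomial.hom_eval₂]
        simp⟩
    have cT := continuous_torusPoint (n := n)
    have cC : Continuous fun z : UnitAddCircle => (AddCircle.toCircle z : ℂ) :=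
      continuous_subtype_val.comp AddCircle.continuous_toCircle
    have cont : ∀ (c d : ℂ) {r : ℝ}, 0 ≤ r → Continuous fun z : UnitAddCircle × (Fin n → UnitAddCircle) =>
        ‖MvPolynomial.eval (Fin.cons (c * AddCircle.toCircle z.1) (d • torusPoint z.2) : Fin (n + 1) → ℂ) P‖ ^ r := by
      intro c d r hr
      refine Continuous.rpow_const (Continuous.norm ?_) fun _ => Or.inr hr
      refine MvPolynomial.continuous_eval_comp P (continuous_pi fun i => ?_)
      refine Fin.cases ?_ (fun j => ?_) i
      · simp only [Fin.cons_zero]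
        exact continuous_const.mul (cC.comp continuous_fst)
      · simp only [Fin.cons_succ, Pi.smul_apply]
        have h : Continuous fun x : Fin n → UnitAddCircle => torusPoint x j :=
          (continuous_apply j).comp cT
        have h2 : Continuous fun z : UnitAddCircle × (Fin n → UnitAddCircle) => torusPoint z.2 j :=
          h.comp continuous_snd
        exact h2.const_smul d
    have c0 := cont ρ ρ hq.le
    have c1 := cont 1 ρ hp.le
    have c1q := cont 1 ρ hq.le
    have c2 := cont 1 1 hp.le
    simp only [one_mul, one_smul] at c1 c1q c2
    rw [integral_fin_succ, integral_fin_succ]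
    simp only [hcons]
    simp only [hcons1]
    rw [Measure.volume_eq_prod, integral_prod_symm _ c0.integrable_of_compactSpace,
      integral_prod _ c2.integrable_of_compactSpace]
    -- The one-variable inequality in `z`, Minkowski with exponent `q / p > 1` to exchange the two
    -- norms, and the induction hypothesis in `y`.
    calc ∫ y, ∫ z : UnitAddCircle, ‖MvPolynomial.eval
          (Fin.cons (ρ * AddCircle.toCircle z) (ρ • torusPoint y) : Fin (n + 1) → ℂ) P‖ ^ q
        ≤ ∫ y, (∫ z : UnitAddCircle, ‖MvPolynomial.eval
          (Fin.cons (AddCircle.toCircle z : ℂ) (ρ • torusPoint y) : Fin (n + 1) → ℂ) P‖ ^ p) ^ (q / p) := by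
          refine integral_mono ?_ ?_ fun y => ?_
          · exact (c0.integral_left_of_compactSpace).integrable_of_compactSpace
          · exact (c1.integral_left_of_compactSpace.rpow_const
              fun _ => Or.inr (by positivity)).integrable_of_compactSpace
          · obtain ⟨f, hf⟩ := slice₁ (ρ • torusPoint y)
            simp only [hf]
            exact integral_norm_rpow_toCircle_le f hp hpq
      _ ≤ (∫ z : UnitAddCircle, (∫ y, (‖MvPolynomial.eval
          (Fin.cons (AddCircle.toCircle z : ℂ) (ρ • torusPoint y) : Fin (n + 1) → ℂ) P‖ ^ p) ^ (q / p)) ^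
            (1 / (q / p))) ^ (q / p) := integral_integral_rpow_le c1 (fun _ => by positivity) hs
      _ ≤ _ := by
          refine Real.rpow_le_rpow (by positivity) ?_ (by positivity)
          have e : ∀ a : ℂ, (‖a‖ ^ p) ^ (q / p) = ‖a‖ ^ q := fun a => by
            rw [← Real.rpow_mul (norm_nonneg _), mul_div_cancel₀ _ hp.ne']
          simp only [e]
          refine integral_mono ?_ ?_ fun z => ?_
          · exact ((Continuous.integral_left_of_compactSpace (c1q.comp continuous_swap)).rpow_const
              fun _ => Or.inr (by positivity)).integrable_of_compactSpace
          · exact (Continuous.integral_left_of_compactSpace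
              (c2.comp continuous_swap)).integrable_of_compactSpace
          · obtain ⟨R, hR⟩ := slice₂ (AddCircle.toCircle z)
            simp only [hR]
            calc _ ≤ ((∫ y, ‖MvPolynomial.eval (torusPoint y) R‖ ^ p) ^ (q / p)) ^ (1 / (q / p)) :=
                  Real.rpow_le_rpow (by positivity) (ih R) (by positivity)
              _ = _ := by
                  rw [← Real.rpow_mul (by positivity), mul_one_div_cancel (by positivity), Real.rpow_one]

/-! ### The Kronecker–Weyl theorem for the primes -/

theorem injective_nth_prime : Function.Injective (Nat.nth Nat.Prime) :=
  Nat.nth_injective Nat.infinite_setOfPred_prime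

theorem factorization_prod_nth_prime {d : ℕ} (a : Fin d → ℕ) (j : ℕ) :
    (∏ i : Fin d, Nat.nth Nat.Prime i ^ a i).factorization (Nat.nth Nat.Prime j) =
      if h : j < d then a ⟨j, h⟩ else 0 := by
  rw [Nat.factorization_prod (g := fun i : Fin d => Nat.nth Nat.Prime i ^ a i) fun i _ => pow_ne_zero _ (Nat.prime_nth_prime i).ne_zero,
    Finset.sum_apply']
  simp only [(Nat.prime_nth_prime _).factorization_pow, Finsupp.single_apply,
    injective_nth_prime.eq_iff]
  split_ifs with h
  · rw [Finset.sum_eq_single ⟨j, h⟩]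
    · simp
    · intro b _ hb
      rw [if_neg]
      rintro rfl
      exact hb rfl
    · simp
  · refine Finset.sum_eq_zero fun i _ => if_neg ?_
    rintro rfl
    exact h i.2

/-- The logarithms of the primes are linearly independent over the integers. -/
theorem sum_mul_log_nth_prime_ne_zero {d : ℕ} {n : Fin d → ℤ} (hn : n ≠ 0) :
    ∑ i, (n i : ℝ) * Real.log (Nat.nth Nat.Prime i) ≠ 0 := by
  intro h
  have hlog : ∀ a : Fin d → ℕ, Real.log ((∏ i : Fin d, Nat.nth Nat.Prime i ^ a i : ℕ) : ℝ) =
      ∑ i, (a i : ℝ) * Real.log (Nat.nth Nat.Prime i) := by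
    intro a
    push_cast
    rw [Real.log_prod fun i _ => pow_ne_zero _ (by exact_mod_cast (Nat.prime_nth_prime i).ne_zero)]
    simp [Real.log_pow]
  have hpos : ∀ a : Fin d → ℕ, (0 : ℝ) < ((∏ i : Fin d, Nat.nth Nat.Prime i ^ a i : ℕ) : ℝ) := fun a => by
    exact Nat.cast_pos.2 <| Finset.prod_pos fun i _ => pow_pos (Nat.prime_nth_prime i).pos _
  -- Separating positive and negative coefficients turns the linear relation into an equality of two
  -- natural numbers, to which unique factorization applies.
  have heq : (∏ i : Fin d, Nat.nth Nat.Prime i ^ (n i).toNat) = ∏ i : Fin d, Nat.nth Nat.Prime i ^ (-n i).toNat := by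
    have : Real.log ((∏ i : Fin d, Nat.nth Nat.Prime i ^ (n i).toNat : ℕ) : ℝ) =
        Real.log ((∏ i : Fin d, Nat.nth Nat.Prime i ^ (-n i).toNat : ℕ) : ℝ) := by
      rw [hlog, hlog, ← sub_eq_zero, ← Finset.sum_sub_distrib, ← h]
      refine Finset.sum_congr rfl fun i _ => ?_
      rw [← sub_mul]
      congr 1
      have := Int.toNat_sub_toNat_neg (n i)
      exact_mod_cast this
    exact_mod_cast Real.log_injOn_pos (hpos _) (hpos _) this
  refine hn (funext fun i => ?_)
  have := congr_arg (fun m => m.factorization (Nat.nth Nat.Prime i)) heq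
  simp only [factorization_prod_nth_prime, i.2, dif_pos, Fin.eta] at this
  have h1 := Int.toNat_sub_toNat_neg (n i)
  simp only [Pi.zero_apply]
  omega

/-- The Kronecker flow on the polytorus, along which the `i`-th coordinate is `p_i ^ (-i t)`. -/
noncomputable def primeFlow (d : ℕ) (t : ℝ) : Fin d → UnitAddCircle :=
  fun i => ((-(t * Real.log (Nat.nth Nat.Prime i) / (2 * Real.pi)) : ℝ) : UnitAddCircle)

theorem continuous_primeFlow (d : ℕ) : Continuous (primeFlow d) :=
  continuous_pi fun i => (AddCircle.continuous_mk' 1).comp (by fun_prop)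

theorem torusPoint_primeFlow {d : ℕ} (t : ℝ) (i : Fin d) :
    torusPoint (primeFlow d t) i = (Nat.nth Nat.Prime i : ℂ) ^ (-(t * Complex.I)) := by
  have hp : (Nat.nth Nat.Prime i : ℂ) ≠ 0 := by exact_mod_cast (Nat.prime_nth_prime i).ne_zero
  simp only [torusPoint, primeFlow, AddCircle.toCircle_apply_mk, Circle.coe_exp]
  rw [Complex.cpow_def_of_ne_zero hp, ← Complex.natCast_log]
  congr 1
  push_cast
  have : (Real.pi : ℂ) ≠ 0 := by exact_mod_cast Real.pi_ne_zero
  field_simp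

theorem mFourier_primeFlow {d : ℕ} (n : Fin d → ℤ) (t : ℝ) :
    UnitAddTorus.mFourier n (primeFlow d t) = Complex.exp
      (((-∑ i, (n i : ℝ) * Real.log (Nat.nth Nat.Prime i) : ℝ) : ℂ) * Complex.I * t) := by
  simp only [UnitAddTorus.mFourier, ContinuousMap.coe_mk, primeFlow, fourier_coe_apply]
  rw [← Complex.exp_sum]
  congr 1
  push_cast
  rw [← Finset.sum_neg_distrib, Finset.sum_mul, Finset.sum_mul]
  refine Finset.sum_congr rfl fun i _ => ?_
  have : (Real.pi : ℂ) ≠ 0 := by exact_mod_cast Real.pi_ne_zero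
  field_simp

/-- Shifting a coordinate of nonzero frequency by half a period changes the sign of the character.
-/
theorem integral_mFourier_eq_zero {d : ℕ} {n : Fin d → ℤ} (hn : n ≠ 0) :
    ∫ x, UnitAddTorus.mFourier n x = 0 := by
  obtain ⟨j, hj⟩ : ∃ j, n j ≠ 0 := Function.ne_iff.1 hn
  refine integral_eq_zero_of_add_right_eq_neg (g := Pi.single j (((1 : ℝ) / 2 / n j : ℝ) : UnitAddCircle))
    fun x => ?_
  simp only [UnitAddTorus.mFourier, ContinuousMap.coe_mk, Pi.add_apply]
  rw [← Finset.mul_prod_erase _ _ (Finset.mem_univ j), ← Finset.mul_prod_erase Finset.univ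
    (fun i => fourier (n i) (x i)) (Finset.mem_univ j), Pi.single_eq_same,
    fourier_add_half_inv_index hj one_pos, neg_mul]
  congr 2
  refine Finset.prod_congr rfl fun i hi => ?_
  rw [Pi.single_eq_of_ne (Finset.ne_of_mem_erase hi), add_zero]

theorem norm_average_le {f : ℝ → ℂ} {C T : ℝ} (hT : 0 < T) (h : ∀ t, ‖f t‖ ≤ C) :
    ‖(1 / (2 * T) : ℂ) * ∫ t in (-T)..T, f t‖ ≤ C := by
  have h1 := intervalIntegral.norm_integral_le_of_norm_le_const (a := -T) (b := T) (f := f)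
    fun t _ => h t
  rw [abs_of_pos (by linarith)] at h1
  have h2 : ‖(1 / (2 * T) : ℂ)‖ = 1 / (2 * T) := by
    have : (1 / (2 * T) : ℂ) = ((1 / (2 * T) : ℝ) : ℂ) := by push_cast; rfl
    rw [this, Complex.norm_real, Real.norm_of_nonneg (by positivity)]
  rw [norm_mul, h2]
  calc _ ≤ 1 / (2 * T) * (C * (T - -T)) := by gcongr
    _ = C := by field_simp; ring

/-- The Kronecker–Weyl theorem for the flow `primeFlow`. -/
theorem tendsto_average_primeFlow {d : ℕ} (F : C(Fin d → UnitAddCircle, ℂ)) :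
    Tendsto (fun T : ℝ => (1 / (2 * T) : ℂ) * ∫ t in (-T)..T, F (primeFlow d t)) atTop
      (𝓝 (∫ x, F x)) := by
  have hint : ∀ (G : C(Fin d → UnitAddCircle, ℂ)) (a b : ℝ),
      IntervalIntegrable (fun t => G (primeFlow d t)) volume a b := fun G a b =>
    (G.continuous.comp (continuous_primeFlow d)).intervalIntegrable a b
  have hmono : ∀ n : Fin d → ℤ, Tendsto (fun T : ℝ => (1 / (2 * T) : ℂ) *
      ∫ t in (-T)..T, UnitAddTorus.mFourier n (primeFlow d t)) atTop
      (𝓝 (∫ x, UnitAddTorus.mFourier n x)) := by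
    intro n
    by_cases hn : n = 0
    · subst hn
      simp only [UnitAddTorus.mFourier_zero, ContinuousMap.one_apply, integral_const,
        probReal_univ, one_smul, intervalIntegral.integral_const]
      refine tendsto_const_nhds.congr' ?_
      filter_upwards [eventually_gt_atTop 0] with T hT
      have : (T : ℂ) ≠ 0 := by exact_mod_cast hT.ne'
      simp
      field_simp
      ring
    · rw [integral_mFourier_eq_zero hn]
      have hl := sum_mul_log_nth_prime_ne_zero hn
      set l := ∑ i, (n i : ℝ) * Real.log (Nat.nth Nat.Prime i)
      have hc : (((-l : ℝ) : ℂ) * Complex.I) ≠ 0 :=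
        mul_ne_zero (by exact_mod_cast neg_ne_zero.2 hl) Complex.I_ne_zero
      rw [tendsto_zero_iff_norm_tendsto_zero]
      -- The integral of a nontrivial exponential of frequency `l` is at most `2 / |l|`, so its mean
      -- over `[-T, T]` is at most `1 / (|l| T)`.
      refine squeeze_zero' (Eventually.of_forall fun _ => norm_nonneg _) (g := fun T => |l|⁻¹ * T⁻¹) ?_ ?_
      · filter_upwards [eventually_gt_atTop 0] with T hT
        simp only [mFourier_primeFlow]
        rw [integral_exp_mul_complex hc]
        have e : ∀ s : ℝ, ‖Complex.exp (((-l : ℝ) : ℂ) * Complex.I * s)‖ = 1 := fun s => by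
          rw [mul_right_comm, ← Complex.ofReal_mul, Complex.norm_exp_ofReal_mul_I]
        have h1 := norm_sub_le (Complex.exp (((-l : ℝ) : ℂ) * Complex.I * T))
          (Complex.exp (((-l : ℝ) : ℂ) * Complex.I * (-T : ℝ)))
        rw [e, e] at h1
        have h2 : ‖(1 / (2 * T) : ℂ)‖ = 1 / (2 * T) := by
          have : (1 / (2 * T) : ℂ) = ((1 / (2 * T) : ℝ) : ℂ) := by push_cast; rfl
          rw [this, Complex.norm_real, Real.norm_of_nonneg (by positivity)]
        rw [norm_mul, h2, norm_div, norm_mul, Complex.norm_I, mul_one, Complex.norm_real, norm_neg,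
          Real.norm_eq_abs]
        have hl' : 0 < |l| := abs_pos.2 hl
        calc _ ≤ 1 / (2 * T) * ((1 + 1) / |l|) := by gcongr
          _ = _ := by field_simp; norm_num
      · simpa using tendsto_inv_atTop_zero.const_mul |l|⁻¹
  have hspan : ∀ G ∈ Submodule.span ℂ (Set.range (UnitAddTorus.mFourier (d := Fin d))),
      Tendsto (fun T : ℝ => (1 / (2 * T) : ℂ) * ∫ t in (-T)..T, G (primeFlow d t)) atTop
      (𝓝 (∫ x, G x)) := by
    intro G hG
    induction hG using Submodule.span_induction with
    | mem G hG => obtain ⟨n, rfl⟩ := hG; exact hmono n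
    | zero => simp
    | add G H _ _ hG hH =>
      simp only [ContinuousMap.add_apply]
      rw [integral_add G.continuous.integrable_of_compactSpace H.continuous.integrable_of_compactSpace]
      refine (hG.add hH).congr fun T => ?_
      rw [intervalIntegral.integral_add (hint G _ _) (hint H _ _), mul_add]
    | smul c G _ hG =>
      simp only [ContinuousMap.smul_apply, smul_eq_mul, integral_const_mul,
        intervalIntegral.integral_const_mul]
      refine (hG.const_mul c).congr fun T => by ring
  have hF : F ∈ closure (Submodule.span ℂ (Set.range (UnitAddTorus.mFourier (d := Fin d))) :
      Set C(Fin d → UnitAddCircle, ℂ)) := by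
    rw [← Submodule.topologicalClosure_coe, UnitAddTorus.span_mFourier_closure_eq_top]
    trivial
  rw [Metric.tendsto_atTop]
  intro ε hε
  obtain ⟨G, hG, hGF⟩ := Metric.mem_closure_iff.1 hF (ε / 3) (by positivity)
  obtain ⟨T₀, hT₀⟩ := Metric.tendsto_atTop.1 (hspan G hG) (ε / 3) (by positivity)
  have hpt : ∀ x, ‖(F - G) x‖ ≤ ε / 3 := fun x =>
    ((F - G).norm_coe_le_norm x).trans (by rw [← dist_eq_norm]; exact hGF.le)
  refine ⟨max T₀ 1, fun T hT => ?_⟩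
  have hT0 : 0 < T := zero_lt_one.trans_le ((le_max_right _ _).trans hT)
  have h1 := norm_average_le hT0 fun t => hpt (primeFlow d t)
  have h2 : ‖∫ x, (F - G) x‖ ≤ ε / 3 := by
    simpa using norm_integral_le_of_norm_le_const (μ := (volume : Measure (Fin d → UnitAddCircle)))
      (Eventually.of_forall hpt)
  have h3 := hT₀ T ((le_max_left _ _).trans hT)
  simp only [ContinuousMap.sub_apply] at h1 h2
  rw [intervalIntegral.integral_sub (hint F _ _) (hint G _ _), mul_sub] at h1
  rw [integral_sub F.continuous.integrable_of_compactSpace G.continuous.integrable_of_compactSpace] at h2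
  rw [dist_eq_norm] at h3 ⊢
  set a := (1 / (2 * T) : ℂ) * ∫ t in (-T)..T, F (primeFlow d t)
  set b := (1 / (2 * T) : ℂ) * ∫ t in (-T)..T, G (primeFlow d t)
  calc ‖a - ∫ x, F x‖ = ‖(a - b) + (b - ∫ x, G x) - ((∫ x, F x) - ∫ x, G x)‖ := by congr 1; ring
    _ ≤ ‖a - b‖ + ‖b - ∫ x, G x‖ + ‖(∫ x, F x) - ∫ x, G x‖ :=
      (norm_sub_le _ _).trans (by gcongr; exact norm_add_le _ _)
    _ < ε := by linarith

/-! ### Hardy norms as norms on the polytorus -/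

/-- The `L^r` norm on the polytorus. -/
noncomputable def torusNorm {d : ℕ} (r : ℝ) (F : (Fin d → UnitAddCircle) → ℂ) : ℝ :=
  (∫ x, ‖F x‖ ^ r) ^ (1 / r)

/-- Bohr's correspondence: means of `D` on the imaginary axis are integrals over the polytorus. -/
theorem tendsto_pMean {d : ℕ} {r : ℝ} (hr : 0 < r) {D : ℂ → ℂ} {F : (Fin d → UnitAddCircle) → ℂ}
    (hF : Continuous F) (hD : ∀ t : ℝ, D (t * Complex.I) = F (primeFlow d t)) :
    Tendsto (pMean r D) atTop (𝓝 (torusNorm r F)) := by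
  have hc : Continuous fun x => ‖F x‖ ^ r := hF.norm.rpow_const fun _ => Or.inr hr.le
  have h := tendsto_average_primeFlow (d := d) ⟨fun x => ((‖F x‖ ^ r : ℝ) : ℂ), by fun_prop⟩
  simp only [ContinuousMap.coe_mk] at h
  rw [show ∫ x, ((‖F x‖ ^ r : ℝ) : ℂ) = ((∫ x, ‖F x‖ ^ r : ℝ) : ℂ) from integral_ofReal] at h
  have h2 : Tendsto (fun T : ℝ => 1 / (2 * T) * ∫ t in (-T)..T, ‖F (primeFlow d t)‖ ^ r) atTop
      (𝓝 (∫ x, ‖F x‖ ^ r)) := by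
    have := (Complex.continuous_re.tendsto _).comp h
    rw [Complex.ofReal_re] at this
    refine this.congr fun T => ?_
    simp only [Function.comp_apply, intervalIntegral.integral_ofReal]
    rw [← Complex.ofReal_re (1 / (2 * T) * ∫ t in (-T)..T, ‖F (primeFlow d t)‖ ^ r)]
    push_cast
    rfl
  have h3 := h2.rpow_const (p := 1 / r) (Or.inr (by positivity))
  refine h3.congr fun T => ?_
  simp only [pMean, hD]

theorem hardyNorm_eq_torusNorm {d : ℕ} {r : ℝ} (hr : 0 < r) {D : ℂ → ℂ}
    {F : (Fin d → UnitAddCircle) → ℂ} (hF : Continuous F)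
    (hD : ∀ t : ℝ, D (t * Complex.I) = F (primeFlow d t)) : hardyNorm r D = torusNorm r F :=
  (tendsto_pMean hr hF hD).limUnder_eq

/-- The exponents of the first `d` primes in `n`. -/
noncomputable def primeExponents (d n : ℕ) : Fin d →₀ ℕ :=
  Finsupp.equivFunOnFinite.symm fun i => n.factorization (Nat.nth Nat.Prime i)

/-- Counted from zero, the `j`-th prime is at least `j + 2`, so no prime beyond the first `d`
divides a positive `n ≤ d`. Hence `⌊x⌋₊` variables suffice for Dirichlet polynomials of length `x`.
-/
theorem prod_pow_primeExponents {d n : ℕ} (hn : n ≠ 0) (hnd : n ≤ d) :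
    ∏ i : Fin d, Nat.nth Nat.Prime i ^ primeExponents d n i = n := by
  refine Nat.eq_of_factorization_eq (Finset.prod_ne_zero_iff.2 fun i _ =>
    pow_ne_zero _ (Nat.prime_nth_prime i).ne_zero) hn fun p => ?_
  by_cases hp : p.Prime
  · obtain ⟨j, rfl⟩ : ∃ j, Nat.nth Nat.Prime j = p := ⟨_, Nat.nth_count hp⟩
    rw [factorization_prod_nth_prime]
    split_ifs with h
    · rfl
    · refine (Nat.factorization_eq_zero_of_lt ?_).symm
      have := Nat.add_two_le_nth_prime j
      omega
  · rw [Nat.factorization_eq_zero_of_not_prime _ hp, Nat.factorization_eq_zero_of_not_prime _ hp]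

/-- `n ↦ n ^ s` as a monoid homomorphism. -/
noncomputable def natCpow (s : ℂ) : ℕ →* ℂ where
  toFun n := (n : ℂ) ^ s
  map_one' := by simp
  map_mul' m n := by
    push_cast
    exact Complex.natCast_mul_natCast_cpow m n s

/-- The Bohr lift of the Dirichlet polynomial with coefficients `a`. -/
noncomputable def bohrLift (d : ℕ) (a : ℕ → ℂ) : MvPolynomial (Fin d) ℂ :=
  ∑ n ∈ Finset.Icc 1 d, MvPolynomial.monomial (primeExponents d n) (a n)

theorem eval_monomial_primeExponents {d n : ℕ} (hn : n ∈ Finset.Icc 1 d) (c s : ℂ) :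
    MvPolynomial.eval (fun i : Fin d => (Nat.nth Nat.Prime i : ℂ) ^ s)
      (MvPolynomial.monomial (primeExponents d n) c) = c * (n : ℂ) ^ s := by
  rw [Finset.mem_Icc] at hn
  rw [MvPolynomial.eval_monomial, Finsupp.prod_fintype _ _ fun i => pow_zero _]
  congr 1
  have := congr_arg (natCpow s) (prod_pow_primeExponents (by omega : n ≠ 0) hn.2)
  simp only [map_prod, map_pow] at this
  exact this

theorem eval_bohrLift (d : ℕ) (a : ℕ → ℂ) (s : ℂ) :
    MvPolynomial.eval (fun i : Fin d => (Nat.nth Nat.Prime i : ℂ) ^ (-s)) (bohrLift d a) =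
      ∑ n ∈ Finset.Icc 1 d, a n * (n : ℂ) ^ (-s) := by
  rw [bohrLift, map_sum]
  exact Finset.sum_congr rfl fun n hn => eval_monomial_primeExponents hn _ _

theorem continuous_eval_torusPoint {d : ℕ} (P : MvPolynomial (Fin d) ℂ) :
    Continuous fun x => MvPolynomial.eval (torusPoint x) P :=
  MvPolynomial.continuous_eval_comp P continuous_torusPoint

theorem eval_torusPoint_primeFlow_bohrLift (d : ℕ) (a : ℕ → ℂ) (t : ℝ) :
    ∑ n ∈ Finset.Icc 1 d, a n * (n : ℂ) ^ (-(t * Complex.I)) =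
      MvPolynomial.eval (torusPoint (primeFlow d t)) (bohrLift d a) := by
  rw [← eval_bohrLift]
  congr 2
  exact funext fun i => (torusPoint_primeFlow t i).symm

/-- A polynomial vanishing on a product of infinite sets is zero, so `P` is nonzero at some point of
the polytorus; continuity does the rest. -/
theorem integral_norm_rpow_eval_torusPoint_pos {d : ℕ} {P : MvPolynomial (Fin d) ℂ} (hP : P ≠ 0) {r : ℝ}
    (hr : 0 < r) : 0 < ∫ x, ‖MvPolynomial.eval (torusPoint x) P‖ ^ r := by
  obtain ⟨x, hx⟩ : ∃ x : Fin d → UnitAddCircle, MvPolynomial.eval (torusPoint x) P ≠ 0 := by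
    by_contra! h
    refine hP (MvPolynomial.funext_set (fun _ => (Submonoid.unitSphere ℂ : Set ℂ)) (fun _ => ?_) fun z hz => ?_)
    · have : Fact ((0 : ℝ) < 1) := ⟨one_pos⟩
      have : Infinite UnitAddCircle := (AddCircle.equivIco (1 : ℝ) 0).infinite_iff.2
        (Set.Ico_infinite (by norm_num)).to_subtype
      have hinj : Function.Injective fun x : UnitAddCircle => (AddCircle.toCircle x : ℂ) :=
        Subtype.val_injective.comp (AddCircle.injective_toCircle one_ne_zero)
      refine Set.Infinite.mono ?_ (Set.infinite_range_of_injective hinj)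
      rintro _ ⟨x, rfl⟩
      exact (AddCircle.toCircle x).2
    · choose x hx using fun i => (AddCircle.homeomorphCircle (T := 1) one_ne_zero).surjective
        (⟨z i, hz i (Set.mem_univ i)⟩ : Circle)
      have hz' : z = torusPoint x := by
        ext i
        rw [torusPoint, ← AddCircle.homeomorphCircle_apply one_ne_zero, hx]
      rw [hz', h, map_zero]
  refine Continuous.integral_pos_of_hasCompactSupport_nonneg_nonzero
    ((continuous_eval_torusPoint P).norm.rpow_const fun _ => Or.inr hr.le)
    (HasCompactSupport.of_compactSpace _) (fun y => by positivity) (x := x) ?_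
  exact (Real.rpow_pos_of_pos (norm_pos_iff.2 hx) r).ne'

theorem torusNorm_eval_pos {d : ℕ} {P : MvPolynomial (Fin d) ℂ} (hP : P ≠ 0) {r : ℝ} (hr : 0 < r) :
    0 < torusNorm r fun x => MvPolynomial.eval (torusPoint x) P :=
  Real.rpow_pos_of_pos (integral_norm_rpow_eval_torusPoint_pos hP hr) _

theorem tendsto_pMean_hardyNorm {r : ℝ} (hr : 0 < r) {x : ℝ} {D : ℂ → ℂ}
    (hD : D ∈ dirichletPolynomials x) :
    Tendsto (pMean r D) atTop (𝓝 (hardyNorm r D)) ∧ (D ≠ 0 → 0 < hardyNorm r D) := by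
  obtain ⟨a, rfl⟩ := hD
  have h := fun t => eval_torusPoint_primeFlow_bohrLift ⌊x⌋₊ a t
  have hc := continuous_eval_torusPoint (bohrLift ⌊x⌋₊ a)
  rw [hardyNorm_eq_torusNorm hr hc h]
  refine ⟨tendsto_pMean hr hc h, fun h0 => torusNorm_eval_pos (fun hP => h0 ?_) hr⟩
  ext s
  rw [← eval_bohrLift, hP, map_zero, Pi.zero_apply]

/-! ### Homogeneous components -/

theorem integral_fourier (n : ℤ) :
    ∫ t : UnitAddCircle, fourier n t = if n = 0 then 1 else 0 := by
  split_ifs with h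
  · subst h
    simp
  · exact integral_eq_zero_of_add_right_eq_neg (fourier_add_half_inv_index h one_pos)

theorem weight_eq_sum {d : ℕ} (w : Fin d → ℕ) (α : Fin d →₀ ℕ) :
    Finsupp.weight w α = ∑ i, α i * w i := by
  rw [Finsupp.weight_apply, Finsupp.sum_fintype _ _ (by simp)]
  rfl

theorem eval_torusPoint_add_monomial {d : ℕ} (w : Fin d → ℕ) (α : Fin d →₀ ℕ) (c : ℂ)
    (x : Fin d → UnitAddCircle) (t : UnitAddCircle) :
    MvPolynomial.eval (torusPoint (x + fun i => w i • t)) (MvPolynomial.monomial α c) =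
      fourier (Finsupp.weight w α : ℤ) t *
        MvPolynomial.eval (torusPoint x) (MvPolynomial.monomial α c) := by
  have e : ∀ i, (AddCircle.toCircle (x i + w i • t) : ℂ) ^ α i =
      (AddCircle.toCircle (x i) : ℂ) ^ α i * (AddCircle.toCircle t : ℂ) ^ (α i * w i) := fun i => by
    rw [AddCircle.toCircle_add, AddCircle.toCircle_nsmul]
    push_cast
    rw [mul_pow, ← pow_mul, mul_comm (w i)]
  rw [MvPolynomial.eval_monomial, MvPolynomial.eval_monomial, Finsupp.prod_fintype _ _ fun i => pow_zero _,
    Finsupp.prod_fintype _ _ fun i => pow_zero _, weight_eq_sum]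
  simp only [torusPoint, Pi.add_apply, e]
  rw [Finset.prod_mul_distrib, Finset.prod_pow_eq_pow_sum, fourier_apply, natCast_zsmul,
    AddCircle.toCircle_nsmul]
  push_cast
  ring

/-- Weighted homogeneous components are averages over rotations. -/
theorem eval_torusPoint_weightedHomogeneousComponent {d : ℕ} (w : Fin d → ℕ) (k : ℕ)
    (P : MvPolynomial (Fin d) ℂ) (x : Fin d → UnitAddCircle) :
    MvPolynomial.eval (torusPoint x) (MvPolynomial.weightedHomogeneousComponent w k P) =
      ∫ t : UnitAddCircle, fourier (-(k : ℤ)) t *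
        MvPolynomial.eval (torusPoint (x + fun i => w i • t)) P := by
  have hcont : ∀ Q : MvPolynomial (Fin d) ℂ, Continuous fun t : UnitAddCircle =>
      fourier (-(k : ℤ)) t * MvPolynomial.eval (torusPoint (x + fun i => w i • t)) Q := fun Q =>
    (fourier (-(k : ℤ))).continuous.mul ((continuous_eval_torusPoint Q).comp (by fun_prop))
  induction P using MvPolynomial.induction_on' with
  | monomial α c =>
    have hα := MvPolynomial.isWeightedHomogeneous_monomial w α c rfl
    simp only [eval_torusPoint_add_monomial, ← mul_assoc, ← fourier_add]
    rw [integral_mul_const, integral_fourier]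
    split_ifs with h
    · have : Finsupp.weight w α = k := by omega
      rw [one_mul, ← this, hα.weightedHomogeneousComponent_same]
    · rw [hα.weightedHomogeneousComponent_ne k (by omega), map_zero, zero_mul]
  | add P Q hP hQ =>
    simp only [map_add, mul_add]
    rw [hP, hQ, integral_add (hcont P).integrable_of_compactSpace (hcont Q).integrable_of_compactSpace]

/-- The component is a mean of rotates of `P` with unimodular factors. Jensen's inequality, where `p
≥ 1` enters, and translation invariance bound its norm. -/
theorem integral_norm_rpow_weightedHomogeneousComponent_le {d : ℕ} (w : Fin d → ℕ) (k : ℕ)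
    (P : MvPolynomial (Fin d) ℂ) {p : ℝ} (hp : 1 ≤ p) :
    ∫ x, ‖MvPolynomial.eval (torusPoint x) (MvPolynomial.weightedHomogeneousComponent w k P)‖ ^ p ≤
      ∫ x, ‖MvPolynomial.eval (torusPoint x) P‖ ^ p := by
  have hp0 : 0 ≤ p := by linarith
  have hc : ∀ Q : MvPolynomial (Fin d) ℂ, Continuous fun x => ‖MvPolynomial.eval (torusPoint x) Q‖ ^ p :=
    fun Q => (continuous_eval_torusPoint Q).norm.rpow_const fun _ => Or.inr hp0
  have hshift : Continuous fun z : (Fin d → UnitAddCircle) × UnitAddCircle => z.1 + fun i => w i • z.2 := by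
    fun_prop
  have hc2 : Continuous fun z : (Fin d → UnitAddCircle) × UnitAddCircle =>
      ‖MvPolynomial.eval (torusPoint (z.1 + fun i => w i • z.2)) P‖ ^ p := (hc P).comp hshift
  calc _ ≤ ∫ x, ∫ t : UnitAddCircle, ‖MvPolynomial.eval (torusPoint (x + fun i => w i • t)) P‖ ^ p := by
        refine integral_mono (hc _).integrable_of_compactSpace
          (Continuous.integral_left_of_compactSpace
            (hc2.comp continuous_swap)).integrable_of_compactSpace fun x => ?_
        have hx : Continuous fun t : UnitAddCircle =>
            ‖MvPolynomial.eval (torusPoint (x + fun i => w i • t)) P‖ :=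
          (continuous_eval_torusPoint P).norm.comp (hshift.comp (Continuous.prodMk_right x))
        calc _ ≤ (∫ t : UnitAddCircle, ‖MvPolynomial.eval (torusPoint (x + fun i => w i • t)) P‖) ^ p := by
              rw [eval_torusPoint_weightedHomogeneousComponent]
              refine Real.rpow_le_rpow (norm_nonneg _) ((norm_integral_le_integral_norm _).trans_eq ?_) hp0
              simp only [norm_mul, fourier_apply, Circle.norm_coe, one_mul]
          _ ≤ _ := (convexOn_rpow hp).map_integral_le
              (Real.continuous_rpow_const hp0).continuousOn isClosed_Ici
              (Eventually.of_forall fun t => norm_nonneg _) hx.integrable_of_compactSpace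
              (hx.rpow_const fun _ => Or.inr hp0).integrable_of_compactSpace
    _ = ∫ t : UnitAddCircle, ∫ x, ‖MvPolynomial.eval (torusPoint (x + fun i => w i • t)) P‖ ^ p :=
        integral_integral_swap hc2.integrable_of_compactSpace
    _ = _ := by
        simp only [integral_add_right_eq_self (fun x => ‖MvPolynomial.eval (torusPoint x) P‖ ^ p)]
        simp

theorem torusNorm_weightedHomogeneousComponent_le {d : ℕ} (w : Fin d → ℕ) (k : ℕ)
    (P : MvPolynomial (Fin d) ℂ) {p : ℝ} (hp : 1 ≤ p) :
    torusNorm p (fun x => MvPolynomial.eval (torusPoint x)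
      (MvPolynomial.weightedHomogeneousComponent w k P)) ≤
      torusNorm p fun x => MvPolynomial.eval (torusPoint x) P :=
  Real.rpow_le_rpow (by positivity) (integral_norm_rpow_weightedHomogeneousComponent_le w k P hp)
    (by positivity)

theorem MvPolynomial.IsHomogeneous.eval_smul {d m : ℕ} {P : MvPolynomial (Fin d) ℂ}
    (hP : P.IsHomogeneous m) (c : ℂ) (z : Fin d → ℂ) :
    MvPolynomial.eval (c • z) P = c ^ m * MvPolynomial.eval z P := by
  rw [MvPolynomial.eval_eq', MvPolynomial.eval_eq', Finset.mul_sum]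
  refine Finset.sum_congr rfl fun α hα => ?_
  have h := hP (MvPolynomial.mem_support_iff.1 hα)
  rw [weight_eq_sum] at h
  simp only [Pi.one_apply, mul_one] at h
  simp only [Pi.smul_apply, smul_eq_mul, mul_pow]
  rw [Finset.prod_mul_distrib, Finset.prod_pow_eq_pow_sum, h]
  ring

/-- Weissler's inequality for homogeneous polynomials. -/
theorem MvPolynomial.IsHomogeneous.torusNorm_le {d m : ℕ} {P : MvPolynomial (Fin d) ℂ}
    (hP : P.IsHomogeneous m) {p q : ℝ} (hp : 0 < p) (hpq : p < q) :
    torusNorm q (fun x => MvPolynomial.eval (torusPoint x) P) ≤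
      √(q / p) ^ m * torusNorm p fun x => MvPolynomial.eval (torusPoint x) P := by
  have hq : 0 < q := hp.trans hpq
  have h := integral_norm_rpow_smul_torusPoint_le hp hpq d P
  have e : ∀ x, ‖MvPolynomial.eval ((√(p / q) : ℂ) • torusPoint x) P‖ ^ q =
      (√(p / q) ^ m) ^ q * ‖MvPolynomial.eval (torusPoint x) P‖ ^ q := fun x => by
    rw [hP.eval_smul, norm_mul, norm_pow, Complex.norm_real, Real.norm_of_nonneg (by positivity),
      Real.mul_rpow (by positivity) (by positivity)]
  simp only [e] at h
  rw [integral_const_mul] at h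
  have h2 := Real.rpow_le_rpow (by positivity) h (by positivity : 0 ≤ 1 / q)
  rw [Real.mul_rpow (by positivity) (by positivity), ← Real.rpow_mul (by positivity),
    mul_one_div_cancel hq.ne', Real.rpow_one, ← Real.rpow_mul (by positivity),
    show q / p * (1 / q) = 1 / p by field_simp] at h2
  have hs : √(p / q) * √(q / p) = 1 := by
    rw [← Real.sqrt_mul (by positivity), div_mul_div_cancel₀ hq.ne', div_self hp.ne', Real.sqrt_one]
  calc _ = √(q / p) ^ m * (√(p / q) ^ m * torusNorm q fun x => MvPolynomial.eval (torusPoint x) P) := by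
        rw [← mul_assoc, ← mul_pow, mul_comm √(q / p), hs, one_pow, one_mul]
    _ ≤ _ := by
        gcongr
        exact h2

/-- The power mean inequality `|∑ a_i|^q ≤ N^(q-1) ∑ |a_i|^q` takes the place of the triangle
inequality; nothing is lost, as all terms share the bound `K`. -/
theorem torusNorm_sum_le {d : ℕ} {ι : Type*} (s : Finset ι) (P : ι → MvPolynomial (Fin d) ℂ) {q K : ℝ}
    (hq : 1 ≤ q) (hK : 0 ≤ K)
    (h : ∀ i ∈ s, torusNorm q (fun x => MvPolynomial.eval (torusPoint x) (P i)) ≤ K) :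
    torusNorm q (fun x => MvPolynomial.eval (torusPoint x) (∑ i ∈ s, P i)) ≤ s.card * K := by
  have hq0 : 0 < q := by linarith
  have hc : ∀ Q : MvPolynomial (Fin d) ℂ, Integrable fun x => ‖MvPolynomial.eval (torusPoint x) Q‖ ^ q :=
    fun Q => ((continuous_eval_torusPoint Q).norm.rpow_const fun _ =>
      Or.inr hq0.le).integrable_of_compactSpace
  have h1 : ∫ x, ‖MvPolynomial.eval (torusPoint x) (∑ i ∈ s, P i)‖ ^ q ≤ (s.card * K) ^ q :=
    calc _ ≤ ∫ x, (s.card : ℝ) ^ (q - 1) * ∑ i ∈ s, ‖MvPolynomial.eval (torusPoint x) (P i)‖ ^ q := by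
          refine integral_mono (hc _) ((integrable_finsetSum _ fun i _ => hc (P i)).const_mul _) fun x => ?_
          have := Real.rpow_sum_le_const_mul_sum_rpow s
            (fun i => ‖MvPolynomial.eval (torusPoint x) (P i)‖) hq
          simp only [abs_norm] at this
          refine le_trans (Real.rpow_le_rpow (norm_nonneg _) ?_ hq0.le) this
          rw [map_sum]
          exact norm_sum_le _ _
      _ = (s.card : ℝ) ^ (q - 1) * ∑ i ∈ s, ∫ x, ‖MvPolynomial.eval (torusPoint x) (P i)‖ ^ q := by
          rw [integral_const_mul, integral_finsetSum _ fun i _ => hc (P i)]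
      _ ≤ (s.card : ℝ) ^ (q - 1) * ∑ i ∈ s, K ^ q := by
          gcongr with i hi
          rw [← Real.rpow_inv_le_iff_of_pos (by positivity) hK hq0, ← one_div]
          exact h i hi
      _ = _ := by
          rw [Finset.sum_const, nsmul_eq_mul, ← mul_assoc, Real.mul_rpow (by positivity) hK]
          congr 1
          rcases s.eq_empty_or_nonempty with rfl | hs
          · simp [hq0.ne']
          · rw [← Real.rpow_add_one (by simpa using hs.ne_empty), sub_add_cancel]
  rw [torusNorm, one_div, Real.rpow_inv_le_iff_of_pos (by positivity) (by positivity) hq0]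
  exact h1

theorem norm_torusPoint {d : ℕ} (x : Fin d → UnitAddCircle) (i : Fin d) : ‖torusPoint x i‖ = 1 :=
  Circle.norm_coe _

theorem torusNorm_congr {d : ℕ} {r : ℝ} {F G : (Fin d → UnitAddCircle) → ℂ}
    (h : ∀ x, ‖F x‖ = ‖G x‖) : torusNorm r F = torusNorm r G := by
  simp only [torusNorm, h]

/-- Weissler's inequality for polynomials that are monomial in the first variables and homogeneous
in the others. -/
theorem torusNorm_le_of_homogeneous_of_le {d m : ℕ} (s : ℕ) {P : MvPolynomial (Fin d) ℂ}
    (h₁ : ∀ α ∈ P.support, ∀ β ∈ P.support, ∀ i : Fin d, i < s → α i = β i)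
    (h₂ : ∀ α ∈ P.support, ∑ i ∈ Finset.univ.filter (fun i : Fin d => s ≤ (i : ℕ)), α i = m) {p q : ℝ} (hp : 0 < p) (hpq : p < q) :
    torusNorm q (fun x => MvPolynomial.eval (torusPoint x) P) ≤
      √(q / p) ^ m * torusNorm p fun x => MvPolynomial.eval (torusPoint x) P := by
  rcases eq_or_ne P 0 with rfl | hP
  · exact (MvPolynomial.isHomogeneous_zero _ _ m).torusNorm_le hp hpq
  obtain ⟨α₀, hα₀⟩ := MvPolynomial.support_nonempty.2 hP
  set R : MvPolynomial (Fin d) ℂ := ∑ α ∈ P.support,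
    MvPolynomial.monomial (α.filter fun i : Fin d => s ≤ (i : ℕ)) (MvPolynomial.coeff α P) with hR
  have hRm : R.IsHomogeneous m := by
    refine MvPolynomial.IsHomogeneous.sum _ _ _ fun α hα => MvPolynomial.isHomogeneous_monomial _ ?_
    rw [Finsupp.degree_eq_sum, ← h₂ α hα, Finset.sum_filter]
    exact Finset.sum_congr rfl fun i _ => Finsupp.filter_apply _ _ _
  -- The common monomial in the first variables has modulus one on the polytorus, so only the degree
  -- `m` in the others counts.
  have hnorm : ∀ x, ‖MvPolynomial.eval (torusPoint x) P‖ = ‖MvPolynomial.eval (torusPoint x) R‖ := by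
    intro x
    have : MvPolynomial.eval (torusPoint x) P =
        (∏ i : Fin d, if s ≤ (i : ℕ) then 1 else torusPoint x i ^ α₀ i) * MvPolynomial.eval (torusPoint x) R := by
      rw [MvPolynomial.eval_eq', hR, map_sum, Finset.mul_sum]
      refine Finset.sum_congr rfl fun α hα => ?_
      rw [MvPolynomial.eval_monomial, Finsupp.prod_fintype _ _ fun i => pow_zero _, mul_left_comm,
        ← Finset.prod_mul_distrib]
      congr 1
      refine Finset.prod_congr rfl fun i _ => ?_
      rw [Finsupp.filter_apply]
      split_ifs with h
      · rw [one_mul]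
      · rw [pow_zero, mul_one, h₁ α hα α₀ hα₀ i (by omega)]
    rw [this, norm_mul, norm_prod, Finset.prod_eq_one, one_mul]
    intro i _
    split_ifs
    · exact norm_one
    · rw [norm_pow, norm_torusPoint, one_pow]
  rw [torusNorm_congr hnorm, torusNorm_congr hnorm]
  exact hRm.torusNorm_le hp hpq

/-! ### Splitting off the small primes by digits in base `B` -/

theorem sum_mul_pow_add_lt {B : ℕ} (s : ℕ) (f : ℕ → ℕ) (hf : ∀ i < s, f i < B) :
    ∑ i ∈ Finset.range s, f i * B ^ i < B ^ s := by
  induction s with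
  | zero => simp
  | succ s ih =>
    rw [Finset.sum_range_succ, pow_succ]
    have h1 := ih fun i hi => hf i (by omega)
    have h2 := Nat.mul_le_mul_right (B ^ s) (hf s (by omega))
    rw [Nat.succ_mul] at h2
    linarith

/-- Uniqueness of the expansion in base `B`, with an unrestricted leading digit. -/
theorem digits_unique {B : ℕ} (s : ℕ) (f g : ℕ → ℕ) (hf : ∀ i < s, f i < B) (hg : ∀ i < s, g i < B)
    {m n : ℕ} (h : ∑ i ∈ Finset.range s, f i * B ^ i + m * B ^ s =
      ∑ i ∈ Finset.range s, g i * B ^ i + n * B ^ s) : (∀ i < s, f i = g i) ∧ m = n := by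
  induction s generalizing m n with
  | zero => simpa using h
  | succ s ih =>
    simp only [Finset.sum_range_succ, pow_succ] at h
    have h' : ∑ i ∈ Finset.range s, f i * B ^ i + (f s + m * B) * B ^ s =
        ∑ i ∈ Finset.range s, g i * B ^ i + (g s + n * B) * B ^ s := by linarith
    obtain ⟨h1, h2⟩ := ih (fun i hi => hf i (by omega)) (fun i hi => hg i (by omega)) h'
    have hfs := hf s (by omega)
    have hgs := hg s (by omega)
    have h3 : f s = g s := by
      have := congr_arg (· % B) h2
      simpa [Nat.mod_eq_of_lt hfs, Nat.mod_eq_of_lt hgs] using this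
    refine ⟨fun i hi => ?_, ?_⟩
    · rcases Nat.lt_succ_iff_lt_or_eq.1 hi with hi | rfl
      exacts [h1 i hi, h3]
    · exact Nat.eq_of_mul_eq_mul_right (by omega : 0 < B) (by omega)

/-- Weissler's inequality for polynomials with bounded exponents in the first `s` variables and
bounded degree in the others. -/
theorem torusNorm_le_of_degrees_le {d : ℕ} (s M : ℕ) {B : ℕ} (hB : 0 < B) {P : MvPolynomial (Fin d) ℂ}
    (h₁ : ∀ α ∈ P.support, ∀ i, α i < B)
    (h₂ : ∀ α ∈ P.support, ∑ i ∈ Finset.univ.filter (fun i : Fin d => s ≤ (i : ℕ)), α i ≤ M) {p q : ℝ} (hp : 1 ≤ p) (hpq : p < q) :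
    torusNorm q (fun x => MvPolynomial.eval (torusPoint x) P) ≤
      ((M + 1) * B ^ s) * (√(q / p) ^ M * torusNorm p fun x => MvPolynomial.eval (torusPoint x) P) := by
  have hp0 : 0 < p := by linarith
  have hqp : 1 ≤ √(q / p) := by
    rw [Real.one_le_sqrt]
    exact ((one_lt_div hp0).2 hpq).le
  have hnn : 0 ≤ torusNorm p fun x => MvPolynomial.eval (torusPoint x) P :=
    Real.rpow_nonneg (integral_nonneg fun x => by positivity) _
  -- With all exponents below `B`, the weight of a monomial has the first `s` exponents as base-`B`
  -- digits and the total degree in the remaining variables as leading digit. One weighted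
  -- homogeneous component therefore fixes all of these.
  set w : Fin d → ℕ := fun i => B ^ min (i : ℕ) s with hw
  -- Exponents are extended by zero because `s` may exceed `d`.
  let ext : (Fin d →₀ ℕ) → ℕ → ℕ := fun α i => if h : i < d then α ⟨i, h⟩ else 0
  have hweight : ∀ α : Fin d →₀ ℕ, Finsupp.weight w α = ∑ i ∈ Finset.range s, ext α i * B ^ i +
      (∑ i ∈ Finset.univ.filter (fun i : Fin d => s ≤ (i : ℕ)), α i) * B ^ s := by
    intro α
    have e : ∑ i ∈ Finset.range s, ext α i * B ^ i = ∑ i ∈ Finset.univ.filter (fun i : Fin d => ¬ s ≤ (i : ℕ)), α i * B ^ (i : ℕ) := by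
      calc _ = ∑ i ∈ Finset.range d with i < s, ext α i * B ^ i := by
            refine (Finset.sum_subset (fun i hi => ?_) fun i hi hi' => ?_).symm
            · exact Finset.mem_range.2 (Finset.mem_filter.1 hi).2
            · have : ¬ i < d := fun h => hi' (Finset.mem_filter.2
                ⟨Finset.mem_range.2 h, Finset.mem_range.1 hi⟩)
              simp [ext, this]
        _ = ∑ i ∈ Finset.range d, if i < s then ext α i * B ^ i else 0 := Finset.sum_filter _ _
        _ = ∑ i : Fin d, if (i : ℕ) < s then ext α i * B ^ (i : ℕ) else 0 :=
            (Fin.sum_univ_eq_sum_range (fun i => if i < s then ext α i * B ^ i else 0) d).symm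
        _ = _ := by
            rw [Finset.sum_filter]
            refine Finset.sum_congr rfl fun i _ => ?_
            simp [ext]
    rw [weight_eq_sum, e, ← Finset.sum_filter_add_sum_filter_not Finset.univ fun i : Fin d => s ≤ (i : ℕ),
      add_comm, Finset.sum_mul]
    congr 1
    · refine Finset.sum_congr rfl fun i hi => ?_
      have := (Finset.mem_filter.1 hi).2
      rw [hw]
      simp only
      rw [min_eq_left (by omega)]
    · refine Finset.sum_congr rfl fun i hi => ?_
      have := (Finset.mem_filter.1 hi).2
      rw [hw]
      simp only
      rw [min_eq_right (by omega)]
  have hext : ∀ α ∈ P.support, ∀ i < s, ext α i < B := by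
    intro α hα i _
    by_cases hi : i < d
    · simpa [ext, hi] using h₁ α hα ⟨i, hi⟩
    · simp only [ext, hi, dite_false]
      exact hB
  have hlt : ∀ α ∈ P.support, Finsupp.weight w α < (M + 1) * B ^ s := by
    intro α hα
    rw [hweight, add_mul, one_mul, add_comm]
    exact Nat.add_lt_add_of_le_of_lt (Nat.mul_le_mul_right _ (h₂ α hα))
      (sum_mul_pow_add_lt s _ (hext α hα))
  have hsum : P = ∑ k ∈ Finset.range ((M + 1) * B ^ s), MvPolynomial.weightedHomogeneousComponent w k P := by
    ext α
    rw [MvPolynomial.coeff_sum]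
    simp only [MvPolynomial.coeff_weightedHomogeneousComponent]
    rw [Finset.sum_ite_eq]
    split_ifs with h
    · rfl
    · by_contra h0
      exact h (Finset.mem_range.2 (hlt α (MvPolynomial.mem_support_iff.2 h0)))
  have key := torusNorm_sum_le (Finset.range ((M + 1) * B ^ s))
    (fun k => MvPolynomial.weightedHomogeneousComponent w k P) (q := q)
    (K := √(q / p) ^ M * torusNorm p fun x => MvPolynomial.eval (torusPoint x) P)
    (by linarith) (by positivity) ?_
  · rw [← hsum] at key
    simpa using key
  intro k _
  have hsupp : ∀ α ∈ (MvPolynomial.weightedHomogeneousComponent w k P).support,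
      α ∈ P.support ∧ Finsupp.weight w α = k := by
    intro α hα
    rw [MvPolynomial.mem_support_iff, MvPolynomial.coeff_weightedHomogeneousComponent] at hα
    rw [MvPolynomial.mem_support_iff]
    split_ifs at hα with h
    · exact ⟨hα, h⟩
    · exact absurd rfl hα
  have huniq : ∀ α ∈ (MvPolynomial.weightedHomogeneousComponent w k P).support,
      ∀ β ∈ (MvPolynomial.weightedHomogeneousComponent w k P).support,
      (∀ i < s, ext α i = ext β i) ∧
        ∑ i ∈ Finset.univ.filter (fun i : Fin d => s ≤ (i : ℕ)), α i = ∑ i ∈ Finset.univ.filter (fun i : Fin d => s ≤ (i : ℕ)), β i := by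
    intro α hα β hβ
    obtain ⟨ha, ha'⟩ := hsupp α hα
    obtain ⟨hb, hb'⟩ := hsupp β hβ
    rw [← hb', hweight, hweight] at ha'
    exact digits_unique s _ _ (hext α ha) (hext β hb) ha'
  obtain ⟨m, hmM, hm⟩ : ∃ m ≤ M, ∀ α ∈ (MvPolynomial.weightedHomogeneousComponent w k P).support,
      ∑ i ∈ Finset.univ.filter (fun i : Fin d => s ≤ (i : ℕ)), α i = m := by
    rcases (MvPolynomial.weightedHomogeneousComponent w k P).support.eq_empty_or_nonempty with h | ⟨β, hβ⟩
    · exact ⟨0, zero_le, by simp [h]⟩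
    · exact ⟨_, h₂ β (hsupp β hβ).1, fun α hα => (huniq α hα β hβ).2⟩
  calc _ ≤ √(q / p) ^ m * torusNorm p fun x => MvPolynomial.eval (torusPoint x)
          (MvPolynomial.weightedHomogeneousComponent w k P) := by
        refine torusNorm_le_of_homogeneous_of_le s (fun α hα β hβ i hi => ?_) hm hp0 hpq
        simpa [ext] using (huniq α hα β hβ).1 i hi
    _ ≤ _ := by
        gcongr
        · exact Real.rpow_nonneg (integral_nonneg fun x => by positivity) _
        · exact torusNorm_weightedHomogeneousComponent_le w k P hp

/-! ### Exponents of integers up to `x` -/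

theorem exists_primeExponents_of_mem_support_bohrLift {d : ℕ} {a : ℕ → ℂ} {α : Fin d →₀ ℕ}
    (hα : α ∈ (bohrLift d a).support) : ∃ n ∈ Finset.Icc 1 d, primeExponents d n = α := by
  obtain ⟨n, hn, h⟩ := Finset.mem_biUnion.1 (MvPolynomial.support_sum hα)
  exact ⟨n, hn, (Finset.mem_singleton.1 (MvPolynomial.support_monomial_subset h)).symm⟩

theorem primeExponents_le_log {d n : ℕ} (hn : n ∈ Finset.Icc 1 d) (i : Fin d) :
    primeExponents d n i ≤ Nat.log 2 d := by
  rw [Finset.mem_Icc] at hn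
  refine Nat.le_log_of_pow_le one_lt_two ?_
  calc 2 ^ primeExponents d n i ≤ Nat.nth Nat.Prime i ^ primeExponents d n i :=
        Nat.pow_le_pow_left (Nat.prime_nth_prime i).two_le _
    _ ≤ n := Nat.le_of_dvd (by omega) (Nat.ordProj_dvd n _)
    _ ≤ d := hn.2

/-- The primes of index at least `s`, counted from zero, are at least `s + 2`; a product of as many
factors `s + 2` is therefore at most `n`. -/
theorem sum_primeExponents_le_log {d n : ℕ} (hn : n ∈ Finset.Icc 1 d) (s : ℕ) :
    ∑ i ∈ Finset.univ.filter (fun i : Fin d => s ≤ (i : ℕ)), primeExponents d n i ≤ Nat.log (s + 2) d := by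
  rw [Finset.mem_Icc] at hn
  refine Nat.le_log_of_pow_le (by omega) ?_
  rw [← Finset.prod_pow_eq_pow_sum]
  calc _ ≤ ∏ i ∈ Finset.univ.filter (fun i : Fin d => s ≤ (i : ℕ)),
          Nat.nth Nat.Prime i ^ primeExponents d n i := by
        refine Finset.prod_le_prod' fun i hi => Nat.pow_le_pow_left ?_ _
        have h1 := (Finset.mem_filter.1 hi).2
        have h2 := Nat.add_two_le_nth_prime i
        omega
    _ ≤ ∏ i : Fin d, Nat.nth Nat.Prime i ^ primeExponents d n i :=
        Finset.prod_le_prod_of_subset_of_one_le' (Finset.filter_subset _ _) fun i _ _ =>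
          Nat.one_le_pow _ _ (Nat.prime_nth_prime i).pos
    _ = n := prod_pow_primeExponents (by omega) hn.2
    _ ≤ d := hn.2

/-- The quotient of two Hardy norms of a Dirichlet polynomial, with the first `s` primes treated
separately. -/
theorem hardyNorm_div_hardyNorm_le {p q : ℝ} (hp : 1 ≤ p) (hpq : p < q) {x : ℝ} {D : ℂ → ℂ}
    (hD : D ∈ dirichletPolynomials x) (h0 : D ≠ 0) (s : ℕ) :
    hardyNorm q D / hardyNorm p D ≤ (Nat.log (s + 2) ⌊x⌋₊ + 1) * (Nat.log 2 ⌊x⌋₊ + 1) ^ s *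
      √(q / p) ^ Nat.log (s + 2) ⌊x⌋₊ := by
  have hpos := (tendsto_pMean_hardyNorm (by linarith : 0 < p) hD).2 h0
  rw [div_le_iff₀ hpos]
  obtain ⟨a, rfl⟩ := hD
  have h := fun t => eval_torusPoint_primeFlow_bohrLift ⌊x⌋₊ a t
  have hc := continuous_eval_torusPoint (bohrLift ⌊x⌋₊ a)
  rw [hardyNorm_eq_torusNorm (by linarith) hc h, hardyNorm_eq_torusNorm (by linarith) hc h]
  have key := torusNorm_le_of_degrees_le (P := bohrLift ⌊x⌋₊ a) s (Nat.log (s + 2) ⌊x⌋₊)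
    (Nat.succ_pos (Nat.log 2 ⌊x⌋₊)) (fun α hα i => ?_) (fun α hα => ?_) hp hpq
  · push_cast at key
    rw [← mul_assoc] at key
    exact key
  · obtain ⟨n, hn, rfl⟩ := exists_primeExponents_of_mem_support_bohrLift hα
    exact Nat.lt_succ_of_le (primeExponents_le_log hn i)
  · obtain ⟨n, hn, rfl⟩ := exists_primeExponents_of_mem_support_bohrLift hα
    exact sum_primeExponents_le_log hn s

/-! ### Asymptotics of the upper bound -/

theorem Real.natLog_le_log_div_log {b : ℕ} (hb : 1 < b) {x : ℝ} (hx : 1 ≤ x) :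
    (Nat.log b ⌊x⌋₊ : ℝ) ≤ Real.log x / Real.log b := by
  have hb' : (1 : ℝ) < b := by exact_mod_cast hb
  rw [le_div_iff₀ (Real.log_pos hb'), ← Real.log_pow]
  refine Real.log_le_log (by positivity) ?_
  have h := Nat.pow_log_le_self b (Nat.floor_pos.2 hx).ne'
  calc ((b : ℝ) ^ Nat.log b ⌊x⌋₊) ≤ (⌊x⌋₊ : ℝ) := by exact_mod_cast h
    _ ≤ x := Nat.floor_le (by linarith)

theorem logIter_one (x : ℝ) : logIter 1 x = Real.log x := rfl

theorem logIter_two (x : ℝ) : logIter 2 x = Real.log (Real.log x) := rfl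

theorem logIter_three (x : ℝ) : logIter 3 x = Real.log (Real.log (Real.log x)) := rfl

/-- These relations are the growth facts behind the later estimates. In particular `(log₂ x)^3 ≤ log
x` places errors of size `log₂ x` within `log x log₃ x / (log₂ x)^2`. -/
theorem eventually_logIter_bounds (K : ℝ) : ∀ᶠ x in atTop,
    K ≤ logIter 3 x ∧ K * logIter 3 x ≤ logIter 2 x ∧ logIter 2 x ^ 3 ≤ logIter 1 x := by
  have h1 : Tendsto Real.log atTop atTop := Real.tendsto_log_atTop
  have h2 := h1.comp h1
  have h3 := h1.comp h2
  have e1 : ∀ᶠ y in atTop, K * Real.log y ≤ y := by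
    filter_upwards [(Real.isLittleO_log_id_atTop.const_mul_left K).bound one_pos, eventually_ge_atTop 0]
      with y hy hy0
    simp only [id, one_mul, Real.norm_eq_abs, abs_of_nonneg hy0] at hy
    exact (le_abs_self _).trans hy
  have e2 : ∀ᶠ y in atTop, Real.log y ^ 3 ≤ y := by
    filter_upwards [(Real.isLittleO_pow_log_id_atTop (n := 3)).bound one_pos, eventually_ge_atTop 0] with y hy hy0
    simp only [id, one_mul, Real.norm_eq_abs, abs_of_nonneg hy0] at hy
    exact (le_abs_self _).trans hy
  filter_upwards [h3.eventually_ge_atTop K, h2.eventually e1, h1.eventually e2] with x a b c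
  exact ⟨a, b, c⟩

/-- The upper bound for the quotients of norms. -/
theorem exists_forall_normRatios_le {p q : ℝ} (hp : 1 ≤ p) (hpq : p < q) :
    ∃ C, ∀ᶠ x in atTop, ∀ r ∈ normRatios q p x, r ≤ Real.exp (logIter 1 x / logIter 2 x *
      (Real.log √(q / p) + C * (logIter 3 x / logIter 2 x))) := by
  have hqp : 1 < √(q / p) := by
    rw [Real.lt_sqrt zero_le_one, one_pow]
    exact (one_lt_div (by linarith)).2 hpq
  have hlam := (Real.log_pos hqp).le
  -- Two from the factor `M + 1`, two from the power with exponent `s`, and `6 log √(q/p)` from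
  -- replacing `M` by `L / l`.
  refine ⟨4 + 6 * Real.log √(q / p), ?_⟩
  filter_upwards [eventually_logIter_bounds 6, eventually_ge_atTop 1] with x hx hx1
  rintro r ⟨D, hD, h0, rfl⟩
  rw [logIter_one, logIter_two, logIter_three] at hx ⊢
  obtain ⟨hu, hl, hL⟩ := hx
  set L := Real.log x
  set l := Real.log L
  set u := Real.log l
  set lam := Real.log √(q / p)
  have hl0 : 36 ≤ l := by linarith
  have hL0 : 36 ≤ L := by nlinarith [mul_pos (by linarith : 0 < l) (by linarith : 0 < l)]
  have hl0' : 0 < l := by linarith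
  have hL0' : 0 < L := by linarith
  -- Small enough that the pieces number only `exp(O(L / l^2))`, large enough that `log (s + 2) ≥ l
  -- - 3u`.
  set s := ⌊L / l ^ 3⌋₊
  have hs1 : (s : ℝ) ≤ L / l ^ 3 := Nat.floor_le (by positivity)
  have hs2 : L / l ^ 3 ≤ ((s + 2 : ℕ) : ℝ) := by
    push_cast
    linarith [(Nat.lt_floor_add_one (L / l ^ 3)).le]
  have hlog2 : l - 3 * u ≤ Real.log ((s + 2 : ℕ) : ℝ) := by
    calc l - 3 * u = Real.log (L / l ^ 3) := by
          rw [Real.log_div hL0'.ne' (by positivity), Real.log_pow]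
          push_cast
          rfl
      _ ≤ _ := Real.log_le_log (by positivity) hs2
  have hlu : 0 < l - 3 * u := by linarith
  set M := Nat.log (s + 2) ⌊x⌋₊
  have hM : (M : ℝ) ≤ L / l * (1 + 6 * (u / l)) :=
    calc (M : ℝ) ≤ L / Real.log ((s + 2 : ℕ) : ℝ) := Real.natLog_le_log_div_log (by omega) hx1
      _ ≤ L / (l - 3 * u) := by gcongr
      _ ≤ _ := by
        rw [div_le_iff₀ hlu]
        have : L / l * (1 + 6 * (u / l)) * (l - 3 * u) = L + L * (3 * u) * (l - 6 * u) / l ^ 2 := by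
          field_simp
          ring
        rw [this]
        have : 0 ≤ L * (3 * u) * (l - 6 * u) / l ^ 2 := by
          have : 0 ≤ l - 6 * u := by linarith
          have : 0 ≤ u := by linarith
          positivity
        linarith
  have hB : ((Nat.log 2 ⌊x⌋₊ : ℕ) : ℝ) + 1 ≤ L ^ 2 := by
    have h1 := Real.natLog_le_log_div_log one_lt_two hx1
    have h2 : Real.log x / Real.log (2 : ℕ) ≤ 2 * L := by
      push_cast
      rw [div_le_iff₀ (Real.log_pos one_lt_two)]
      have := Real.log_two_gt_d9
      change L ≤ _
      nlinarith
    nlinarith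
  have hM1 : (M : ℝ) + 1 ≤ L ^ 2 := by
    have h1 : M ≤ Nat.log 2 ⌊x⌋₊ := Nat.log_anti_left one_lt_two (by omega)
    have h2 : (M : ℝ) ≤ ((Nat.log 2 ⌊x⌋₊ : ℕ) : ℝ) := by exact_mod_cast h1
    linarith
  have hexp : L ^ 2 = Real.exp (2 * l) := by
    rw [two_mul, Real.exp_add, Real.exp_log hL0']
    ring
  have hsq : √(q / p) = Real.exp lam := (Real.exp_log (by linarith)).symm
  calc _ ≤ ((M : ℝ) + 1) * (((Nat.log 2 ⌊x⌋₊ : ℕ) : ℝ) + 1) ^ s * √(q / p) ^ M :=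
        hardyNorm_div_hardyNorm_le hp hpq hD h0 s
    _ ≤ Real.exp (2 * l) * Real.exp (2 * l) ^ s * Real.exp lam ^ M := by
        rw [← hexp, ← hsq]
        gcongr
    _ = Real.exp (2 * l + s * (2 * l) + M * lam) := by
        rw [← Real.exp_nat_mul, ← Real.exp_nat_mul, Real.exp_add, Real.exp_add]
    _ ≤ _ := by
        refine Real.exp_le_exp.2 ?_
        have h1 : 2 * l ≤ 2 * (L * u / l ^ 2) := by
          have : l ≤ L * u / l ^ 2 := by
            rw [le_div_iff₀ (by positivity)]
            nlinarith
          linarith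
        have h2 : s * (2 * l) ≤ 2 * (L * u / l ^ 2) :=
          calc s * (2 * l) ≤ L / l ^ 3 * (2 * l) := by gcongr
            _ = 2 * (L * 1 / l ^ 2) := by field_simp
            _ ≤ _ := by
              gcongr
              linarith
        have h3 : M * lam ≤ L / l * (1 + 6 * (u / l)) * lam := by gcongr
        calc _ ≤ 2 * (L * u / l ^ 2) + 2 * (L * u / l ^ 2) + L / l * (1 + 6 * (u / l)) * lam := by linarith
          _ = _ := by
            field_simp
            ring

/-! ### Even moments of Steinhaus sums -/

theorem integral_mFourier {d : ℕ} (n : Fin d → ℤ) :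
    ∫ x, UnitAddTorus.mFourier n x = if n = 0 then 1 else 0 := by
  split_ifs with h
  · subst h
    simp [UnitAddTorus.mFourier_zero]
  · exact integral_mFourier_eq_zero h

/-- The numbers of times that the values of `f` are taken. -/
def fiberCard {m n : ℕ} (f : Fin m → Fin n) (i : Fin n) : ℤ :=
  (Finset.univ.filter fun j => f j = i).card

theorem fiberCard_comp {m n : ℕ} (f : Fin m → Fin n) (σ : Equiv.Perm (Fin m)) :
    fiberCard (f ∘ σ) = fiberCard f := by
  ext i
  simp only [fiberCard, Nat.cast_inj]
  exact Finset.card_equiv σ fun j => by simp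

theorem exists_perm_of_fiberCard_eq {m n : ℕ} {f g : Fin m → Fin n} (h : fiberCard f = fiberCard g) :
    ∃ σ : Equiv.Perm (Fin m), f ∘ σ = g := by
  have e : ∀ i, Nonempty ({j // g j = i} ≃ {j // f j = i}) := fun i => by
    have hi := congr_fun h i
    simp only [fiberCard, Nat.cast_inj] at hi
    rw [← Fintype.card_eq, Fintype.card_subtype, Fintype.card_subtype, hi]
  have e' := fun i => (e i).some
  exact ⟨Equiv.ofFiberEquiv e', funext fun j => Equiv.ofFiberEquiv_map e' j⟩

theorem prod_torusPoint_comp {m n : ℕ} (f : Fin m → Fin n) (x : Fin n → UnitAddCircle) :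
    ∏ j, torusPoint x (f j) = UnitAddTorus.mFourier (fiberCard f) x := by
  rw [← Finset.prod_fiberwise' Finset.univ f]
  simp only [Finset.prod_const]
  refine Finset.prod_congr rfl fun i _ => ?_
  rw [fiberCard, fourier_apply, natCast_zsmul, AddCircle.toCircle_nsmul]
  push_cast
  rfl

/-- The even moments of a sum of independent Steinhaus variables count coincidences. -/
theorem integral_norm_sum_torusPoint_pow (m n : ℕ) :
    ∫ x : Fin n → UnitAddCircle, ‖∑ i, torusPoint x i‖ ^ (2 * m) =
      (Finset.univ.filter fun z : (Fin m → Fin n) × (Fin m → Fin n) =>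
        fiberCard z.1 = fiberCard z.2).card := by
  have h : ∀ x : Fin n → UnitAddCircle, ((‖∑ i, torusPoint x i‖ ^ (2 * m) : ℝ) : ℂ) =
      ∑ z : (Fin m → Fin n) × (Fin m → Fin n), UnitAddTorus.mFourier (fiberCard z.1 - fiberCard z.2) x := by
    intro x
    have h1 : (∑ i, torusPoint x i) ^ m = ∑ f : Fin m → Fin n, UnitAddTorus.mFourier (fiberCard f) x := by
      rw [Fintype.sum_pow]
      simp only [prod_torusPoint_comp]
    rw [pow_mul', ← norm_pow, h1, Complex.ofReal_pow, ← Complex.mul_conj', map_sum, Finset.sum_mul_sum,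
      ← Finset.sum_product']
    refine Finset.sum_congr rfl fun z _ => ?_
    rw [sub_eq_add_neg, UnitAddTorus.mFourier_add, UnitAddTorus.mFourier_neg]
  have h2 : ((∫ x : Fin n → UnitAddCircle, ‖∑ i, torusPoint x i‖ ^ (2 * m) : ℝ) : ℂ) =
      ∑ z : (Fin m → Fin n) × (Fin m → Fin n), if fiberCard z.1 = fiberCard z.2 then 1 else 0 := by
    rw [← integral_complex_ofReal]
    simp only [h]
    rw [integral_finsetSum _ fun z _ =>
      (ContinuousMap.continuous (UnitAddTorus.mFourier _)).integrable_of_compactSpace]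
    simp only [integral_mFourier, sub_eq_zero]
  rw [Finset.sum_boole] at h2
  exact_mod_cast h2

/-- A map with the same fibre sizes as `f` is `f ∘ σ` for some permutation `σ`, so each `f` has at
most `m!` partners. -/
theorem integral_norm_sum_torusPoint_pow_le (m n : ℕ) :
    ∫ x : Fin n → UnitAddCircle, ‖∑ i, torusPoint x i‖ ^ (2 * m) ≤ m.factorial * n ^ m := by
  rw [integral_norm_sum_torusPoint_pow]
  have : (Finset.univ.filter fun z : (Fin m → Fin n) × (Fin m → Fin n) =>
      fiberCard z.1 = fiberCard z.2) ⊆ Finset.univ.image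
        fun z : (Fin m → Fin n) × Equiv.Perm (Fin m) => (z.1, z.1 ∘ z.2) := by
    rintro ⟨f, g⟩ h
    obtain ⟨σ, hσ⟩ := exists_perm_of_fiberCard_eq (Finset.mem_filter.1 h).2
    exact Finset.mem_image.2 ⟨(f, σ), Finset.mem_univ _, Prod.ext rfl hσ⟩
  have h2 := (Finset.card_le_card this).trans Finset.card_image_le
  rw [Finset.card_univ, Fintype.card_prod, Fintype.card_perm, Fintype.card_fun, Fintype.card_fin,
    Fintype.card_fin, mul_comm] at h2
  exact_mod_cast h2

/-- For injective `f` the `m!` maps `f ∘ σ` are distinct, so each injective `f` contributes `m!`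
coincidences. -/
theorem le_integral_norm_sum_torusPoint_pow (m n : ℕ) :
    (m.factorial * n.descFactorial m : ℝ) ≤
      ∫ x : Fin n → UnitAddCircle, ‖∑ i, torusPoint x i‖ ^ (2 * m) := by
  rw [integral_norm_sum_torusPoint_pow]
  have : (Finset.univ : Finset ((Fin m ↪ Fin n) × Equiv.Perm (Fin m))).card ≤ _ :=
    Finset.card_le_card_of_injOn (t := Finset.univ.filter fun z : (Fin m → Fin n) × (Fin m → Fin n) =>
      fiberCard z.1 = fiberCard z.2) (fun z => (z.1, z.1 ∘ z.2))
      (fun z _ => Finset.mem_coe.2 (Finset.mem_filter.2 ⟨Finset.mem_univ _, (fiberCard_comp _ _).symm⟩)) ?_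
  · rw [Finset.card_univ, Fintype.card_prod, Fintype.card_perm, Fintype.card_embedding_eq, Fintype.card_fin,
      Fintype.card_fin, mul_comm] at this
    exact_mod_cast this
  · rintro ⟨f, σ⟩ _ ⟨g, τ⟩ _ h
    simp only [Prod.mk.injEq, DFunLike.coe_fn_eq] at h
    obtain ⟨rfl, h⟩ := h
    refine Prod.ext rfl (Equiv.ext fun j => f.injective (congr_fun h j))

/-! ### Norms of powers of Steinhaus sums -/

theorem torusNorm_mono {d : ℕ} {F : (Fin d → UnitAddCircle) → ℂ} (hF : Continuous F) {r r' : ℝ}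
    (hr : 0 < r) (h : r ≤ r') : torusNorm r F ≤ torusNorm r' F := by
  have hr' : 0 < r' := by linarith
  have h1 : 1 ≤ r' / r := (one_le_div hr).2 h
  have hc : Continuous fun x => ‖F x‖ ^ r := hF.norm.rpow_const fun _ => Or.inr hr.le
  have hJ := (convexOn_rpow h1).map_integral_le (μ := volume)
    (Real.continuous_rpow_const (by positivity)).continuousOn isClosed_Ici
    (Eventually.of_forall fun x => show (0 : ℝ) ≤ ‖F x‖ ^ r by positivity)
    hc.integrable_of_compactSpace
    (hc.rpow_const fun _ => Or.inr (by positivity : 0 ≤ r' / r)).integrable_of_compactSpace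
  simp only [← Real.rpow_mul (norm_nonneg _), mul_div_cancel₀ _ hr.ne'] at hJ
  have h2 := Real.rpow_le_rpow (by positivity) hJ (by positivity : 0 ≤ 1 / r')
  rw [← Real.rpow_mul (by positivity), show r' / r * (1 / r') = 1 / r by field_simp] at h2
  exact h2

theorem torusNorm_const_mul {d : ℕ} {r : ℝ} (hr : 0 < r) (c : ℂ) (F : (Fin d → UnitAddCircle) → ℂ) :
    torusNorm r (fun x => c * F x) = ‖c‖ * torusNorm r F := by
  simp only [torusNorm, norm_mul, Real.mul_rpow (norm_nonneg _) (norm_nonneg _)]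
  rw [integral_const_mul, Real.mul_rpow (by positivity) (by positivity), ← Real.rpow_mul (norm_nonneg _),
    mul_one_div_cancel hr.ne', Real.rpow_one]

theorem torusNorm_pow {d : ℕ} {r : ℝ} (hr : 0 < r) {k : ℕ} (hk : k ≠ 0) (F : (Fin d → UnitAddCircle) → ℂ) :
    torusNorm r (fun x => F x ^ k) = torusNorm (k * r) F ^ k := by
  have hk' : (0 : ℝ) < k := by positivity
  simp only [torusNorm, norm_pow, ← Real.rpow_natCast, ← Real.rpow_mul (norm_nonneg _)]
  rw [← Real.rpow_mul (by positivity), show 1 / (k * r) * k = 1 / r by field_simp]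

/-- The sum of `n` independent Steinhaus variables. -/
noncomputable def steinhausSum (n : ℕ) (x : Fin n → UnitAddCircle) : ℂ := ∑ i, torusPoint x i

theorem continuous_steinhausSum (n : ℕ) : Continuous (steinhausSum n) :=
  continuous_finsetSum _ fun i _ => (continuous_apply i).comp continuous_torusPoint

theorem torusNorm_steinhausSum (n m : ℕ) :
    torusNorm (2 * m) (steinhausSum n) = (∫ x : Fin n → UnitAddCircle, ‖∑ i, torusPoint x i‖ ^ (2 * m)) ^
      (1 / (2 * m) : ℝ) := by
  rw [torusNorm]
  congr 2 with x
  rw [steinhausSum]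
  exact_mod_cast Real.rpow_natCast _ (2 * m)

/-- Induction by `(m + 1) log ((m + 1) / m) ≥ 1`. The main term is that of Stirling's formula; the
excess `1 + log m` will cost only a power of the degree. -/
theorem log_factorial_le {m : ℕ} (hm : 1 ≤ m) :
    Real.log m.factorial ≤ m * (Real.log m - 1) + 1 + Real.log m := by
  induction m, hm using Nat.le_induction with
  | base => simp
  | succ m hm ih =>
    have hm0 : (0 : ℝ) < m := by positivity
    rw [Nat.factorial_succ, Nat.cast_mul, Real.log_mul (by positivity) (by positivity)]
    have h := Real.one_sub_inv_le_log_of_pos (by positivity : (0 : ℝ) < (m + 1) / m)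
    rw [Real.log_div (by positivity) hm0.ne'] at h
    have h2 : ((m : ℝ) + 1) * (1 - (((m : ℝ) + 1) / m)⁻¹) = 1 := by
      field_simp
      ring
    have h3 := mul_le_mul_of_nonneg_left h (by positivity : (0 : ℝ) ≤ m + 1)
    rw [h2] at h3
    push_cast
    linarith

/-- The falling factorial is at least `(n - m)^m`, and `log m! ≥ m (log m - 1)` by Stirling. -/
theorem le_log_torusNorm_steinhausSum {m n : ℕ} (hm : 1 ≤ m) (hmn : m < n) :
    (Real.log m - 1 + Real.log (n - m)) / 2 ≤ Real.log (torusNorm (2 * m) (steinhausSum n)) := by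
  have hm0 : (0 : ℝ) < m := by positivity
  have hnm : (0 : ℝ) < n - m := by
    have : (m : ℝ) < n := by exact_mod_cast hmn
    linarith
  have h1 : m.factorial * ((n : ℝ) - m) ^ m ≤
      ∫ x : Fin n → UnitAddCircle, ‖∑ i, torusPoint x i‖ ^ (2 * m) := by
    refine le_trans ?_ (le_integral_norm_sum_torusPoint_pow m n)
    gcongr
    have h2 := Nat.pow_sub_le_descFactorial n m
    calc ((n : ℝ) - m) ^ m ≤ ((n + 1 - m : ℕ) : ℝ) ^ m := by
          gcongr
          rw [Nat.cast_sub (by omega)]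
          push_cast
          linarith
      _ ≤ _ := by exact_mod_cast h2
  have hpos : 0 < m.factorial * ((n : ℝ) - m) ^ m := by positivity
  rw [torusNorm_steinhausSum, Real.log_rpow (hpos.trans_le h1)]
  have h3 := Real.log_le_log hpos h1
  rw [Real.log_mul (by positivity) (by positivity), Real.log_pow] at h3
  have h4 := Stirling.le_log_factorial_stirling (by omega : m ≠ 0)
  have h5 : 0 ≤ Real.log m := Real.log_nonneg (by exact_mod_cast hm)
  have h6 : 0 ≤ Real.log (2 * Real.pi) := Real.log_nonneg (by nlinarith [Real.pi_gt_three])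
  rw [div_mul_eq_mul_div, one_mul, le_div_iff₀ (by positivity)]
  linarith

theorem torusNorm_steinhausSum_pos {n : ℕ} (hn : 1 ≤ n) {r : ℝ} (hr : 2 ≤ r) :
    0 < torusNorm r (steinhausSum n) := by
  refine lt_of_lt_of_le ?_ (torusNorm_mono (continuous_steinhausSum n) two_pos hr)
  have h := torusNorm_steinhausSum n 1
  have h1 := le_integral_norm_sum_torusPoint_pow 1 n
  rw [Nat.factorial_one, Nat.descFactorial_one, Nat.cast_one, one_mul] at h1
  have h2 : (0 : ℝ) < n := by exact_mod_cast hn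
  rw [Nat.cast_one, mul_one] at h
  rw [h]
  exact Real.rpow_pos_of_pos (h2.trans_le h1) _

theorem log_torusNorm_steinhausSum_le {m n : ℕ} (hm : 1 ≤ m) (hn : 1 ≤ n) :
    Real.log (torusNorm (2 * m) (steinhausSum n)) ≤
      (Real.log m - 1 + (1 + Real.log m) / m + Real.log n) / 2 := by
  have hm0 : (0 : ℝ) < m := by positivity
  have hpos := torusNorm_steinhausSum_pos hn (r := 2 * m) (by
    have : (1 : ℝ) ≤ m := by exact_mod_cast hm
    linarith)
  have hI : 0 < ∫ x : Fin n → UnitAddCircle, ‖∑ i, torusPoint x i‖ ^ (2 * m) := by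
    refine lt_of_le_of_ne (integral_nonneg fun x => by positivity) fun h => ?_
    rw [torusNorm_steinhausSum, ← h, Real.zero_rpow (by positivity)] at hpos
    exact lt_irrefl _ hpos
  rw [torusNorm_steinhausSum, Real.log_rpow hI]
  have h3 := Real.log_le_log hI (integral_norm_sum_torusPoint_pow_le m n)
  rw [Real.log_mul (by positivity) (by positivity), Real.log_pow] at h3
  have h4 := log_factorial_le hm
  rw [div_mul_eq_mul_div, one_mul, div_le_iff₀ (by positivity)]
  have h5 : (Real.log m - 1 + (1 + Real.log m) / m + Real.log n) / 2 * (2 * m) =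
      m * (Real.log m - 1) + 1 + Real.log m + m * Real.log n := by
    field_simp
    ring
  linarith

/-- The norms of powers of a sum of Steinhaus variables. -/
theorem exp_le_torusNorm_div_torusNorm {p q : ℝ} (hp : 1 ≤ p) (hpq : p < q) {k n : ℕ} (hk : 4 ≤ k)
    (hkn : k * q ≤ n) {c : ℂ} (hc : c ≠ 0) :
    Real.exp (k * Real.log √(q / p) - (4 + Real.log p + Real.log k + k ^ 2 * q / (2 * n))) ≤
      torusNorm q (fun x => c * steinhausSum n x ^ k) / torusNorm p fun x => c * steinhausSum n x ^ k := by
  have hp0 : 0 < p := by linarith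
  have hq0 : 0 < q := by linarith
  have hk4 : (4 : ℝ) ≤ k := by exact_mod_cast hk
  have hk0 : (0 : ℝ) < k := by linarith
  have hn0 : (0 : ℝ) < n := by nlinarith
  rw [torusNorm_const_mul hq0, torusNorm_const_mul hp0, mul_div_mul_left _ _ (norm_ne_zero_iff.2 hc),
    torusNorm_pow hq0 (by omega), torusNorm_pow hp0 (by omega), ← div_pow]
  -- Only even moments are available. As norms increase with the exponent, `k * q` is rounded down
  -- to `2 * m` and `k * p` up to `2 * M`.
  set m := ⌊k * q / 2⌋₊
  set M := ⌈k * p / 2⌉₊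
  have hm1 : (m : ℝ) ≤ k * q / 2 := Nat.floor_le (by positivity)
  have hm2 : k * q / 2 - 1 < m := by linarith [Nat.lt_floor_add_one (k * q / 2)]
  have hM1 : k * p / 2 ≤ (M : ℝ) := Nat.le_ceil _
  have hM2 : (M : ℝ) < k * p / 2 + 1 := Nat.ceil_lt_add_one (by positivity)
  have hm3 : 1 < (m : ℝ) + 1 := by nlinarith
  have hm : 1 ≤ m := by
    have : 0 < (m : ℝ) := by linarith
    exact_mod_cast this
  have hM : 1 ≤ M := by
    have : 0 < (M : ℝ) := by nlinarith
    exact_mod_cast this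
  have hmn : m < n := by
    have : (m : ℝ) < n := by linarith
    exact_mod_cast this
  have hlow := le_log_torusNorm_steinhausSum hm hmn
  have hup := log_torusNorm_steinhausSum_le hM (by omega : 1 ≤ n)
  have hm0 : (0 : ℝ) < m := by positivity
  have hM0 : (0 : ℝ) < M := by positivity
  have hkq : (0 : ℝ) < k * q / 2 := by positivity
  have hkp : (0 : ℝ) < k * p / 2 := by positivity
  have hkk : (k : ℝ) ≤ k * p := le_mul_of_one_le_right hk0.le hp
  have hkk' : (k : ℝ) ≤ k * q := le_mul_of_one_le_right hk0.le (by linarith)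
  have hN1 : 0 < torusNorm (k * q) (steinhausSum n) := torusNorm_steinhausSum_pos (by omega) (by linarith)
  have hN2 : 0 < torusNorm (k * p) (steinhausSum n) := torusNorm_steinhausSum_pos (by omega) (by linarith)
  have h1 := Real.log_le_log (torusNorm_steinhausSum_pos (by omega : 1 ≤ n) (r := 2 * m) (by
      have : (1 : ℝ) ≤ m := by exact_mod_cast hm
      linarith))
    (torusNorm_mono (continuous_steinhausSum n) (by positivity) (by linarith : 2 * (m : ℝ) ≤ k * q))
  have h2 := Real.log_le_log hN2
    (torusNorm_mono (continuous_steinhausSum n) (by positivity) (by linarith : k * p ≤ 2 * (M : ℝ)))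
  have ha1 : Real.log (k * q / 2) - 4 / k ≤ Real.log m := by
    have h := Real.one_sub_inv_le_log_of_pos (by positivity : 0 < m / (k * q / 2))
    rw [Real.log_div hm0.ne' hkq.ne', inv_div] at h
    have : k * q / 2 / m ≤ 1 + 4 / k := by
      rw [div_le_iff₀ hm0]
      have h4 : 1 ≤ 4 / k * (m : ℝ) := by
        rw [div_mul_eq_mul_div, one_le_div hk0]
        linarith
      linarith
    linarith
  have ha2 : Real.log M ≤ Real.log (k * p / 2) + 2 / k := by
    have h := Real.log_le_sub_one_of_pos (by positivity : 0 < M / (k * p / 2))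
    rw [Real.log_div hM0.ne' hkp.ne'] at h
    have : M / (k * p / 2) ≤ 1 + 2 / k := by
      rw [div_le_iff₀ hkp]
      have h4 : (1 + 2 / k) * (k * p / 2) = k * p / 2 + p := by field_simp
      linarith
    linarith
  -- The hypothesis `k * q ≤ n` gives `m ≤ n / 2`, which bounds the loss from `n - m` in place of
  -- `n`.
  have hb : Real.log n - k * q / n ≤ Real.log (n - m) := by
    have hnm : n / 2 ≤ (n : ℝ) - m := by linarith
    have hnm0 : 0 < (n : ℝ) - m := by linarith
    have h := Real.one_sub_inv_le_log_of_pos (by positivity : 0 < (n - m : ℝ) / n)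
    rw [Real.log_div hnm0.ne' hn0.ne', inv_div] at h
    have : n / (n - m : ℝ) ≤ 1 + k * q / n := by
      rw [div_le_iff₀ hnm0]
      have h4 : k * q / n * (n / 2) ≤ k * q / n * (n - m : ℝ) := by gcongr
      have h5 : k * q / n * (n / 2 : ℝ) = k * q / 2 := by field_simp
      linarith
    linarith
  have hc1 : Real.log M ≤ Real.log k + Real.log p := by
    rw [← Real.log_mul hk0.ne' hp0.ne']
    exact Real.log_le_log hM0 (by linarith)
  have hc2 : k / 2 * ((1 + Real.log M) / M) ≤ 1 + Real.log M := by
    have h := Real.log_nonneg (by exact_mod_cast hM : (1 : ℝ) ≤ M)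
    rw [mul_div_assoc', div_le_iff₀ hM0, mul_comm]
    gcongr
    linarith
  have hqp : Real.log √(q / p) = (Real.log (k * q / 2) - Real.log (k * p / 2)) / 2 := by
    rw [Real.log_sqrt (by positivity), ← Real.log_div hkq.ne' hkp.ne']
    congr 2
    field_simp
  -- After multiplication by `k / 2`, rounding costs 2 for `m` and 1 for `M`, the factorial bound
  -- costs `1 + log k + log p`, and passing from `n` to `n - m` costs `k^2 q / (2n)`.
  have key : k * Real.log √(q / p) - (4 + Real.log p + Real.log k + k ^ 2 * q / (2 * n)) ≤
      k * (Real.log (torusNorm (k * q) (steinhausSum n)) -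
        Real.log (torusNorm (k * p) (steinhausSum n))) := by
    have e1 : k / 2 * (4 / k : ℝ) = 2 := by
      field_simp
      norm_num
    have e2 : k / 2 * (2 / k : ℝ) = 1 := by field_simp
    have e3 : k / 2 * (k * q / n : ℝ) = k ^ 2 * q / (2 * n) := by field_simp
    have h3 : (Real.log m - Real.log M + Real.log (n - m) - Real.log n - (1 + Real.log M) / M) / 2 ≤
        Real.log (torusNorm (k * q) (steinhausSum n)) -
        Real.log (torusNorm (k * p) (steinhausSum n)) := by linarith
    have h4 := mul_le_mul_of_nonneg_left h3 hk0.le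
    have h5 := mul_le_mul_of_nonneg_left ha1 (by positivity : 0 ≤ (k : ℝ) / 2)
    have h6 := mul_le_mul_of_nonneg_left ha2 (by positivity : 0 ≤ (k : ℝ) / 2)
    have h7 := mul_le_mul_of_nonneg_left hb (by positivity : 0 ≤ (k : ℝ) / 2)
    rw [mul_sub, e1] at h5
    rw [mul_add, e2] at h6
    rw [mul_sub, e3] at h7
    rw [hqp]
    linarith
  calc _ ≤ Real.exp (k * (Real.log (torusNorm (k * q) (steinhausSum n)) -
        Real.log (torusNorm (k * p) (steinhausSum n)))) := Real.exp_le_exp.2 key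
    _ = _ := by rw [Real.exp_nat_mul, Real.exp_sub, Real.exp_log hN1, Real.exp_log hN2]

/-! ### The extremal Dirichlet polynomials -/

theorem extremalPoly_apply (x : ℝ) (s : ℂ) :
    extremalPoly x s = ((1 / √(extremalVars x : ℝ) : ℝ) : ℂ) ^ extremalDegree x *
      (∑ i : Fin (extremalVars x), (Nat.nth Nat.Prime i : ℂ) ^ (-s)) ^ extremalDegree x := by
  rw [extremalPoly, bohrTransform, steinhausPoly, map_pow, map_mul, MvPolynomial.eval_C, map_sum, mul_pow,
    Finset.sum_range]
  simp only [MvPolynomial.eval_X]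

theorem nth_prime_le_of_lt_primeCounting {i N : ℕ} (h : i < Nat.primeCounting N) :
    Nat.nth Nat.Prime i ≤ N :=
  Nat.lt_succ_iff.1 (Nat.nth_lt_of_lt_count h)

/-- A product of `k` primes, each at most `x^(1/k)`, is at most `x`. The coefficient of `m` counts
the `k`-tuples of primes with product `m`. -/
theorem extremalPoly_mem {x : ℝ} (hx : 0 ≤ x) (hk : extremalDegree x ≠ 0) :
    extremalPoly x ∈ dirichletPolynomials x := by
  set k := extremalDegree x with hkdef
  set n := extremalVars x with hn
  set c := ((1 / √(n : ℝ) : ℝ) : ℂ) ^ k with hc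
  have hmem : ∀ f : Fin k → Fin n, ∏ j, Nat.nth Nat.Prime (f j) ∈ Finset.Icc 1 ⌊x⌋₊ := by
    intro f
    refine Finset.mem_Icc.2 ⟨Finset.prod_pos fun j _ => (Nat.prime_nth_prime _).pos, Nat.le_floor ?_⟩
    push_cast
    calc ∏ j, (Nat.nth Nat.Prime (f j) : ℝ) ≤ ∏ _j : Fin k, x ^ (1 / (k : ℝ)) := by
          refine Finset.prod_le_prod (fun j _ => by positivity) fun j _ => ?_
          have h : Nat.nth Nat.Prime (f j) ≤ ⌊x ^ (1 / (k : ℝ))⌋₊ :=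
            nth_prime_le_of_lt_primeCounting (f j).2
          exact (Nat.cast_le.2 h).trans (Nat.floor_le (by positivity))
      _ = x := by
          rw [Finset.prod_const, Finset.card_univ, Fintype.card_fin, ← Real.rpow_mul_natCast hx,
            one_div_mul_cancel (by exact_mod_cast hk), Real.rpow_one]
  refine ⟨fun m => c * (Finset.univ.filter fun f : Fin k → Fin n =>
    ∏ j, Nat.nth Nat.Prime (f j) = m).card, funext fun s => ?_⟩
  have h : ∀ f : Fin k → Fin n, ∏ j, (Nat.nth Nat.Prime (f j) : ℂ) ^ (-s) =
      ((∏ j, Nat.nth Nat.Prime (f j) : ℕ) : ℂ) ^ (-s) := fun f =>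
    (map_prod (natCpow (-s)) (fun j => Nat.nth Nat.Prime (f j)) Finset.univ).symm
  rw [extremalPoly_apply, ← hkdef, ← hn, ← hc, Fintype.sum_pow]
  simp only [h]
  rw [← Finset.sum_fiberwise_of_maps_to (fun f _ => hmem f), Finset.mul_sum]
  refine Finset.sum_congr rfl fun m _ => ?_
  rw [mul_assoc, Finset.sum_congr rfl fun f hf => by rw [(Finset.mem_filter.1 hf).2], Finset.sum_const,
    nsmul_eq_mul]

theorem extremalPoly_ne_zero {x : ℝ} (hn : extremalVars x ≠ 0) : extremalPoly x ≠ 0 := by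
  intro h
  have h0 := congr_fun h 0
  rw [extremalPoly_apply, Pi.zero_apply] at h0
  simp [hn] at h0

theorem hardyNorm_extremalPoly {r : ℝ} (hr : 0 < r) (x : ℝ) :
    hardyNorm r (extremalPoly x) = torusNorm r fun θ =>
      ((1 / √(extremalVars x : ℝ) : ℝ) : ℂ) ^ extremalDegree x *
        steinhausSum (extremalVars x) θ ^ extremalDegree x := by
  refine hardyNorm_eq_torusNorm hr (continuous_const.mul ((continuous_steinhausSum _).pow _)) fun t => ?_
  rw [extremalPoly_apply, steinhausSum]
  simp only [torusPoint_primeFlow]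

/-- The margin between `log 2` and `1 / 2` in Chebyshev's bound absorbs the logarithmic term, which
is estimated by the tangent line of `log` at `128 = 2^7`. -/
theorem div_two_mul_log_le_primeCounting {y : ℝ} (hy : 1000 ≤ y) :
    y / (2 * Real.log y) ≤ Nat.primeCounting ⌊y⌋₊ := by
  refine le_trans ?_ (Chebyshev.pi_ge' (by linarith : 1 < y))
  have hlog : 0 < Real.log y := Real.log_pos (by linarith)
  have h1 : Real.log (y + 2) ≤ (y + 2) / 128 - 1 + 7 * Real.log 2 := by
    have h := Real.log_le_sub_one_of_pos (by positivity : 0 < (y + 2) / 128)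
    rw [Real.log_div (by positivity) (by norm_num), show (128 : ℝ) = 2 ^ 7 by norm_num, Real.log_pow] at h
    push_cast at h
    linarith
  have h2 := Real.log_two_gt_d9
  have h3 := Real.log_two_lt_d9
  rw [← div_div]
  gcongr
  nlinarith

/-- The number of variables and the degree of the extremal polynomials. -/
theorem eventually_extremal_bounds (K : ℝ) : ∀ᶠ x in atTop,
    logIter 1 x / logIter 2 x * (1 - logIter 3 x / logIter 2 x) - 1 ≤ extremalDegree x ∧
    extremalDegree x ≤ logIter 1 x / logIter 2 x ∧ logIter 1 x / 4 ≤ extremalVars x ∧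
    K ≤ extremalDegree x := by
  filter_upwards [eventually_logIter_bounds (36 + |K|), eventually_gt_atTop 1] with x hx hx1
  rw [extremalVars, extremalDegree]
  rw [logIter_one, logIter_two, logIter_three] at hx ⊢
  obtain ⟨hu, hl, hL⟩ := hx
  set L := Real.log x with hLdef
  set l := Real.log L
  set u := Real.log l
  have hK := abs_nonneg K
  have hu0 : 0 < u := by linarith
  have hl0 : (36 + |K|) ^ 2 ≤ l := by nlinarith
  have hl1 : 36 + |K| ≤ l := by nlinarith
  have hl0' : 0 < l := by linarith
  have hl3 : 36 * l ≤ L := by nlinarith [mul_pos hl0' hl0', sq_nonneg l]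
  have hul : u ≤ l := by nlinarith
  have hL0 : 0 < L := by linarith
  set k := ⌊L / (l + u)⌋₊
  have hk1 : (k : ℝ) ≤ L / (l + u) := Nat.floor_le (by positivity)
  have hk2 : L / (l + u) - 1 ≤ k := by linarith [Nat.lt_floor_add_one (L / (l + u))]
  have hk3 : L / l * (1 - u / l) ≤ L / (l + u) := by
    rw [le_div_iff₀ (by positivity)]
    have : L / l * (1 - u / l) * (l + u) = L - L * (u / l) ^ 2 := by
      field_simp
      ring
    rw [this]
    have : 0 ≤ L * (u / l) ^ 2 := by positivity
    linarith
  have hkK : |K| + 1 ≤ L / (l + u) := by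
    rw [le_div_iff₀ (by positivity)]
    have h1 : (|K| + 1) * (l + u) ≤ (|K| + 1) * (2 * l) := by
      gcongr
      linarith
    have h2 : (|K| + 1) * 2 * l ≤ l ^ 2 * l := by
      gcongr
      nlinarith
    nlinarith
  have hk0 : (0 : ℝ) < k := by
    have : 0 < k := Nat.floor_pos.2 (by linarith)
    exact_mod_cast this
  refine ⟨by linarith, hk1.trans (by gcongr; linarith), ?_, by linarith [le_abs_self K]⟩
  -- The reason for the form of `k(x)`: `k ≤ L / (l + u)` means `log (x^(1/k)) ≥ l + u = log (L l)`.
  -- The primes up to `L l` then number at least `L / 4`.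
  have hy : L * l ≤ x ^ (1 / (k : ℝ)) := by
    rw [← Real.log_le_log_iff (by positivity) (by positivity), Real.log_mul hL0.ne' hl0'.ne',
      Real.log_rpow (by linarith), div_mul_eq_mul_div, one_mul, le_div_iff₀ hk0]
    rw [le_div_iff₀ (by positivity)] at hk1
    linarith
  calc L / 4 = L * l / (2 * (2 * l)) := by
        field_simp
        norm_num
    _ ≤ L * l / (2 * Real.log (L * l)) := by
        rw [Real.log_mul hL0.ne' hl0'.ne']
        gcongr
        change l + u ≤ _
        linarith
    _ ≤ Nat.primeCounting ⌊L * l⌋₊ := div_two_mul_log_le_primeCounting (by nlinarith)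
    _ ≤ _ := by exact_mod_cast Nat.monotone_primeCounting (Nat.floor_le_floor hy)

theorem exists_le_hardyNorm_extremalPoly_div {p q : ℝ} (hp : 1 ≤ p) (hpq : p < q) :
    ∃ C, ∀ᶠ x in atTop, extremalPoly x ∈ dirichletPolynomials x ∧ extremalPoly x ≠ 0 ∧
      Real.exp (logIter 1 x / logIter 2 x * (Real.log √(q / p) - C * (logIter 3 x / logIter 2 x))) ≤
        hardyNorm q (extremalPoly x) / hardyNorm p (extremalPoly x) := by
  have hqp : 1 < √(q / p) := by
    rw [Real.lt_sqrt zero_le_one, one_pow]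
    exact (one_lt_div (by linarith)).2 hpq
  have hlam := (Real.log_pos hqp).le
  have hlogp := Real.log_nonneg hp
  -- The first term comes from the factor `1 - u / l` in the degree, the second from the floor in
  -- the degree together with the loss `4 + log p + log k`, and `2q` from `k^2 q / (2n)`.
  refine ⟨Real.log √(q / p) + (Real.log √(q / p) + 5 + Real.log p) + 2 * q, ?_⟩
  filter_upwards [eventually_logIter_bounds (6 + 4 * q), eventually_extremal_bounds 4,
    eventually_ge_atTop 1] with x hx hx' hx1
  rw [logIter_one, logIter_two, logIter_three] at hx hx' ⊢
  obtain ⟨hu, hl, hL⟩ := hx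
  obtain ⟨hk1, hk2, hn, hk4⟩ := hx'
  set L := Real.log x
  set l := Real.log L
  set u := Real.log l
  set lam := Real.log √(q / p)
  set k := extremalDegree x with hk
  set n := extremalVars x with hndef
  have hq0 : 0 < q := by linarith
  have hu1 : 1 ≤ u := by linarith
  have hl1 : 6 + 4 * q ≤ l := by nlinarith
  have hl0 : 0 < l := by linarith
  have hL0 : 0 < L := by nlinarith [pow_pos hl0 3]
  have hn0 : (0 : ℝ) < n := by linarith
  have hk0 : (0 : ℝ) < k := by linarith
  refine ⟨extremalPoly_mem (by linarith) (by exact_mod_cast hk0.ne'),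
    extremalPoly_ne_zero (by exact_mod_cast hn0.ne'), ?_⟩
  rw [hardyNorm_extremalPoly (by linarith), hardyNorm_extremalPoly (by linarith)]
  have hkn : k * q ≤ n :=
    calc k * q ≤ L / l * q := by
          gcongr
      _ = L / (4 * l) * (4 * q) := by field_simp
      _ ≤ L / (4 * l) * l := by
          gcongr
          linarith
      _ = L / 4 := by field_simp
      _ ≤ n := hn
  refine le_trans (Real.exp_le_exp.2 ?_) (exp_le_torusNorm_div_torusNorm hp hpq (by exact_mod_cast hk4) hkn ?_)
  swap
  · refine pow_ne_zero _ (Complex.ofReal_ne_zero.2 ?_)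
    positivity
  have hW : l ≤ L * u / l ^ 2 := by
    rw [le_div_iff₀ (by positivity)]
    nlinarith
  have h1 : Real.log k ≤ l := by
    refine Real.log_le_log hk0 (hk2.trans (div_le_self hL0.le (by linarith)))
  have h2 : k ^ 2 * q / (2 * n) ≤ 2 * q * (L * u / l ^ 2) := by
    calc k ^ 2 * q / (2 * n) ≤ (L / l) ^ 2 * q / (2 * (L / 4)) := by
          gcongr
      _ = 2 * q * (L * 1 / l ^ 2) := by
          field_simp
          ring
      _ ≤ _ := by
          gcongr
  have h3 : (L / l * (1 - u / l) - 1) * lam ≤ k * lam := by gcongr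
  have h4 : (lam + 5 + Real.log p) * l ≤ (lam + 5 + Real.log p) * (L * u / l ^ 2) := by gcongr
  have h5 : (lam + 4 + Real.log p) * 1 ≤ (lam + 4 + Real.log p) * l := by
    gcongr
    linarith
  calc _ = (L / l * (1 - u / l)) * lam - (lam + 5 + Real.log p) * (L * u / l ^ 2) -
        2 * q * (L * u / l ^ 2) := by
        field_simp
        ring
    _ ≤ _ := by linarith

/-! ### Conclusion -/

/-- The supremum of the quotients of norms is finite and lies between the two bounds. -/
theorem eventually_isLUB_mho {p q : ℝ} (hp : 1 ≤ p) (hpq : p < q) :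
    ∃ C, ∀ᶠ x in atTop, IsLUB (normRatios q p x) (mho q p x) ∧
      Real.exp (logIter 1 x / logIter 2 x * (Real.log √(q / p) - C * (logIter 3 x / logIter 2 x))) ≤
        mho q p x ∧
      mho q p x ≤
        Real.exp (logIter 1 x / logIter 2 x * (Real.log √(q / p) + C * (logIter 3 x / logIter 2 x))) := by
  obtain ⟨C₁, h₁⟩ := exists_forall_normRatios_le hp hpq
  obtain ⟨C₂, h₂⟩ := exists_le_hardyNorm_extremalPoly_div hp hpq
  refine ⟨max C₁ C₂, ?_⟩
  filter_upwards [h₁, h₂, eventually_logIter_bounds 1] with x h₁ ⟨hmem, h0, hle⟩ ⟨hu, hl, hL⟩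
  have hl1 : 1 ≤ logIter 2 x := by linarith
  have hL1 : 1 ≤ logIter 1 x := (one_le_pow₀ hl1).trans hL
  have hr : hardyNorm q (extremalPoly x) / hardyNorm p (extremalPoly x) ∈ normRatios q p x :=
    ⟨_, hmem, h0, rfl⟩
  have hLUB : IsLUB (normRatios q p x) (mho q p x) := isLUB_csSup ⟨_, hr⟩ ⟨_, h₁⟩
  refine ⟨hLUB, le_trans ?_ (hle.trans (hLUB.1 hr)), (hLUB.2 h₁).trans ?_⟩
  · gcongr
    exact le_max_right _ _
  · gcongr
    exact le_max_left _ _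

theorem theorem1 (p q : ℝ) (hp : 1 ≤ p) (hpq : p < q) :
    -- the norms are well defined
    (∀ r : ℝ, 1 ≤ r → ∀ x : ℝ, ∀ D ∈ dirichletPolynomials x,
      Tendsto (pMean r D) atTop (𝓝 (hardyNorm r D)) ∧ (D ≠ 0 → 0 < hardyNorm r D)) ∧
    -- the asymptotic formula for the supremum
    (∃ E : ℝ → ℝ, E =O[atTop] (fun x => logIter 3 x / logIter 2 x) ∧
      ∀ᶠ x in atTop, IsLUB (normRatios q p x) (mho q p x) ∧
        mho q p x =
          Real.exp (logIter 1 x / logIter 2 x * (Real.log √(q / p) + E x))) ∧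
    -- the polynomials `D_x` satisfy the lower bound
    (∃ E : ℝ → ℝ, E =O[atTop] (fun x => logIter 3 x / logIter 2 x) ∧
      ∀ᶠ x in atTop, extremalPoly x ∈ dirichletPolynomials x ∧ extremalPoly x ≠ 0 ∧
        Real.exp (logIter 1 x / logIter 2 x * (Real.log √(q / p) + E x)) ≤
          hardyNorm q (extremalPoly x) / hardyNorm p (extremalPoly x)) := by
  refine ⟨fun r hr x D hD => tendsto_pMean_hardyNorm (by linarith) hD, ?_, ?_⟩
  · obtain ⟨C, hC⟩ := eventually_isLUB_mho hp hpq
    -- The error term is obtained by solving the formula for it; the two bounds on `mho` then give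
    -- its size.
    refine ⟨fun x => Real.log (mho q p x) / (logIter 1 x / logIter 2 x) - Real.log √(q / p),
      IsBigO.of_bound C ?_, ?_⟩
    · filter_upwards [hC, eventually_logIter_bounds 1] with x ⟨_, hlow, hup⟩ ⟨hu, hl, hL⟩
      have hl1 : 1 ≤ logIter 2 x := by linarith
      have hL1 : 1 ≤ logIter 1 x := (one_le_pow₀ hl1).trans hL
      have hw : 0 < logIter 1 x / logIter 2 x := by positivity
      have hpos := (Real.exp_pos _).trans_le hlow
      have h1 := (Real.le_log_iff_exp_le hpos).2 hlow
      have h2 := (Real.log_le_iff_le_exp hpos).2 hup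
      rw [mul_comm, ← le_div_iff₀ hw] at h1
      rw [mul_comm, ← div_le_iff₀ hw] at h2
      rw [Real.norm_eq_abs, Real.norm_of_nonneg (by positivity), abs_le]
      constructor <;> linarith
    · filter_upwards [hC, eventually_logIter_bounds 1] with x ⟨hLUB, hlow, _⟩ ⟨hu, hl, hL⟩
      have hl1 : 1 ≤ logIter 2 x := by linarith
      have hL1 : 1 ≤ logIter 1 x := (one_le_pow₀ hl1).trans hL
      have hw : logIter 1 x / logIter 2 x ≠ 0 := by positivity
      refine ⟨hLUB, ?_⟩
      rw [add_sub_cancel, mul_div_cancel₀ _ hw, Real.exp_log ((Real.exp_pos _).trans_le hlow)]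
  · obtain ⟨C, hC⟩ := exists_le_hardyNorm_extremalPoly_div hp hpq
    refine ⟨fun x => -C * (logIter 3 x / logIter 2 x), (isBigO_refl _ _).const_mul_left _, ?_⟩
    filter_upwards [hC] with x hx
    rw [neg_mul, ← sub_eq_add_neg]
    exact hx
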